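/- Let $\mathbb D$ be the open unit disk and let $\mathcal S_b$ be the class of bounded univalent (holomorphic injective) functions $\varphi:\mathbb D\to\mathbb C$ with $\varphi(0)=0$, $\varphi'(0)=1$. For $\varphi\in\mathcal S_b$ and $\tau\in\mathbb C$ put $[\varphi']^\tau=\exp(\tau\log\varphi')$, where $\log\varphi'$ is the holomorphic branch on $\mathbb D$ that vanishes at $0$, and $$M_\tau[\varphi'](r)=\frac1{2\pi}\int_{-\pi}^{\pi}\big|[\varphi'(re^{i\theta})]^\tau\big|\,d\theta,\qquad 0<r<1.$$ Let $\beta_\varphi(\tau)$ be the infimum of all $\beta>0$ such that $M_\tau[\varphi'](r)=O\big((1-r)^{-\beta}\big)$ as $r\to1^-$, and let $\mathrm B_b(\tau)=\sup_{\varphi\in\mathcal S_b}\beta_\varphi(\tau)$ be the universal integral means spectrum of $\mathcal S_b$. Then $\mathrm B_b(2-\tau)$ is finite for all sufficiently small complex $\tau\neq0$, and $$\mathrm B_b(2-\tau)=1-\operatorname{Re}\tau+O\Big(|\tau|^2\log\frac1{|\tau|}\Big),\qquad \tau\in\mathbb C,\ |\tau|\to0^+.$$ -/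

import Mathlib

open Filter Topology Asymptotics

noncomputable section

namespace IntegralMeans

/-- The class `S_b`: bounded univalent (holomorphic and injective) functions on the open unit disk,
normalized by `φ 0 = 0` and `φ' 0 = 1`. -/
structure BoundedSchlicht (φ : ℂ → ℂ) : Prop where
  holo : DifferentiableOn ℂ φ (Metric.ball 0 1)
  inj : Set.InjOn φ (Metric.ball 0 1)
  map_zero : φ 0 = 0
  deriv_zero : deriv φ 0 = 1
  bdd : Bornology.IsBounded (φ '' Metric.ball 0 1)

/-- The branch of `log φ'` on the unit disk which vanishes at the origin, i.e. the integral
of `φ'' / φ'` along the segment from `0` to `z`. -/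
def logDerivative (φ : ℂ → ℂ) (z : ℂ) : ℂ :=
  ∫ t in (0 : ℝ)..1, z * logDeriv (deriv φ) ((t : ℂ) * z)

/-- The function `logDerivative φ` is a holomorphic logarithm of `φ'` on the unit disk. -/
theorem logDerivative_spec {φ : ℂ → ℂ} (hφ : DifferentiableOn ℂ φ (Metric.ball 0 1))
    (h0 : deriv φ 0 = 1) (hne : ∀ z ∈ Metric.ball (0 : ℂ) 1, deriv φ z ≠ 0) :
    logDerivative φ 0 = 0 ∧ DifferentiableOn ℂ (logDerivative φ) (Metric.ball 0 1) ∧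
      ∀ z ∈ Metric.ball (0 : ℂ) 1, Complex.exp (logDerivative φ z) = deriv φ z := by
  have hd : DifferentiableOn ℂ (deriv φ) (Metric.ball 0 1) := hφ.deriv Metric.isOpen_ball
  have hl : DifferentiableOn ℂ (logDeriv (deriv φ)) (Metric.ball 0 1) :=
    (hd.deriv Metric.isOpen_ball).div hd hne
  obtain ⟨G, hG⟩ := hl.isExactOn_ball
  have key : ∀ z ∈ Metric.ball (0 : ℂ) 1, logDerivative φ z = G z - G 0 := by
    intro z hz
    have hmem : ∀ t ∈ Set.uIcc (0 : ℝ) 1, (t : ℂ) * z ∈ Metric.ball (0 : ℂ) 1 := by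
      intro t ht
      rw [Set.uIcc_of_le zero_le_one] at ht
      have hz' : ‖z‖ < 1 := by simpa using hz
      have : ‖(t : ℂ) * z‖ < 1 := by
        rw [norm_mul, Complex.norm_real, Real.norm_of_nonneg ht.1]
        nlinarith [norm_nonneg z, ht.2, ht.1]
      simpa using this
    have hder : ∀ t ∈ Set.uIcc (0 : ℝ) 1, HasDerivAt (fun t : ℝ => G ((t : ℂ) * z))
        (z * logDeriv (deriv φ) ((t : ℂ) * z)) t := by
      intro t ht
      have h1 : HasDerivAt (fun s : ℂ => s * z) z (t : ℂ) := by
        simpa using (hasDerivAt_id (t : ℂ)).mul_const z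
      have h2 := (HasDerivAt.comp (t : ℂ) (hG _ (hmem t ht)) h1).comp_ofReal
      simpa [mul_comm, Function.comp_def] using h2
    have hcont : ContinuousOn (fun t : ℝ => z * logDeriv (deriv φ) ((t : ℂ) * z))
        (Set.uIcc (0 : ℝ) 1) := by
      refine continuousOn_const.mul (hl.continuousOn.comp ?_ hmem)
      fun_prop
    have h3 := intervalIntegral.integral_eq_sub_of_hasDerivAt hder hcont.intervalIntegrable
    simpa [logDerivative] using h3
  refine ⟨by simp [logDerivative], ?_, ?_⟩
  · have hGd : DifferentiableOn ℂ (fun z => G z - G 0) (Metric.ball 0 1) := fun z hz =>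
      ((hG z hz).differentiableAt.sub_const _).differentiableWithinAt
    exact hGd.congr key
  · have hE : ∀ z ∈ Metric.ball (0 : ℂ) 1,
        HasDerivAt (fun z => deriv φ z * Complex.exp (-(G z - G 0))) 0 z := by
      intro z hz
      have h1 := (hd.differentiableAt (Metric.isOpen_ball.mem_nhds hz)).hasDerivAt
      have h2 := ((hG z hz).sub_const (G 0)).neg.cexp
      refine (h1.mul h2).congr_deriv ?_
      have := hne z hz
      simp only [logDeriv_apply, Pi.neg_apply]
      field_simp
      ring
    intro z hz
    have hconst := (convex_ball (0 : ℂ) 1).is_const_of_fderivWithin_eq_zero (𝕜 := ℂ)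
      (f := fun z => deriv φ z * Complex.exp (-(G z - G 0)))
      (fun w hw => (hE w hw).differentiableAt.differentiableWithinAt)
      (fun w hw => by
        rw [fderivWithin_of_isOpen Metric.isOpen_ball hw]
        refine (hE w hw).hasFDerivAt.fderiv.trans ?_
        ext
        simp) (Metric.mem_ball_self one_pos) hz
    simp only [sub_self, neg_zero, Complex.exp_zero, mul_one, h0] at hconst
    rw [key z hz]
    rw [Complex.exp_neg] at hconst
    have := Complex.exp_ne_zero (G z - G 0)
    field_simp at hconst
    exact hconst

/-- The integral mean
`M_τ[φ'](r) = (1 / 2π) ∫_{-π}^{π} |[φ'(r e^{iθ})]^τ| dθ`,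
where `[φ']^τ = exp (τ log φ')`. -/
def integralMean (φ : ℂ → ℂ) (τ : ℂ) (r : ℝ) : ℝ :=
  (1 / (2 * Real.pi)) * ∫ θ in (-Real.pi)..Real.pi,
    ‖Complex.exp (τ * logDerivative φ ((r : ℂ) * Complex.exp ((θ : ℂ) * Complex.I)))‖

/-- The integral means spectrum `β_φ(τ)`: the infimum of the `β > 0` such that
`M_τ[φ'](r) = O((1 - r)^{-β})` as `r → 1⁻`. The infimum is taken in the extended reals
(it would be `⊤` if there were no such `β`). -/
def meansSpectrum (φ : ℂ → ℂ) (τ : ℂ) : EReal :=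
  sInf {b : EReal | ∃ β : ℝ, b = (β : EReal) ∧ 0 < β ∧
    integralMean φ τ =O[𝓝[<] (1 : ℝ)] fun r : ℝ => 1 / (1 - r) ^ β}

/-- The universal integral means spectrum `B_b(τ)` of the class `S_b`: the supremum of `β_φ(τ)`
over `φ ∈ S_b`, taken in the extended reals. -/
def universalSpectrum (τ : ℂ) : EReal :=
  sSup {b : EReal | ∃ φ : ℂ → ℂ, BoundedSchlicht φ ∧ b = meansSpectrum φ τ}

end IntegralMeans

end

noncomputable section

namespace IntegralMeans

open Metric Set MeasureTheory ENNReal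

section Covering

/-- A holomorphic injective function has a nonvanishing derivative. -/
theorem deriv_ne_zero_of_injOn {f : ℂ → ℂ} {U : Set ℂ} (hU : IsOpen U)
    (hd : DifferentiableOn ℂ f U) (hi : InjOn f U) {z : ℂ} (hz : z ∈ U) : deriv f z ≠ 0 := by
  intro h0
  have hfa : AnalyticAt ℂ f z := hd.analyticAt (hU.mem_nhds hz)
  have hFa : AnalyticAt ℂ (fun w => f w - f z) z := hfa.sub analyticAt_const
  have hfin : analyticOrderAt (fun w => f w - f z) z ≠ ⊤ := by
    intro htop
    rw [analyticOrderAt_eq_top] at htop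
    have h1 : ∀ᶠ w in 𝓝[≠] z, w = z := by
      filter_upwards [nhdsWithin_le_nhds htop, nhdsWithin_le_nhds (hU.mem_nhds hz)] with w hw hwU
      exact hi hwU hz (sub_eq_zero.mp hw)
    obtain ⟨w, hw, hw'⟩ := (h1.and self_mem_nhdsWithin).exists
    exact hw' hw
  obtain ⟨n, hn⟩ := ENat.ne_top_iff_exists.mp hfin
  obtain ⟨g, hga, hgz, hg⟩ := hFa.analyticOrderAt_eq_natCast.mp hn.symm
  have hn0 : n ≠ 0 := by
    rintro rfl
    have := hg.self_of_nhds
    simp at this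
    exact hgz this.symm
  have hn1 : n ≠ 1 := by
    rintro rfl
    have h1 : HasDerivAt (fun w => (w - z) ^ 1 • g w) (g z) z := by
      have := ((hasDerivAt_id z).sub_const z).mul hga.differentiableAt.hasDerivAt
      simpa [Pi.mul_def] using! this
    have h2 : HasDerivAt (fun w => f w - f z) (deriv f z) z :=
      hfa.differentiableAt.hasDerivAt.sub_const _
    have h3 := (h1.congr_of_eventuallyEq hg).unique h2
    exact hgz (h3.trans h0)
  have hka : AnalyticAt ℂ (fun w => (w - z) * (g w / g z) ^ (1 / n : ℂ)) z := by
    refine (analyticAt_id.sub analyticAt_const).mul ((hga.div analyticAt_const hgz).cpow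
      analyticAt_const ?_)
    simp [hgz]
  set k : ℂ → ℂ := fun w => (w - z) * (g w / g z) ^ (1 / n : ℂ) with hk
  have hk1 : HasStrictDerivAt k 1 z := by
    have h1 := hka.hasStrictDerivAt
    have h2 : deriv k z = 1 := by
      have hb : DifferentiableAt ℂ (fun w => (g w / g z) ^ (1 / n : ℂ)) z :=
        ((hga.div analyticAt_const hgz).cpow analyticAt_const (by simp [hgz])).differentiableAt
      have h3 : HasDerivAt k _ z := ((hasDerivAt_id z).sub_const z).mul hb.hasDerivAt
      rw [h3.deriv]
      simp [hgz]
    rwa [h2] at h1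
  have hmap := hk1.map_nhds_eq one_ne_zero
  have hkz : k z = 0 := by simp [hk]
  rw [hkz] at hmap
  set S : Set ℂ := {w | w ∈ U ∧ f w - f z = (w - z) ^ n • g w} with hS
  have hSn : S ∈ 𝓝 z := (hU.eventually_mem hz).and hg
  have hkS : k '' S ∈ 𝓝 (0 : ℂ) := by
    rw [← hmap]
    exact image_mem_map hSn
  have hkn : ∀ w, k w ^ n = (w - z) ^ n * (g w / g z) := by
    intro w
    simp only [hk, mul_pow]
    rw [← Complex.cpow_mul_nat]
    congr 1
    rw [one_div_mul_cancel (by exact_mod_cast hn0), Complex.cpow_one]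
  set ζ : ℂ := Complex.exp (2 * Real.pi * Complex.I / n) with hζ
  have hprim : IsPrimitiveRoot ζ n := Complex.isPrimitiveRoot_exp n hn0
  have hζ1 : ζ ≠ 1 := hprim.ne_one (by omega)
  have hpre : ∀ᶠ t in 𝓝[≠] (0 : ℂ), t ∈ k '' S ∧ ζ * t ∈ k '' S ∧ t ≠ 0 := by
    have hc : Tendsto (fun t : ℂ => ζ * t) (𝓝 0) (𝓝 0) := by
      have : Continuous (fun t : ℂ => ζ * t) := by fun_prop
      simpa using this.tendsto 0
    filter_upwards [nhdsWithin_le_nhds hkS, nhdsWithin_le_nhds (hc hkS), self_mem_nhdsWithin]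
      with t h1 h2 h3
    exact ⟨h1, h2, h3⟩
  obtain ⟨t, ⟨w₁, hw₁, h1⟩, ⟨w₂, hw₂, h2⟩, ht⟩ := hpre.exists
  have hpow : k w₁ ^ n = k w₂ ^ n := by
    rw [h1, h2, mul_pow, hprim.pow_eq_one, one_mul]
  rw [hkn, hkn] at hpow
  have hff : f w₁ = f w₂ := by
    have e1 := hw₁.2
    have e2 := hw₂.2
    simp only [smul_eq_mul] at e1 e2
    field_simp at hpow
    rw [← e1, ← e2] at hpow
    linear_combination hpow
  have := hi hw₁.1 hw₂.1 hff
  rw [this, h2] at h1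
  apply hζ1
  have : (ζ - 1) * t = 0 := by linear_combination h1
  rcases mul_eq_zero.mp this with h | h
  · linear_combination h
  · exact absurd h ht

/-- A continuous logarithm of a differentiable function is differentiable. -/
theorem hasDerivAt_of_exp_eq {F ℓ : ℂ → ℂ} {F' z : ℂ} (hℓ : ContinuousAt ℓ z)
    (h : ∀ᶠ w in 𝓝 z, Complex.exp (ℓ w) = F w) (hF : HasDerivAt F F' z) :
    HasDerivAt ℓ (F' / F z) z := by
  have hFz : F z ≠ 0 := by
    rw [← h.self_of_nhds]; exact Complex.exp_ne_zero _
  have hlog : HasDerivAt (fun w => ℓ z + Complex.log (F w / F z)) (F' / F z) z := by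
    have h1 : HasDerivAt (fun w => F w / F z) (F' / F z) z := hF.div_const _
    have h2 := h1.clog (by simp [hFz])
    simpa [hFz] using h2.const_add (ℓ z)
  refine hlog.congr_of_eventuallyEq ?_
  have h3 : ∀ᶠ w in 𝓝 z, ‖ℓ w - ℓ z‖ < 1 := by
    have := Metric.continuousAt_iff'.mp hℓ 1 one_pos
    simpa [dist_eq_norm] using this
  filter_upwards [h, h3] with w hw hw'
  rw [← hw, ← h.self_of_nhds, ← Complex.exp_sub, Complex.log_exp]
  · ring
  · have := (abs_le.mp (Complex.abs_im_le_norm (ℓ w - ℓ z))).1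
    linarith [Real.pi_gt_three]
  · have := (abs_le.mp (Complex.abs_im_le_norm (ℓ w - ℓ z))).2
    linarith [Real.pi_gt_three]

theorem isSimplyConnected_of_convex {E : Type*} [NormedAddCommGroup E] [NormedSpace ℝ E]
    {U : Set E} (hc : Convex ℝ U) (hne : U.Nonempty) : IsSimplyConnected U := by
  have := hc.contractibleSpace hne
  exact inferInstanceAs (SimplyConnectedSpace U)

/-- A nonvanishing continuous function on a convex open set has a continuous logarithm, with
a prescribed value at one point. -/
theorem exists_continuous_log {E : Type*} [NormedAddCommGroup E] [NormedSpace ℝ E]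
    {U : Set E} (hc : Convex ℝ U) (hU : IsOpen U) {g : E → ℂ} (hg : ContinuousOn g U)
    (h0 : ∀ x ∈ U, g x ≠ 0) {x₀ : E} (hx₀ : x₀ ∈ U) {c : ℂ} (hx : Complex.exp c = g x₀) :
    ∃ ℓ : E → ℂ, ContinuousOn ℓ U ∧ (∀ x ∈ U, Complex.exp (ℓ x) = g x) ∧ ℓ x₀ = c := by
  obtain ⟨ℓ, h1, h2⟩ := Complex.exists_continuousOn_eqOn_exp_comp
    (isSimplyConnected_of_convex hc ⟨x₀, hx₀⟩) hU hg (by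
      rintro ⟨x, hx, hx'⟩
      exact h0 x hx hx')
  refine ⟨fun x => ℓ x + (c - ℓ x₀), h1.add continuousOn_const, fun x hx' => ?_, by ring⟩
  have e1 : Complex.exp (ℓ x) = g x := h2 hx'
  have e2 : Complex.exp (ℓ x₀) = g x₀ := h2 hx₀
  rw [Complex.exp_add, Complex.exp_sub, e1, e2, hx, div_self (h0 _ hx₀), mul_one]

/-- The square root transform of a univalent function omitting a value. -/
theorem exists_sqrt_transform {f : ℂ → ℂ} (hd : DifferentiableOn ℂ f (ball 0 1))
    (hi : InjOn f (ball 0 1)) {a : ℂ} (ha : a ∉ f '' ball 0 1) :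
    ∃ g : ℂ → ℂ, DifferentiableOn ℂ g (ball 0 1) ∧ InjOn g (ball 0 1) ∧ g 0 = 1 ∧
      (∀ z ∈ ball (0 : ℂ) 1, g z ^ 2 = (f z - a) / (f 0 - a)) ∧
      (∀ z ∈ ball (0 : ℂ) 1, ∀ w ∈ ball (0 : ℂ) 1, g z ≠ - g w) ∧
      deriv g 0 = deriv f 0 / (2 * (f 0 - a)) := by
  have h00 : (0 : ℂ) ∈ ball (0 : ℂ) 1 := mem_ball_self one_pos
  have hne : ∀ z ∈ ball (0 : ℂ) 1, f z - a ≠ 0 := fun z hz h =>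
    ha ⟨z, hz, sub_eq_zero.mp h⟩
  have hFd : DifferentiableOn ℂ (fun z => (f z - a) / (f 0 - a)) (ball 0 1) :=
    (hd.sub_const a).div_const _
  obtain ⟨ℓ, hℓc, hℓe, hℓ0⟩ := exists_continuous_log (convex_ball (0 : ℂ) 1) isOpen_ball
    (g := fun z => (f z - a) / (f 0 - a)) hFd.continuousOn
    (fun z hz => div_ne_zero (hne z hz) (hne 0 h00)) h00 (c := 0)
    (by rw [div_self (hne 0 h00), Complex.exp_zero])
  have hder : ∀ z ∈ ball (0 : ℂ) 1, HasDerivAt ℓ (deriv f z / (f z - a)) z := by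
    intro z hz
    have h1 := hasDerivAt_of_exp_eq (hℓc.continuousAt (isOpen_ball.mem_nhds hz))
      (by filter_upwards [isOpen_ball.mem_nhds hz] with w hw using hℓe w hw)
      (((hd.differentiableAt (isOpen_ball.mem_nhds hz)).hasDerivAt.sub_const a).div_const
        (f 0 - a))
    refine h1.congr_deriv ?_
    have := hne z hz
    have := hne 0 h00
    field_simp
  have hgder : ∀ z ∈ ball (0 : ℂ) 1, HasDerivAt (fun z => Complex.exp (ℓ z / 2))
      (Complex.exp (ℓ z / 2) * (deriv f z / (f z - a) / 2)) z := fun z hz =>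
    ((hder z hz).div_const 2).cexp
  have hsq : ∀ z ∈ ball (0 : ℂ) 1, Complex.exp (ℓ z / 2) ^ 2 = (f z - a) / (f 0 - a) := by
    intro z hz
    rw [← hℓe z hz, ← Complex.exp_nat_mul]
    congr 1
    push_cast
    ring
  have hsqinj : ∀ z ∈ ball (0 : ℂ) 1, ∀ w ∈ ball (0 : ℂ) 1,
      Complex.exp (ℓ z / 2) ^ 2 = Complex.exp (ℓ w / 2) ^ 2 → z = w := by
    intro z hz w hw h
    rw [hsq z hz, hsq w hw, div_left_inj' (hne 0 h00)] at h
    exact hi hz hw (sub_left_injective h)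
  refine ⟨fun z => Complex.exp (ℓ z / 2),
    fun z hz => (hgder z hz).differentiableAt.differentiableWithinAt, ?_, by simp [hℓ0], hsq, ?_, ?_⟩
  · intro z hz w hw h
    exact hsqinj z hz w hw (by simp only at h; rw [h])
  · intro z hz w hw h
    have := hsqinj z hz w hw (by simp only at h; rw [h]; ring)
    subst this
    exact Complex.exp_ne_zero (ℓ z / 2) (by linear_combination h / 2)
  · rw [(hgder 0 h00).deriv, hℓ0]
    have := hne 0 h00
    simp
    field_simp

/-- If the square root transform covers `ball 1 R`, then its values stay away from `-1`. -/
theorem le_norm_add_one {g : ℂ → ℂ} {R : ℝ} (h : ball 1 R ⊆ g '' ball 0 1)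
    (hg : ∀ z ∈ ball (0 : ℂ) 1, ∀ w ∈ ball (0 : ℂ) 1, g z ≠ - g w) {z : ℂ}
    (hz : z ∈ ball (0 : ℂ) 1) : R ≤ ‖g z + 1‖ := by
  by_contra! hlt
  have : - g z ∈ ball (1 : ℂ) R := by
    rwa [mem_ball, dist_eq_norm, ← norm_neg, show -(-g z - 1) = g z + 1 by ring]
  obtain ⟨w, hw, hw'⟩ := h this
  exact hg w hw z hz hw'

/-- Covering with a constant depending on the bound of the function. -/
theorem ball_subset_image_of_bound {f : ℂ → ℂ} {M : ℝ} (hM : 1 ≤ M)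
    (hd : DifferentiableOn ℂ f (ball 0 1)) (hf' : deriv f 0 ≠ 0)
    (hb : ∀ z ∈ ball (0 : ℂ) 1, ‖f z - f 0‖ ≤ M * ‖deriv f 0‖) :
    ball (f 0) (1 / (16 * M) * ‖deriv f 0‖) ⊆ f '' ball 0 1 := by
  set D := ‖deriv f 0‖ with hD
  have hDpos : 0 < D := norm_pos_iff.mpr hf'
  have h00 : (0 : ℂ) ∈ ball (0 : ℂ) 1 := mem_ball_self one_pos
  have hder0 := (hd.differentiableAt (isOpen_ball.mem_nhds h00)).hasDerivAt
  set F : ℂ → ℂ := fun z => f z - z * deriv f 0 with hF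
  have hF0 : F 0 = f 0 := by simp [hF]
  have hFd : DifferentiableOn ℂ F (ball 0 1) := by
    refine hd.sub ?_
    fun_prop
  have hmaps : MapsTo F (ball 0 1) (closedBall (F 0) (2 * M * D)) := by
    intro z hz
    rw [mem_closedBall, dist_eq_norm, hF0]
    have h1 : F z - f 0 = (f z - f 0) - z * deriv f 0 := by simp [hF]; ring
    rw [h1]
    have hz1 : ‖z‖ ≤ 1 := by simpa using (mem_ball_zero_iff.mp hz).le
    calc _ ≤ ‖f z - f 0‖ + ‖z * deriv f 0‖ := norm_sub_le _ _
      _ ≤ M * D + 1 * D := by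
        rw [norm_mul]
        gcongr
        exact hb z hz
      _ ≤ _ := by nlinarith
  have hsmall : (F · - F 0) =o[𝓝 0] (fun w : ℂ => ‖w - 0‖ ^ 1) := by
    have := hder0.isLittleO
    simp only [pow_one, sub_zero]
    refine (this.congr_left ?_).trans_isBigO ?_
    · intro z
      simp [hF]
      ring
    · simpa using (Asymptotics.isBigO_refl (fun x : ℂ => x) (𝓝 0)).norm_right
  have key : ∀ z ∈ ball (0 : ℂ) 1, ‖F z - F 0‖ ≤ 2 * M * D * ‖z‖ ^ 2 := by
    intro z hz
    have := Complex.dist_le_mul_div_pow_of_mapsTo_ball_of_isLittleO (n := 1) hFd hmaps hsmall hz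
    simpa [dist_eq_norm] using this
  set r : ℝ := 1 / (4 * M) with hr
  have hrpos : 0 < r := by positivity
  have hr1 : r < 1 := by
    rw [hr, div_lt_one (by positivity)]
    linarith
  have hrM : 4 * M * r = 1 := by rw [hr]; field_simp
  have hsub : closedBall (0 : ℂ) r ⊆ ball 0 1 := closedBall_subset_ball hr1
  have hdc : DiffContOnCl ℂ f (ball 0 r) :=
    (hd.mono hsub).diffContOnCl_ball subset_rfl
  have hlow : ∀ z ∈ sphere (0 : ℂ) r, D * r / 2 ≤ ‖f z - f 0‖ := by
    intro z hz
    have hz' : ‖z‖ = r := by simpa using hz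
    have h1 := key z (hsub (sphere_subset_closedBall hz))
    have h2 : f z - f 0 = z * deriv f 0 - (-(F z - F 0)) := by simp [hF]; ring
    rw [h2]
    have h3 := norm_sub_norm_le (z * deriv f 0) (-(F z - F 0))
    rw [norm_neg, norm_mul, hz'] at h3
    rw [hz'] at h1
    have : 2 * M * D * r ^ 2 = D * r / 2 := by
      have : 2 * M * D * r ^ 2 = (4 * M * r) * (D * r / 2) := by ring
      rw [this, hrM, one_mul]
    nlinarith
  have hfreq : ∃ᶠ z in 𝓝 (0 : ℂ), f z ≠ f 0 := by
    exact ((hder0.eventually_ne hf' (c := f 0)).frequently).filter_mono nhdsWithin_le_nhds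
  have := hdc.ball_subset_image_closedBall hrpos hlow hfreq
  refine subset_trans (subset_trans (ball_subset_ball ?_) this) (image_mono hsub)
  rw [hr]
  apply le_of_eq
  field_simp
  norm_num

/-- The covering property with constant `k` for univalent functions bounded by `M * ‖f' 0‖`. -/
def CoversDisk (M k : ℝ) : Prop :=
  ∀ f : ℂ → ℂ, DifferentiableOn ℂ f (ball 0 1) → InjOn f (ball 0 1) →
    (∀ z ∈ ball (0 : ℂ) 1, ‖f z - f 0‖ ≤ M * ‖deriv f 0‖) →
    ball (f 0) (k * ‖deriv f 0‖) ⊆ f '' ball 0 1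

theorem CoversDisk.double {M k : ℝ} (hM : 1 ≤ M) (hk : 0 < k) (hk' : k ≤ 1 / 128)
    (h : CoversDisk M k) : CoversDisk M (2 * k) := by
  intro f hd hi hb a ha
  by_contra hna
  have h00 : (0 : ℂ) ∈ ball (0 : ℂ) 1 := mem_ball_self one_pos
  have hf' := deriv_ne_zero_of_injOn isOpen_ball hd hi h00
  obtain ⟨g, hgd, hgi, hg0, hgsq, hgneg, hg'⟩ := exists_sqrt_transform hd hi hna
  set D := ‖deriv f 0‖ with hD
  have hDpos : 0 < D := norm_pos_iff.mpr hf'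
  have hane : f 0 - a ≠ 0 := fun h' => hna ⟨0, h00, sub_eq_zero.mp h'⟩
  set e := ‖f 0 - a‖ with he
  have hepos : 0 < e := norm_pos_iff.mpr hane
  have hlt : e < 2 * k * D := by
    rw [mem_ball, dist_comm, dist_eq_norm] at ha
    exact ha
  set u := D / e with hu
  have hupos : 0 < u := by positivity
  have huk : 1 < 2 * k * u := by
    rw [hu, ← mul_div_assoc, lt_div_iff₀ hepos]
    linarith
  have hu64 : 64 < u := by nlinarith
  have hg'n : ‖deriv g 0‖ = u / 2 := by
    rw [hg', norm_div, norm_mul, ← hD, ← he, hu]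
    simp
    field_simp
  have hgb : ∀ z ∈ ball (0 : ℂ) 1, ‖g z - g 0‖ ≤ M * ‖deriv g 0‖ := by
    intro z hz
    have h1 : ‖g z‖ ^ 2 ≤ 1 + M * u := by
      rw [← norm_pow, hgsq z hz, norm_div, ← he, div_le_iff₀ hepos]
      have h2 : f z - a = (f z - f 0) + (f 0 - a) := by ring
      rw [h2]
      calc _ ≤ ‖f z - f 0‖ + ‖f 0 - a‖ := norm_add_le _ _
        _ ≤ M * D + e := by gcongr; exact hb z hz
        _ = _ := by rw [hu]; field_simp; ring
    have hMu : 64 < M * u := by nlinarith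
    have h3 : ‖g z‖ ≤ M * u / 2 - 1 := by
      apply abs_le_of_sq_le_sq' _ (by linarith) |>.2
      nlinarith
    rw [hg'n, hg0]
    calc _ ≤ ‖g z‖ + ‖(1 : ℂ)‖ := norm_sub_le _ _
      _ ≤ _ := by rw [norm_one]; linarith
  have hcov := h g hgd hgi hgb
  rw [hg0, hg'n] at hcov
  have hR : 0 < k * (u / 2) := by positivity
  have hlow := fun z hz => le_norm_add_one (z := z) hcov hgneg hz
  have hne1 : ∀ z ∈ ball (0 : ℂ) 1, g z + 1 ≠ 0 := fun z hz h' => by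
    have := hlow z hz
    rw [h', norm_zero] at this
    linarith
  have hhd : DifferentiableOn ℂ (fun z => (g z + 1)⁻¹) (ball 0 1) :=
    (hgd.add_const 1).inv hne1
  have hhb : ∀ z ∈ ball (0 : ℂ) 1, ‖(g z + 1)⁻¹‖ ≤ (k * (u / 2))⁻¹ := by
    intro z hz
    rw [norm_inv]
    exact inv_anti₀ hR (hlow z hz)
  have hsch := Complex.norm_deriv_le_div_of_mapsTo_ball (R₂ := 2 * (k * (u / 2))⁻¹) hhd (by
    intro z hz
    rw [mem_closedBall, dist_eq_norm]
    calc _ ≤ ‖(g z + 1)⁻¹‖ + ‖(g 0 + 1)⁻¹‖ := norm_sub_le _ _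
      _ ≤ _ := by linarith [hhb z hz, hhb 0 h00]) one_pos
  have hder := ((hgd.differentiableAt (isOpen_ball.mem_nhds h00)).hasDerivAt.add_const
    (1 : ℂ)).fun_inv (hne1 0 h00)
  rw [hder.deriv, norm_div, norm_neg, hg'n, hg0] at hsch
  have h4 : ‖((1 : ℂ) + 1) ^ 2‖ = 4 := by norm_num
  rw [h4, div_one] at hsch
  have h5 : 2 * (k * (u / 2))⁻¹ = 4 / (k * u) := by field_simp; norm_num
  rw [h5, div_div, div_le_div_iff₀ (by norm_num) (by positivity)] at hsch
  nlinarith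

/-- A weak form of the Koebe covering theorem, for bounded univalent functions. -/
theorem koebe_covering {f : ℂ → ℂ} (hd : DifferentiableOn ℂ f (ball 0 1))
    (hi : InjOn f (ball 0 1)) (hb : Bornology.IsBounded (f '' ball 0 1)) :
    ball (f 0) (1 / 128 * ‖deriv f 0‖) ⊆ f '' ball 0 1 := by
  have h00 : (0 : ℂ) ∈ ball (0 : ℂ) 1 := mem_ball_self one_pos
  have hf' := deriv_ne_zero_of_injOn isOpen_ball hd hi h00
  set D := ‖deriv f 0‖ with hD
  have hDpos : 0 < D := norm_pos_iff.mpr hf'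
  obtain ⟨B, hB⟩ := hb.subset_closedBall (f 0)
  set M := max 1 (B / D) with hMdef
  have hM : 1 ≤ M := le_max_left _ _
  have hbound : ∀ z ∈ ball (0 : ℂ) 1, ‖f z - f 0‖ ≤ M * D := by
    intro z hz
    have h1 := hB ⟨z, hz, rfl⟩
    rw [mem_closedBall, dist_eq_norm] at h1
    refine h1.trans ?_
    rw [← div_le_iff₀ hDpos]
    exact le_max_right _ _
  set k₀ : ℝ := 1 / (16 * M) with hk₀
  have hk₀pos : 0 < k₀ := by positivity
  have hmono : ∀ {k k' : ℝ}, k' ≤ k → CoversDisk M k → CoversDisk M k' := by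
    intro k k' hkk h f hd hi hb
    exact (ball_subset_ball (by gcongr)).trans (h f hd hi hb)
  have hbase : CoversDisk M k₀ := fun f hd hi hb =>
    ball_subset_image_of_bound hM hd (deriv_ne_zero_of_injOn isOpen_ball hd hi h00) hb
  have hind : ∀ n : ℕ, CoversDisk M (min (2 ^ n * k₀) (1 / 128)) := by
    intro n
    induction n with
    | zero => exact hmono (by simp) hbase
    | succ n ih =>
      refine hmono ?_ (ih.double hM (by positivity) (min_le_right _ _))
      rw [mul_min_of_nonneg _ _ (by norm_num : (0 : ℝ) ≤ 2), pow_succ]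
      apply min_le_min
      · apply le_of_eq; ring
      · norm_num
  obtain ⟨n, hn⟩ := pow_unbounded_of_one_lt (1 / 128 / k₀) (one_lt_two)
  have h128 : CoversDisk M (1 / 128) := by
    have := hind n
    rwa [min_eq_right] at this
    rw [div_lt_iff₀ hk₀pos] at hn
    exact hn.le
  exact h128 f hd hi hbound

/-- A univalent function omits a value close to `f 0`. -/
theorem exists_omitted_value {f : ℂ → ℂ} (hd : DifferentiableOn ℂ f (ball 0 1))
    (hi : InjOn f (ball 0 1)) : ∃ a, a ∉ f '' ball 0 1 ∧ ‖f 0 - a‖ ≤ 3 * ‖deriv f 0‖ := by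
  by_contra! hcon
  have h00 : (0 : ℂ) ∈ ball (0 : ℂ) 1 := mem_ball_self one_pos
  have hf' := deriv_ne_zero_of_injOn isOpen_ball hd hi h00
  set D := ‖deriv f 0‖ with hD
  have hDpos : 0 < D := norm_pos_iff.mpr hf'
  have hsub : ball (f 0) (3 * D) ⊆ f '' ball 0 1 := by
    intro a ha
    by_contra hna
    have := hcon a hna
    rw [mem_ball, dist_comm, dist_eq_norm] at ha
    linarith
  set ψ := Function.invFunOn f (ball 0 1) with hψ
  have hleft : ∀ z ∈ ball (0 : ℂ) 1, ψ (f z) = z := fun z hz => hi.leftInvOn_invFunOn hz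
  have hder : ∀ z ∈ ball (0 : ℂ) 1, HasDerivAt ψ (deriv f z)⁻¹ (f z) := by
    intro z hz
    have h1 := (hd.analyticAt (isOpen_ball.mem_nhds hz)).hasStrictDerivAt
    refine (h1.to_local_left_inverse (deriv_ne_zero_of_injOn isOpen_ball hd hi hz) ?_).hasDerivAt
    filter_upwards [isOpen_ball.mem_nhds hz] with w hw using hleft w hw
  have hψd : DifferentiableOn ℂ ψ (ball (f 0) (3 * D)) := by
    intro w hw
    obtain ⟨z, hz, rfl⟩ := hsub hw
    exact (hder z hz).differentiableAt.differentiableWithinAt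
  have hmaps : MapsTo ψ (ball (f 0) (3 * D)) (closedBall (ψ (f 0)) 1) := by
    intro w hw
    obtain ⟨z, hz, rfl⟩ := hsub hw
    rw [hleft z hz, hleft 0 h00]
    exact ball_subset_closedBall hz
  have h1 := Complex.norm_deriv_le_div_of_mapsTo_ball hψd hmaps (by positivity)
  rw [(hder 0 h00).deriv, norm_inv, ← hD, inv_eq_one_div,
    div_le_div_iff₀ hDpos (by positivity)] at h1
  linarith

/-- A univalent function is bounded in terms of its derivative near the origin. -/
theorem norm_le_near_zero {f : ℂ → ℂ} (hd : DifferentiableOn ℂ f (ball 0 1))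
    (hi : InjOn f (ball 0 1)) (hb : Bornology.IsBounded (f '' ball 0 1)) {z : ℂ}
    (hz : ‖z‖ < 1 / 8192) : ‖f z - f 0‖ ≤ 100 * ‖deriv f 0‖ := by
  have h00 : (0 : ℂ) ∈ ball (0 : ℂ) 1 := mem_ball_self one_pos
  have hf' := deriv_ne_zero_of_injOn isOpen_ball hd hi h00
  obtain ⟨a, ha, hae⟩ := exists_omitted_value hd hi
  obtain ⟨g, hgd, hgi, hg0, hgsq, hgneg, hg'⟩ := exists_sqrt_transform hd hi ha
  set D := ‖deriv f 0‖ with hD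
  have hDpos : 0 < D := norm_pos_iff.mpr hf'
  have hane : f 0 - a ≠ 0 := fun h' => ha ⟨0, h00, sub_eq_zero.mp h'⟩
  set e := ‖f 0 - a‖ with he
  have hepos : 0 < e := norm_pos_iff.mpr hane
  have hg'n : 1 / 6 ≤ ‖deriv g 0‖ := by
    rw [hg', norm_div, norm_mul, ← hD, ← he, div_le_div_iff₀ (by norm_num) (by simpa using hepos)]
    simp only [Complex.norm_ofNat]
    linarith
  obtain ⟨B, hB⟩ := hb.subset_closedBall a
  have hgbdd : Bornology.IsBounded (g '' ball 0 1) := by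
    refine (isBounded_closedBall (x := (0 : ℂ)) (r := 1 + B / e)).subset ?_
    rintro _ ⟨z, hz, rfl⟩
    have h1 := hB ⟨z, hz, rfl⟩
    rw [mem_closedBall, dist_eq_norm] at h1
    rw [mem_closedBall_zero_iff]
    have h2 : ‖g z‖ ^ 2 ≤ B / e := by
      rw [← norm_pow, hgsq z hz, norm_div, ← he]
      gcongr
    nlinarith [sq_nonneg (‖g z‖ - 1), norm_nonneg (g z)]
  have hcov := koebe_covering hgd hgi hgbdd
  rw [hg0] at hcov
  have hcov' : ball (1 : ℂ) (1 / 768) ⊆ g '' ball 0 1 :=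
    (ball_subset_ball (by linarith)).trans hcov
  have hlow := fun z hz => le_norm_add_one (z := z) hcov' hgneg hz
  have hne1 : ∀ z ∈ ball (0 : ℂ) 1, g z + 1 ≠ 0 := fun z hz h' => by
    have := hlow z hz
    rw [h', norm_zero] at this
    linarith
  have hhd : DifferentiableOn ℂ (fun z => (g z + 1)⁻¹) (ball 0 1) :=
    (hgd.add_const 1).inv hne1
  have hhb : ∀ z ∈ ball (0 : ℂ) 1, ‖(g z + 1)⁻¹‖ ≤ 768 := by
    intro z hz
    rw [norm_inv]
    have := inv_anti₀ (by norm_num) (hlow z hz)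
    simpa using this
  have hz1 : z ∈ ball (0 : ℂ) 1 := by
    rw [mem_ball_zero_iff]; linarith
  have hsch := Complex.dist_le_div_mul_dist_of_mapsTo_ball (R₂ := 769) hhd (by
    intro z hz
    rw [mem_closedBall, dist_eq_norm]
    calc _ ≤ ‖(g z + 1)⁻¹‖ + ‖(g 0 + 1)⁻¹‖ := norm_sub_le _ _
      _ ≤ _ := by
        have : ‖(g 0 + 1)⁻¹‖ = 1 / 2 := by rw [hg0]; norm_num
        linarith [hhb z hz]) hz1
  rw [dist_eq_norm, dist_zero_right, hg0] at hsch
  have h1 : ‖(1 + 1 : ℂ)⁻¹‖ = 1 / 2 := by norm_num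
  have h2 : 1 / 4 ≤ ‖(g z + 1)⁻¹‖ := by
    have := norm_sub_norm_le ((1 + 1 : ℂ)⁻¹) ((g z + 1)⁻¹)
    rw [norm_sub_rev, h1] at this
    have : (769 : ℝ) / 1 * ‖z‖ ≤ 769 / 8192 := by linarith
    linarith
  have h3 : ‖g z + 1‖ ≤ 4 := by
    rw [norm_inv] at h2
    have hpos : 0 < ‖g z + 1‖ := norm_pos_iff.mpr (hne1 z hz1)
    rw [div_le_iff₀ (by norm_num)] at h2
    have := mul_le_mul_of_nonneg_right h2 hpos.le
    rw [mul_assoc, mul_comm 4, ← mul_assoc, inv_mul_cancel₀ hpos.ne'] at this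
    linarith
  have h4 : ‖g z‖ ≤ 5 := by
    have := norm_sub_le (g z + 1) 1
    rw [add_sub_cancel_right, norm_one] at this
    linarith
  have h5 : f z - f 0 = (f 0 - a) * (g z ^ 2 - 1) := by
    rw [hgsq z hz1]
    field_simp
    ring
  rw [h5, norm_mul, ← he]
  have h6 : ‖g z ^ 2 - 1‖ ≤ 26 := by
    refine (norm_sub_le _ _).trans ?_
    rw [norm_pow, norm_one]
    nlinarith [norm_nonneg (g z)]
  nlinarith

end Covering

section Distortion

theorem add_mem_unit_ball {ξ : ℂ} {ε : ℝ} (hε : ε ≤ 1 - ‖ξ‖) {ζ : ℂ} (hζ : ζ ∈ ball ξ ε) :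
    ζ ∈ ball (0 : ℂ) 1 := by
  rw [mem_ball, dist_eq_norm] at hζ
  rw [mem_ball_zero_iff]
  have := norm_add_le (ζ - ξ) ξ
  rw [sub_add_cancel] at this
  linarith

/-- Rescaling of a function from `ball ξ ε` to the unit disk. -/
theorem rescale_spec {φ : ℂ → ℂ} (hd : DifferentiableOn ℂ φ (ball 0 1))
    (hi : InjOn φ (ball 0 1)) (hb : Bornology.IsBounded (φ '' ball 0 1)) {ξ : ℂ} {ε : ℝ}
    (hε0 : 0 < ε) (hε : ε ≤ 1 - ‖ξ‖) :
    DifferentiableOn ℂ (fun z => φ (ξ + ε * z)) (ball 0 1) ∧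
      InjOn (fun z => φ (ξ + ε * z)) (ball 0 1) ∧
      Bornology.IsBounded ((fun z => φ (ξ + ε * z)) '' ball 0 1) ∧
      deriv (fun z => φ (ξ + ε * z)) 0 = ε * deriv φ ξ ∧
      (fun z => φ (ξ + ε * z)) '' ball 0 1 = φ '' ball ξ ε := by
  have hmaps : MapsTo (fun z : ℂ => ξ + ε * z) (ball 0 1) (ball ξ ε) := by
    intro z hz
    rw [mem_ball_zero_iff] at hz
    rw [mem_ball, dist_eq_norm, add_sub_cancel_left, norm_mul, Complex.norm_real,
      Real.norm_of_nonneg hε0.le]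
    nlinarith
  have hmaps' : MapsTo (fun z : ℂ => ξ + ε * z) (ball 0 1) (ball 0 1) := fun z hz =>
    add_mem_unit_ball hε (hmaps hz)
  have hξ : ξ ∈ ball (0 : ℂ) 1 := by
    rw [mem_ball_zero_iff]; linarith
  have hεc : (ε : ℂ) ≠ 0 := by exact_mod_cast hε0.ne'
  have himg : (fun z => φ (ξ + ε * z)) '' ball 0 1 = φ '' ball ξ ε := by
    rw [show (fun z => φ (ξ + ε * z)) = φ ∘ (fun z : ℂ => ξ + ε * z) from rfl, image_comp]
    congr 1
    refine subset_antisymm hmaps.image_subset ?_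
    intro ζ hζ
    refine ⟨(ζ - ξ) / ε, ?_, ?_⟩
    · rw [mem_ball, dist_eq_norm] at hζ
      rw [mem_ball_zero_iff, norm_div, Complex.norm_real, Real.norm_of_nonneg hε0.le,
        div_lt_one hε0]
      exact hζ
    · simp only
      field_simp
      ring
  refine ⟨hd.comp (by fun_prop) hmaps', ?_, ?_, ?_, himg⟩
  · intro z hz w hw h
    have := hi (hmaps' hz) (hmaps' hw) h
    simpa [hεc] using this
  · rw [himg]
    exact hb.subset (image_mono fun ζ hζ => add_mem_unit_ball hε hζ)
  · have h1 : HasDerivAt (fun z : ℂ => ξ + ε * z) (ε : ℂ) 0 := by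
      simpa using ((hasDerivAt_id (0 : ℂ)).const_mul (ε : ℂ)).const_add ξ
    have h2 : HasDerivAt φ (deriv φ ξ) (ξ + ε * 0) := by
      rw [mul_zero, add_zero]
      exact (hd.differentiableAt (isOpen_ball.mem_nhds hξ)).hasDerivAt
    have := (h2.comp (0 : ℂ) h1).deriv
    simp only [Function.comp_def] at this
    rw [this, mul_comm]

variable {φ : ℂ → ℂ}

/-- Univalent functions separate points, quantitatively. -/
theorem BoundedSchlicht.le_norm_sub (hφ : BoundedSchlicht φ) {ξ z : ℂ} {ε : ℝ} (hε0 : 0 < ε)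
    (hε : ε ≤ 1 - ‖ξ‖) (hz : z ∈ ball (0 : ℂ) 1) (hzξ : ε ≤ ‖z - ξ‖) :
    ε * ‖deriv φ ξ‖ / 128 ≤ ‖φ z - φ ξ‖ := by
  obtain ⟨h1, h2, h3, h4, h5⟩ := rescale_spec hφ.holo hφ.inj hφ.bdd hε0 hε
  have hcov := koebe_covering h1 h2 h3
  rw [h4, h5, mul_zero, add_zero, norm_mul, Complex.norm_real, Real.norm_of_nonneg hε0.le] at hcov
  by_contra! hlt
  have hmem : φ z ∈ ball (φ ξ) (1 / 128 * (ε * ‖deriv φ ξ‖)) := by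
    rw [mem_ball, dist_eq_norm]
    linarith
  obtain ⟨z', hz', he⟩ := hcov hmem
  have := hφ.inj (add_mem_unit_ball hε hz') hz he
  subst this
  rw [mem_ball, dist_eq_norm] at hz'
  linarith

theorem BoundedSchlicht.deriv_ne_zero (hφ : BoundedSchlicht φ) {ξ : ℂ}
    (hξ : ξ ∈ ball (0 : ℂ) 1) : deriv φ ξ ≠ 0 :=
  deriv_ne_zero_of_injOn isOpen_ball hφ.holo hφ.inj hξ

/-- The second derivative of a univalent function is controlled by the first one. -/
theorem BoundedSchlicht.norm_deriv_deriv_le (hφ : BoundedSchlicht φ) {ξ : ℂ}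
    (hξ : ξ ∈ ball (0 : ℂ) 1) :
    ‖deriv (deriv φ) ξ‖ ≤ 10 ^ 11 * ‖deriv φ ξ‖ / (1 - ‖ξ‖) := by
  set δ := 1 - ‖ξ‖ with hδ
  have hδ0 : 0 < δ := by
    rw [mem_ball_zero_iff] at hξ; linarith
  set D := ‖deriv φ ξ‖ with hD
  have hD0 : 0 ≤ D := norm_nonneg _
  obtain ⟨h1, h2, h3, h4, h5⟩ := rescale_spec hφ.holo hφ.inj hφ.bdd hδ0 le_rfl
  have hnear : ∀ ζ ∈ ball ξ (δ / 8192), ‖φ ζ - φ ξ‖ ≤ 100 * (δ * D) := by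
    intro ζ hζ
    rw [mem_ball, dist_eq_norm] at hζ
    have hδc : (δ : ℂ) ≠ 0 := by exact_mod_cast hδ0.ne'
    have := norm_le_near_zero h1 h2 h3 (z := (ζ - ξ) / δ) (by
      rw [norm_div, Complex.norm_real, Real.norm_of_nonneg hδ0.le, div_lt_iff₀ hδ0]
      linarith)
    rw [h4, norm_mul, Complex.norm_real, Real.norm_of_nonneg hδ0.le, mul_div_cancel₀ _ hδc] at this
    simpa using this
  have hd' : DifferentiableOn ℂ (deriv φ) (ball 0 1) := hφ.holo.deriv isOpen_ball
  have hderiv : ∀ ζ ∈ ball ξ (δ / 16384), ‖deriv φ ζ‖ ≤ 3276800 * D := by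
    intro ζ hζ
    have hsub : ball ζ (δ / 16384) ⊆ ball ξ (δ / 8192) := by
      apply ball_subset_ball'
      rw [mem_ball] at hζ
      linarith
    have hsub' : ball ζ (δ / 16384) ⊆ ball (0 : ℂ) 1 := fun w hw =>
      add_mem_unit_ball (ε := δ / 8192) (by linarith) (hsub hw)
    have hζm : ζ ∈ ball ζ (δ / 16384) := mem_ball_self (by positivity)
    have := Complex.norm_deriv_le_div_of_mapsTo_ball (R₂ := 200 * (δ * D)) (hφ.holo.mono hsub') (by
      intro w hw
      rw [mem_closedBall, dist_eq_norm]
      have e : φ w - φ ζ = (φ w - φ ξ) - (φ ζ - φ ξ) := by ring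
      rw [e]
      have := norm_sub_le (φ w - φ ξ) (φ ζ - φ ξ)
      linarith [hnear w (hsub hw), hnear ζ (hsub hζm)]) (by positivity)
    refine this.trans (le_of_eq ?_)
    field_simp
    ring
  have hsub : ball ξ (δ / 16384) ⊆ ball (0 : ℂ) 1 := fun w hw =>
    add_mem_unit_ball (ε := δ / 16384) (by linarith) hw
  have := Complex.norm_deriv_le_div_of_mapsTo_ball (R₂ := 3276801 * D) (hd'.mono hsub) (by
      intro w hw
      rw [mem_closedBall, dist_eq_norm]
      have := norm_sub_le (deriv φ w) (deriv φ ξ)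
      linarith [hderiv w hw]) (by positivity)
  refine this.trans ?_
  rw [div_div_eq_mul_div]
  gcongr ?_ / _
  nlinarith

theorem BoundedSchlicht.exp_logDerivative (hφ : BoundedSchlicht φ) {ξ : ℂ}
    (hξ : ξ ∈ ball (0 : ℂ) 1) : Complex.exp (logDerivative φ ξ) = deriv φ ξ :=
  (logDerivative_spec hφ.holo hφ.deriv_zero fun _ hz => hφ.deriv_ne_zero hz).2.2 ξ hξ

theorem BoundedSchlicht.hasDerivAt_logDerivative (hφ : BoundedSchlicht φ) {ξ : ℂ}
    (hξ : ξ ∈ ball (0 : ℂ) 1) :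
    HasDerivAt (logDerivative φ) (deriv (deriv φ) ξ / deriv φ ξ) ξ := by
  have hs := logDerivative_spec hφ.holo hφ.deriv_zero fun _ hz => hφ.deriv_ne_zero hz
  have hd' : DifferentiableOn ℂ (deriv φ) (ball 0 1) := hφ.holo.deriv isOpen_ball
  have hn := isOpen_ball.mem_nhds hξ
  refine hasDerivAt_of_exp_eq (hs.2.1.continuousOn.continuousAt hn) ?_
    (hd'.differentiableAt hn).hasDerivAt
  filter_upwards [hn] with w hw using hs.2.2 w hw

/-- A constant `K` for which the distortion estimates hold for all bounded univalent functions. -/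
structure IsDistortionConst (K : ℝ) : Prop where
  one_le : 1 ≤ K
  log_sub_le : ∀ {φ : ℂ → ℂ}, BoundedSchlicht φ → ∀ {ξ ξ' : ℂ}, ξ ∈ ball (0 : ℂ) 1 →
    ‖ξ' - ξ‖ ≤ 7 / 8 * (1 - ‖ξ‖) → ‖logDerivative φ ξ' - logDerivative φ ξ‖ ≤ K
  deriv_le : ∀ {φ : ℂ → ℂ}, BoundedSchlicht φ → ∀ {ξ ξ' : ℂ}, ξ ∈ ball (0 : ℂ) 1 →
    ‖ξ' - ξ‖ ≤ 7 / 8 * (1 - ‖ξ‖) → ‖deriv φ ξ'‖ ≤ K * ‖deriv φ ξ‖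
  le_deriv : ∀ {φ : ℂ → ℂ}, BoundedSchlicht φ → ∀ {ξ ξ' : ℂ}, ξ ∈ ball (0 : ℂ) 1 →
    ‖ξ' - ξ‖ ≤ 7 / 8 * (1 - ‖ξ‖) → ‖deriv φ ξ‖ ≤ K * ‖deriv φ ξ'‖
  deriv2_le : ∀ {φ : ℂ → ℂ}, BoundedSchlicht φ → ∀ {ξ ξ' : ℂ}, ξ ∈ ball (0 : ℂ) 1 →
    ‖ξ' - ξ‖ ≤ 7 / 8 * (1 - ‖ξ‖) → ‖deriv (deriv φ) ξ'‖ ≤ K * ‖deriv φ ξ‖ / (1 - ‖ξ‖)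
  sub_le : ∀ {φ : ℂ → ℂ}, BoundedSchlicht φ → ∀ {ξ ξ' : ℂ}, ξ ∈ ball (0 : ℂ) 1 →
    ‖ξ' - ξ‖ ≤ 7 / 8 * (1 - ‖ξ‖) → ‖φ ξ' - φ ξ‖ ≤ K * ‖deriv φ ξ‖ * ‖ξ' - ξ‖

theorem one_sub_norm_ge {ξ ξ' : ℂ} (h : ‖ξ' - ξ‖ ≤ 7 / 8 * (1 - ‖ξ‖)) :
    1 / 8 * (1 - ‖ξ‖) ≤ 1 - ‖ξ'‖ := by
  have := norm_sub_norm_le ξ' ξ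
  linarith

/-- A universal (not sharp) distortion constant exists. -/
theorem exists_isDistortionConst : ∃ K, IsDistortionConst K := by
  set A : ℝ := 8 * 10 ^ 11 with hA
  have mem' : ∀ {ξ ξ' : ℂ}, ξ ∈ ball (0 : ℂ) 1 → ‖ξ' - ξ‖ ≤ 7 / 8 * (1 - ‖ξ‖) →
      ξ' ∈ ball (0 : ℂ) 1 := by
    intro ξ ξ' hξ h
    rw [mem_ball_zero_iff] at hξ ⊢
    linarith [one_sub_norm_ge h]
  have hlog : ∀ {φ : ℂ → ℂ}, BoundedSchlicht φ → ∀ {ξ ξ' : ℂ}, ξ ∈ ball (0 : ℂ) 1 →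
      ‖ξ' - ξ‖ ≤ 7 / 8 * (1 - ‖ξ‖) → ‖logDerivative φ ξ' - logDerivative φ ξ‖ ≤ A := by
    intro φ hφ ξ ξ' hξ h
    have hpos : 0 < 1 - ‖ξ‖ := by rw [mem_ball_zero_iff] at hξ; linarith
    have hcl : ∀ ζ ∈ closedBall ξ (7 / 8 * (1 - ‖ξ‖)), ‖ζ - ξ‖ ≤ 7 / 8 * (1 - ‖ξ‖) :=
      fun ζ hζ => by rwa [mem_closedBall, dist_eq_norm] at hζ
    have := Convex.norm_image_sub_le_of_norm_hasDerivWithin_le (C := A / (1 - ‖ξ‖))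
      (f := logDerivative φ) (s := closedBall ξ (7 / 8 * (1 - ‖ξ‖)))
      (fun ζ hζ => (hφ.hasDerivAt_logDerivative (mem' hξ (hcl ζ hζ))).hasDerivWithinAt)
      (fun ζ hζ => by
        have hm := mem' hξ (hcl ζ hζ)
        have h1 := hφ.norm_deriv_deriv_le hm
        have h2 := one_sub_norm_ge (hcl ζ hζ)
        have h3 : 0 < ‖deriv φ ζ‖ := norm_pos_iff.mpr (hφ.deriv_ne_zero hm)
        rw [norm_div, div_le_iff₀ h3]
        refine h1.trans ?_
        rw [div_le_iff₀ (by linarith)]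
        calc (10 : ℝ) ^ 11 * ‖deriv φ ζ‖
            = A / (1 - ‖ξ‖) * ‖deriv φ ζ‖ * (1 / 8 * (1 - ‖ξ‖)) := by
              rw [hA]; field_simp
          _ ≤ _ := by gcongr)
      (convex_closedBall _ _) (mem_closedBall_self (by positivity))
      (y := ξ') (by rwa [mem_closedBall, dist_eq_norm])
    refine this.trans ?_
    rw [div_mul_eq_mul_div, div_le_iff₀ hpos]
    gcongr
    linarith
  have hder : ∀ {φ : ℂ → ℂ}, BoundedSchlicht φ → ∀ {ξ ξ' : ℂ}, ξ ∈ ball (0 : ℂ) 1 →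
      ‖ξ' - ξ‖ ≤ 7 / 8 * (1 - ‖ξ‖) → ‖deriv φ ξ'‖ ≤ Real.exp A * ‖deriv φ ξ‖ ∧
        ‖deriv φ ξ‖ ≤ Real.exp A * ‖deriv φ ξ'‖ := by
    intro φ hφ ξ ξ' hξ h
    have h1 := hlog hφ hξ h
    have h2 := abs_le.mp ((Complex.abs_re_le_norm _).trans h1)
    rw [Complex.sub_re] at h2
    rw [← hφ.exp_logDerivative hξ, ← hφ.exp_logDerivative (mem' hξ h), Complex.norm_exp,
      Complex.norm_exp, ← Real.exp_add, ← Real.exp_add]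
    exact ⟨Real.exp_le_exp.mpr (by linarith), Real.exp_le_exp.mpr (by linarith)⟩
  have hA1 : (1 : ℝ) ≤ A := by rw [hA]; norm_num
  have hE : 1 ≤ Real.exp A := Real.one_le_exp (by linarith)
  have hAE : A ≤ A * Real.exp A := le_mul_of_one_le_right (by linarith) hE
  have hEA : Real.exp A ≤ A * Real.exp A := le_mul_of_one_le_left (by positivity) hA1
  refine ⟨A * Real.exp A, ⟨by linarith, ?_, ?_, ?_, ?_, ?_⟩⟩
  · intro φ hφ ξ ξ' hξ h
    exact (hlog hφ hξ h).trans hAE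
  · intro φ hφ ξ ξ' hξ h
    exact (hder hφ hξ h).1.trans (by gcongr)
  · intro φ hφ ξ ξ' hξ h
    exact (hder hφ hξ h).2.trans (by gcongr)
  · intro φ hφ ξ ξ' hξ h
    have hpos : 0 < 1 - ‖ξ‖ := by rw [mem_ball_zero_iff] at hξ; linarith
    have h2 := one_sub_norm_ge h
    refine (hφ.norm_deriv_deriv_le (mem' hξ h)).trans ?_
    rw [div_le_div_iff₀ (by linarith) hpos]
    calc (10 : ℝ) ^ 11 * ‖deriv φ ξ'‖ * (1 - ‖ξ‖)
        ≤ 10 ^ 11 * (Real.exp A * ‖deriv φ ξ‖) * (1 - ‖ξ‖) := by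
          gcongr; exact (hder hφ hξ h).1
      _ = A * Real.exp A * ‖deriv φ ξ‖ * (1 / 8 * (1 - ‖ξ‖)) := by rw [hA]; ring
      _ ≤ _ := by gcongr
  · intro φ hφ ξ ξ' hξ h
    have hpos : 0 < 1 - ‖ξ‖ := by rw [mem_ball_zero_iff] at hξ; linarith
    have hcl : ∀ ζ ∈ closedBall ξ (7 / 8 * (1 - ‖ξ‖)), ‖ζ - ξ‖ ≤ 7 / 8 * (1 - ‖ξ‖) :=
      fun ζ hζ => by rwa [mem_closedBall, dist_eq_norm] at hζ
    refine Convex.norm_image_sub_le_of_norm_hasDerivWithin_le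
      (f := φ) (s := closedBall ξ (7 / 8 * (1 - ‖ξ‖))) (f' := deriv φ)
      (fun ζ hζ => (hφ.holo.differentiableAt
        (isOpen_ball.mem_nhds (mem' hξ (hcl ζ hζ)))).hasDerivAt.hasDerivWithinAt)
      (fun ζ hζ => (hder hφ hξ (hcl ζ hζ)).1.trans (by gcongr))
      (convex_closedBall _ _) (mem_closedBall_self (by positivity))
      (y := ξ') (by rwa [mem_closedBall, dist_eq_norm])

end Distortion

section DyadicPacking

/-- The numerical inequality behind the exponential integrability of sums satisfying a
Carleson packing condition. -/
theorem exp_mul_le_of_packing {t A α m J : ℝ} (ht : 0 ≤ t) (hA : t * A ≤ 1 / 2) (hα : 0 ≤ α)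
    (hm : 0 ≤ m) (hJ : 0 ≤ J) (h : α * m + J ≤ A * m) :
    Real.exp (t * α) * (m + 2 * t * J) ≤ m + 2 * t * (α * m + J) := by
  rcases hm.eq_or_lt with rfl | hm
  · have : J = 0 := by nlinarith
    subst this
    simp
  have hαA : α ≤ A := by
    by_contra! hlt
    nlinarith
  have htα : t * α ≤ 1 / 2 := (mul_le_mul_of_nonneg_left hαA ht).trans hA
  have hexp : Real.exp (t * α) * (1 - t * α) ≤ 1 := by
    have h1 := Real.add_one_le_exp (-(t * α))
    have h2 : Real.exp (t * α) * Real.exp (-(t * α)) = 1 := by rw [← Real.exp_add]; simp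
    have h3 := mul_le_mul_of_nonneg_left h1 (Real.exp_pos (t * α)).le
    linarith
  have h2 : m + 2 * t * J ≤ (m + 2 * t * (α * m + J)) * (1 - t * α) := by
    have h3 : t * (α * m + J) ≤ m / 2 := by
      calc t * (α * m + J) ≤ t * (A * m) := by gcongr
        _ = (t * A) * m := by ring
        _ ≤ 1 / 2 * m := by gcongr
        _ = m / 2 := by ring
    have h4 : 0 ≤ t * α * (m / 2 - t * (α * m + J)) := mul_nonneg (by positivity) (by linarith)
    nlinarith
  have h5 : 0 ≤ m + 2 * t * (α * m + J) := by positivity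
  calc _ ≤ Real.exp (t * α) * ((m + 2 * t * (α * m + J)) * (1 - t * α)) := by gcongr
    _ = (m + 2 * t * (α * m + J)) * (Real.exp (t * α) * (1 - t * α)) := by ring
    _ ≤ (m + 2 * t * (α * m + J)) * 1 := by gcongr
    _ = _ := mul_one _

section Packing

variable {X ι : Type*}

/-- The sum over `d` generations, from the `k`-th on, of the weights of the cells
containing `x`. -/
def generationSum (π : ℕ → X → ι) (a : ℕ → ι → ℝ) (k d : ℕ) (x : X) : ℝ :=
  ∑ i ∈ Finset.range d, a (k + i) (π (k + i) x)

theorem generationSum_succ (π : ℕ → X → ι) (a : ℕ → ι → ℝ) (k d : ℕ) (x : X) :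
    generationSum π a k (d + 1) x = a k (π k x) + generationSum π a (k + 1) d x := by
  unfold generationSum
  rw [Finset.sum_range_succ', add_comm]
  simp only [add_zero]
  congr 1
  refine Finset.sum_congr rfl fun i _ => ?_
  rw [show k + (i + 1) = k + 1 + i by ring]

theorem generationSum_nonneg (π : ℕ → X → ι) {a : ℕ → ι → ℝ} (ha : ∀ k q, 0 ≤ a k q) (k d : ℕ)
    (x : X) : 0 ≤ generationSum π a k d x :=
  Finset.sum_nonneg fun _ _ => ha _ _

variable [MeasurableSpace X] [MeasurableSpace ι] [DiscreteMeasurableSpace ι]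

theorem measurable_generationSum {π : ℕ → X → ι} (hπ : ∀ k, Measurable (π k)) (a : ℕ → ι → ℝ)
    (k d : ℕ) : Measurable (generationSum π a k d) := by
  unfold generationSum
  exact Finset.measurable_fun_sum _ fun i _ => (Measurable.of_discrete (f := a (k + i))).comp (hπ _)

variable [Countable ι] {μ : Measure X} {π : ℕ → X → ι} {a : ℕ → ι → ℝ} {σ : ι → ι}

theorem lintegral_cell (hπ : ∀ k, Measurable (π k)) (hσ : ∀ k x, π k x = σ (π (k + 1) x))
    (k : ℕ) (q : ι) (f : X → ℝ≥0∞) :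
    ∫⁻ x in π k ⁻¹' {q}, f x ∂μ = ∑' q' : σ ⁻¹' {q}, ∫⁻ x in π (k + 1) ⁻¹' {q'.1}, f x ∂μ := by
  rw [← lintegral_biUnion (t := σ ⁻¹' {q}) (s := fun q' => π (k + 1) ⁻¹' {q'}) (to_countable _)]
  · congr 2
    ext x
    simp [hσ k x]
  · exact fun q' _ => hπ _ (measurableSet_singleton _)
  · intro q₁ _ q₂ _ hne
    refine Set.disjoint_left.mpr fun x h1 h2 => hne ?_
    rw [← show π (k + 1) x = q₁ from h1, ← show π (k + 1) x = q₂ from h2]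

theorem lintegral_exp_generationSum_le_aux (hπ : ∀ k, Measurable (π k))
    (hσ : ∀ k x, π k x = σ (π (k + 1) x)) (ha : ∀ k q, 0 ≤ a k q)
    (hfin : ∀ k q, μ (π k ⁻¹' {q}) ≠ ∞) {t A : ℝ} (ht : 0 ≤ t) (hA0 : 0 ≤ A) (hA : t * A ≤ 1 / 2)
    (hpack : ∀ k d q, ∫⁻ x in π k ⁻¹' {q}, ENNReal.ofReal (generationSum π a k d x) ∂μ ≤
      ENNReal.ofReal A * μ (π k ⁻¹' {q})) (d : ℕ) : ∀ k q,
    ∫⁻ x in π k ⁻¹' {q}, ENNReal.ofReal (Real.exp (t * generationSum π a k d x)) ∂μ ≤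
      μ (π k ⁻¹' {q}) + ENNReal.ofReal (2 * t) *
        ∫⁻ x in π k ⁻¹' {q}, ENNReal.ofReal (generationSum π a k d x) ∂μ := by
  induction d with
  | zero =>
    intro k q
    simp [generationSum]
  | succ d ih =>
    intro k q
    set F := π k ⁻¹' {q} with hF
    have hFm : MeasurableSet F := hπ k (measurableSet_singleton q)
    set J := ∫⁻ x in F, ENNReal.ofReal (generationSum π a (k + 1) d x) ∂μ with hJ
    have hE : ∫⁻ x in F, ENNReal.ofReal (Real.exp (t * generationSum π a (k + 1) d x)) ∂μ ≤
        μ F + ENNReal.ofReal (2 * t) * J := by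
      rw [hF, lintegral_cell hπ hσ]
      refine (ENNReal.tsum_le_tsum fun q' : σ ⁻¹' {q} => ih (k + 1) q'.1).trans_eq ?_
      rw [ENNReal.tsum_add, ENNReal.tsum_mul_left, hJ, hF, lintegral_cell hπ hσ]
      congr 1
      have := lintegral_cell (μ := μ) hπ hσ k q (fun _ => 1)
      simpa using this.symm
    have e1 : ∫⁻ x in F, ENNReal.ofReal (Real.exp (t * generationSum π a k (d + 1) x)) ∂μ =
        ENNReal.ofReal (Real.exp (t * a k q)) *
          ∫⁻ x in F, ENNReal.ofReal (Real.exp (t * generationSum π a (k + 1) d x)) ∂μ := by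
      rw [← lintegral_const_mul']
      · refine setLIntegral_congr_fun hFm fun x hx => ?_
        rw [← ENNReal.ofReal_mul (Real.exp_pos _).le, ← Real.exp_add, generationSum_succ,
          show π k x = q from hx, mul_add]
      · exact ENNReal.ofReal_ne_top
    have e2 : ∫⁻ x in F, ENNReal.ofReal (generationSum π a k (d + 1) x) ∂μ =
        ENNReal.ofReal (a k q) * μ F + J := by
      rw [hJ, ← setLIntegral_const, ← lintegral_add_left measurable_const]
      refine setLIntegral_congr_fun hFm fun x hx => ?_
      rw [← ENNReal.ofReal_add (ha _ _) (generationSum_nonneg π ha _ _ _), generationSum_succ,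
          show π k x = q from hx]
    have hp := hpack k (d + 1) q
    rw [e2] at hp
    rw [e1, e2]
    refine (mul_le_mul_right hE _).trans ?_
    have hμ : μ F ≠ ∞ := hfin k q
    have hJfin : J ≠ ∞ := by
      refine ne_top_of_le_ne_top ?_ (le_add_self.trans hp)
      exact ENNReal.mul_ne_top ENNReal.ofReal_ne_top hμ
    obtain ⟨m, hm0, hm⟩ : ∃ m : ℝ, 0 ≤ m ∧ μ F = ENNReal.ofReal m :=
      ⟨(μ F).toReal, ENNReal.toReal_nonneg, (ENNReal.ofReal_toReal hμ).symm⟩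
    obtain ⟨j, hj0, hj⟩ : ∃ j : ℝ, 0 ≤ j ∧ J = ENNReal.ofReal j :=
      ⟨J.toReal, ENNReal.toReal_nonneg, (ENNReal.ofReal_toReal hJfin).symm⟩
    have hα := ha k q
    rw [← hF] at hp
    rw [hm, hj] at hp ⊢
    rw [← ENNReal.ofReal_mul hα, ← ENNReal.ofReal_mul hA0,
      ← ENNReal.ofReal_add (by positivity) hj0, ENNReal.ofReal_le_ofReal_iff (by positivity)] at hp
    rw [← ENNReal.ofReal_mul (by positivity), ← ENNReal.ofReal_add hm0 (by positivity),
      ← ENNReal.ofReal_mul (by positivity), ← ENNReal.ofReal_mul hα,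
      ← ENNReal.ofReal_add (by positivity) hj0, ← ENNReal.ofReal_mul (by positivity),
      ← ENNReal.ofReal_add hm0 (by positivity)]
    exact ENNReal.ofReal_le_ofReal (exp_mul_le_of_packing ht hA hα hm0 hj0 hp)

/-- Exponential integrability of sums of weights satisfying a Carleson packing condition. -/
theorem lintegral_exp_generationSum_le (hπ : ∀ k, Measurable (π k))
    (hσ : ∀ k x, π k x = σ (π (k + 1) x)) (ha : ∀ k q, 0 ≤ a k q)
    (hfin : ∀ k q, μ (π k ⁻¹' {q}) ≠ ∞) {t A : ℝ} (ht : 0 ≤ t) (hA0 : 0 ≤ A) (hA : t * A ≤ 1 / 2)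
    (hpack : ∀ k d q, ∫⁻ x in π k ⁻¹' {q}, ENNReal.ofReal (generationSum π a k d x) ∂μ ≤
      ENNReal.ofReal A * μ (π k ⁻¹' {q})) (d k : ℕ) (q : ι) :
    ∫⁻ x in π k ⁻¹' {q}, ENNReal.ofReal (Real.exp (t * generationSum π a k d x)) ∂μ ≤
      2 * μ (π k ⁻¹' {q}) := by
  refine (lintegral_exp_generationSum_le_aux hπ hσ ha hfin ht hA0 hA hpack d k q).trans ?_
  calc _ ≤ μ (π k ⁻¹' {q}) + ENNReal.ofReal (2 * t) * (ENNReal.ofReal A * μ (π k ⁻¹' {q})) := by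
        gcongr
        exact hpack k d q
    _ ≤ μ (π k ⁻¹' {q}) + 1 * μ (π k ⁻¹' {q}) := by
        rw [← mul_assoc, ← ENNReal.ofReal_mul (by positivity)]
        gcongr
        rw [← ENNReal.ofReal_one]
        exact ENNReal.ofReal_le_ofReal (by linarith)
    _ = _ := by ring

end Packing

/-- The index of the dyadic square of side `s / 2 ^ k` containing `w`. -/
def dyadicIndex (s : ℝ) (k : ℕ) (w : ℂ) : ℤ × ℤ :=
  (⌊2 ^ k * w.re / s⌋, ⌊2 ^ k * w.im / s⌋)

theorem floor_two_mul_div_two (y : ℝ) : ⌊2 * y⌋ / 2 = ⌊y⌋ := by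
  symm
  rw [Int.floor_eq_iff]
  have h1 := Int.floor_le (2 * y)
  have h2 := Int.lt_floor_add_one (2 * y)
  have h3 : ⌊2 * y⌋ / 2 * 2 ≤ ⌊2 * y⌋ := by omega
  have h4 : ⌊2 * y⌋ + 1 ≤ ⌊2 * y⌋ / 2 * 2 + 2 := by omega
  have h3' : ((⌊2 * y⌋ / 2 : ℤ) : ℝ) * 2 ≤ ⌊2 * y⌋ := by exact_mod_cast h3
  have h4' : (⌊2 * y⌋ : ℝ) + 1 ≤ ((⌊2 * y⌋ / 2 : ℤ) : ℝ) * 2 + 2 := by exact_mod_cast h4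
  constructor <;> linarith

theorem dyadicIndex_parent (s : ℝ) (k : ℕ) (w : ℂ) :
    dyadicIndex s k w = ((dyadicIndex s (k + 1) w).1 / 2, (dyadicIndex s (k + 1) w).2 / 2) := by
  unfold dyadicIndex
  simp only [pow_succ']
  rw [← floor_two_mul_div_two (2 ^ k * w.re / s), ← floor_two_mul_div_two (2 ^ k * w.im / s)]
  ring_nf

theorem measurable_dyadicIndex (s : ℝ) (k : ℕ) : Measurable (dyadicIndex s k) := by
  unfold dyadicIndex
  refine Measurable.prodMk ?_ ?_
  · exact Int.measurable_floor.comp ((Complex.measurable_re.const_mul _).div_const _)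
  · exact Int.measurable_floor.comp ((Complex.measurable_im.const_mul _).div_const _)

theorem volume_Ico_reProdIm (a b c d : ℝ) :
    volume (Ico a b ×ℂ Ico c d) = ENNReal.ofReal (b - a) * ENNReal.ofReal (d - c) := by
  have h := Complex.volume_preserving_equiv_real_prod.measure_preimage
    (measurableSet_Ico.prod measurableSet_Ico : MeasurableSet (Ico a b ×ˢ Ico c d)).nullMeasurableSet
  rw [Measure.volume_eq_prod, Measure.prod_prod, Real.volume_Ico, Real.volume_Ico] at h
  rw [← h]
  congr 1

/-- Two indices are near when they belong to the same or to neighbouring squares. -/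
def IsNear (u v : ℤ × ℤ) : Prop := |u.1 - v.1| ≤ 1 ∧ |u.2 - v.2| ≤ 1

theorem IsNear.parent {u v : ℤ × ℤ} (h : IsNear u v) :
    IsNear (u.1 / 2, u.2 / 2) (v.1 / 2, v.2 / 2) := by
  unfold IsNear at *
  simp only [abs_le] at *
  omega

theorem isNear_dyadicIndex_of_le {s : ℝ} {k j : ℕ} (hkj : k ≤ j) {x w : ℂ}
    (h : IsNear (dyadicIndex s j x) (dyadicIndex s j w)) :
    IsNear (dyadicIndex s k x) (dyadicIndex s k w) := by
  induction j, hkj using Nat.le_induction with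
  | base => exact h
  | succ j _ ih =>
    apply ih
    rw [dyadicIndex_parent s j x, dyadicIndex_parent s j w]
    exact h.parent

theorem volume_cell {s : ℝ} (hs : 0 < s) (k : ℕ) (q : ℤ × ℤ) :
    volume (dyadicIndex s k ⁻¹' {q}) = ENNReal.ofReal ((s / 2 ^ k) ^ 2) := by
  have : dyadicIndex s k ⁻¹' {q} = Ico (q.1 * (s / 2 ^ k)) ((q.1 + 1) * (s / 2 ^ k)) ×ℂ
      Ico (q.2 * (s / 2 ^ k)) ((q.2 + 1) * (s / 2 ^ k)) := by
    ext w
    have key : ∀ (x : ℝ) (n : ℤ), ⌊2 ^ k * x / s⌋ = n ↔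
        x ∈ Ico (n * (s / 2 ^ k)) ((n + 1) * (s / 2 ^ k)) := by
      intro x n
      rw [Int.floor_eq_iff, le_div_iff₀ hs, div_lt_iff₀ hs, mem_Ico, ← mul_div_assoc,
        ← mul_div_assoc, div_le_iff₀ (by positivity), lt_div_iff₀ (by positivity), mul_comm x]
    rw [mem_preimage, mem_singleton_iff, Prod.ext_iff, Complex.mem_reProdIm, ← key, ← key]
    rfl
  rw [this, volume_Ico_reProdIm, ← ENNReal.ofReal_mul (by nlinarith [show 0 < s / 2 ^ k by positivity])]
  congr 1
  ring

theorem volume_near_le {s : ℝ} (hs : 0 < s) (k : ℕ) (q : ℤ × ℤ) :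
    volume {w | IsNear (dyadicIndex s k w) q} ≤ 9 * ENNReal.ofReal ((s / 2 ^ k) ^ 2) := by
  have hδ : 0 < s / 2 ^ k := by positivity
  have : {w | IsNear (dyadicIndex s k w) q} ⊆
      Ico ((q.1 - 1) * (s / 2 ^ k)) ((q.1 + 2) * (s / 2 ^ k)) ×ℂ
      Ico ((q.2 - 1) * (s / 2 ^ k)) ((q.2 + 2) * (s / 2 ^ k)) := by
    intro w hw
    have key : ∀ (x : ℝ) (n : ℤ), |⌊2 ^ k * x / s⌋ - n| ≤ 1 →
        x ∈ Ico ((n - 1) * (s / 2 ^ k)) ((n + 2) * (s / 2 ^ k)) := by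
      intro x n h
      have h1 := Int.floor_le (2 ^ k * x / s)
      have h2 := Int.lt_floor_add_one (2 ^ k * x / s)
      rw [abs_le] at h
      have h3 : (n : ℝ) - 1 ≤ ⌊2 ^ k * x / s⌋ := by exact_mod_cast (by omega : n - 1 ≤ ⌊2 ^ k * x / s⌋)
      have h4 : (⌊2 ^ k * x / s⌋ : ℝ) + 1 ≤ n + 2 := by
        exact_mod_cast (by omega : ⌊2 ^ k * x / s⌋ + 1 ≤ n + 2)
      have h5 := h3.trans h1
      have h6 := h2.trans_le h4
      rw [le_div_iff₀ hs] at h5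
      rw [div_lt_iff₀ hs] at h6
      rw [mem_Ico, ← mul_div_assoc, ← mul_div_assoc, div_le_iff₀ (by positivity),
        lt_div_iff₀ (by positivity), mul_comm x]
      exact ⟨h5, h6⟩
    exact ⟨key _ _ hw.1, key _ _ hw.2⟩
  refine (measure_mono this).trans_eq ?_
  rw [volume_Ico_reProdIm, ← ENNReal.ofReal_mul (by nlinarith), show (9 : ℝ≥0∞) = ENNReal.ofReal 9 by simp,
    ← ENNReal.ofReal_mul (by norm_num)]
  congr 1
  ring

end DyadicPacking

section MarcinkiewiczIntegral

section Marcinkiewicz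

variable {Y : Type*}

/-- The points whose scale `ρ` is comparable to `s / 2 ^ k`. -/
def scaleSet (s κ C : ℝ) (ρ : Y → ℝ) (k : ℕ) : Set Y :=
  {y | κ * (s / 2 ^ (k + 1)) ≤ ρ y ∧ ρ y ≤ C * (s / 2 ^ k)}

/-- The points near the square of index `q` whose scale is comparable to the side of the square. -/
def nearScaleSet (s κ C : ℝ) (p : Y → ℂ) (ρ : Y → ℝ) (j k : ℕ) (q : ℤ × ℤ) : Set Y :=
  {y | IsNear (dyadicIndex s j (p y)) q} ∩ scaleSet s κ C ρ k

theorem card_scale_le {ρ : Y → ℝ} {s κ C : ℝ} (hs : 0 < s) (hκ : 0 < κ) {m : ℕ} (hm : 2 * C < κ * 2 ^ m) (k d : ℕ)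
    (y : Y) : ∑ i ∈ Finset.range d, (scaleSet s κ C ρ (k + i)).indicator (1 : Y → ℝ≥0∞) y ≤ m := by
  classical
  have h1 : ∑ i ∈ Finset.range d, (scaleSet s κ C ρ (k + i)).indicator (1 : Y → ℝ≥0∞) y =
      ((Finset.range d).filter fun i => y ∈ scaleSet s κ C ρ (k + i)).card := by
    simp only [indicator_apply, Pi.one_apply]
    rw [Finset.sum_boole]
  rw [h1]
  set T := (Finset.range d).filter fun i => y ∈ scaleSet s κ C ρ (k + i) with hT
  norm_cast
  rcases T.eq_empty_or_nonempty with h0 | hne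
  · rw [h0]; simp
  have hmin := T.min'_mem hne
  set i₀ := T.min' hne with hi₀
  have hsub : T ⊆ Finset.Ico i₀ (i₀ + m) := by
    intro i hi
    rw [Finset.mem_Ico]
    refine ⟨T.min'_le i hi, ?_⟩
    by_contra! hge
    have h2 := (Finset.mem_filter.mp hi).2.2
    have h3 := (Finset.mem_filter.mp hmin).2.1
    have h4 := h3.trans h2
    have hC : 0 < C := by
      by_contra! hC0
      have : C * (s / 2 ^ (k + i)) ≤ 0 := mul_nonpos_of_nonpos_of_nonneg hC0 (by positivity)
      have : 0 < κ * (s / 2 ^ (k + i₀ + 1)) := by positivity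
      linarith
    have h5 : C * (s / 2 ^ (k + i)) ≤ C * (s / 2 ^ (k + i₀ + m)) := by
      refine mul_le_mul_of_nonneg_left (div_le_div_of_nonneg_left hs.le (by positivity) ?_) hC.le
      exact pow_le_pow_right₀ one_le_two (by omega)
    have h6 := h4.trans h5
    rw [pow_add _ (k + i₀) m, pow_succ] at h6
    have h7 : (0 : ℝ) < s / 2 ^ (k + i₀) := by positivity
    have e1 : κ * (s / (2 ^ (k + i₀) * 2)) = (s / 2 ^ (k + i₀)) * (κ / 2) := by field_simp
    have e2 : C * (s / (2 ^ (k + i₀) * 2 ^ m)) = (s / 2 ^ (k + i₀)) * (C / 2 ^ m) := by field_simp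
    rw [e1, e2] at h6
    have h8 := le_of_mul_le_mul_left h6 h7
    rw [div_le_div_iff₀ (by norm_num) (by positivity)] at h8
    linarith
  refine (Finset.card_le_card hsub).trans ?_
  simp

variable [MeasurableSpace Y]

/-- The density of `nearScaleSet` relative to the area of the square. -/
def scaleDensity (ν : Measure Y) (s κ C : ℝ) (p : Y → ℂ) (ρ : Y → ℝ) (k : ℕ) (q : ℤ × ℤ) : ℝ :=
  4 ^ (k + 1) / s ^ 2 * (ν (nearScaleSet s κ C p ρ k k q)).toReal

variable {ν : Measure Y} {p : Y → ℂ} {ρ : Y → ℝ} {s κ C : ℝ}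

theorem measurableSet_near (hp : Measurable p) (s : ℝ) (k : ℕ) (q : ℤ × ℤ) :
    MeasurableSet {y | IsNear (dyadicIndex s k (p y)) q} :=
  ((measurable_dyadicIndex s k).comp hp) (MeasurableSet.of_discrete (s := {u | IsNear u q}))

theorem measurableSet_scaleSet (hρ : Measurable ρ) (s κ C : ℝ) (k : ℕ) :
    MeasurableSet (scaleSet s κ C ρ k) :=
  (measurableSet_le measurable_const hρ).inter (measurableSet_le hρ measurable_const)

theorem measure_near_le (hν : ∀ A, MeasurableSet A → ν (p ⁻¹' A) ≤ volume A) (hs : 0 < s) (k : ℕ)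
    (q : ℤ × ℤ) : ν {y | IsNear (dyadicIndex s k (p y)) q} ≤
      9 * ENNReal.ofReal ((s / 2 ^ k) ^ 2) :=
  (hν {w | IsNear (dyadicIndex s k w) q} (measurableSet_near measurable_id s k q)).trans
    (volume_near_le hs k q)

theorem measure_nearScaleSet_ne_top (hν : ∀ A, MeasurableSet A → ν (p ⁻¹' A) ≤ volume A)
    (hs : 0 < s) (j k : ℕ) (q : ℤ × ℤ) : ν (nearScaleSet s κ C p ρ j k q) ≠ ∞ := by
  refine ne_top_of_le_ne_top ?_ ((measure_mono inter_subset_left).trans (measure_near_le hν hs j q))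
  exact ENNReal.mul_ne_top (by simp) ENNReal.ofReal_ne_top

theorem ofReal_scaleDensity (hν : ∀ A, MeasurableSet A → ν (p ⁻¹' A) ≤ volume A)
    (hs : 0 < s) (k : ℕ) (q : ℤ × ℤ) : ENNReal.ofReal (scaleDensity ν s κ C p ρ k q) =
      ENNReal.ofReal (4 ^ (k + 1) / s ^ 2) * ν (nearScaleSet s κ C p ρ k k q) := by
  rw [scaleDensity, ENNReal.ofReal_mul (by positivity),
    ENNReal.ofReal_toReal (measure_nearScaleSet_ne_top hν hs k k q)]

theorem IsNear.symm {u v : ℤ × ℤ} (h : IsNear u v) : IsNear v u := by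
  unfold IsNear at *
  rwa [abs_sub_comm v.1, abs_sub_comm v.2]

theorem lintegral_scaleDensity_le [SFinite ν] (hp : Measurable p) (hρ : Measurable ρ)
    (hν : ∀ A, MeasurableSet A → ν (p ⁻¹' A) ≤ volume A) (hs : 0 < s) {k j : ℕ} (hkj : k ≤ j)
    (q : ℤ × ℤ) :
    ∫⁻ w in dyadicIndex s k ⁻¹' {q},
      ENNReal.ofReal (scaleDensity ν s κ C p ρ j (dyadicIndex s j w)) ≤
      36 * ν (nearScaleSet s κ C p ρ k j q) := by
  set F := dyadicIndex s k ⁻¹' {q} with hF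
  set G := nearScaleSet s κ C p ρ k j q with hG
  have hFm : MeasurableSet F := measurable_dyadicIndex s k (measurableSet_singleton q)
  have hGm : MeasurableSet G := (measurableSet_near hp s k q).inter (measurableSet_scaleSet hρ _ _ _ _)
  set E : Set (ℂ × Y) := {x | x.2 ∈ nearScaleSet s κ C p ρ j j (dyadicIndex s j x.1)} with hE
  have hEm : MeasurableSet E := by
    have h1 : MeasurableSet {x : ℂ × Y | IsNear (dyadicIndex s j (p x.2)) (dyadicIndex s j x.1)} := by
      have : Measurable fun x : ℂ × Y => (dyadicIndex s j (p x.2), dyadicIndex s j x.1) :=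
        ((measurable_dyadicIndex s j).comp (hp.comp measurable_snd)).prodMk
          ((measurable_dyadicIndex s j).comp measurable_fst)
      exact this (MeasurableSet.of_discrete (s := {u : (ℤ × ℤ) × (ℤ × ℤ) | IsNear u.1 u.2}))
    exact h1.inter (measurable_snd (measurableSet_scaleSet hρ s κ C j))
  have hswap : ∫⁻ w in F, ν (nearScaleSet s κ C p ρ j j (dyadicIndex s j w)) =
      ∫⁻ y, volume ({w | (w, y) ∈ E} ∩ F) ∂ν := by
    have h1 : ∀ w, ν (nearScaleSet s κ C p ρ j j (dyadicIndex s j w)) =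
        ∫⁻ y, E.indicator 1 (w, y) ∂ν := by
      intro w
      exact (lintegral_indicator_one (measurable_prodMk_left (x := w) hEm)).symm
    simp_rw [h1]
    rw [lintegral_lintegral_swap (f := fun w y => E.indicator 1 (w, y))
      ((measurable_one.indicator hEm).aemeasurable)]
    refine lintegral_congr fun y => ?_
    have hy := measurable_prodMk_right (y := y) hEm
    exact (lintegral_indicator_one hy).trans (Measure.restrict_apply hy)
  have hbound : ∀ y, volume ({w | (w, y) ∈ E} ∩ F) ≤
      G.indicator (fun _ => 9 * ENNReal.ofReal ((s / 2 ^ j) ^ 2)) y := by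
    intro y
    by_cases hy : y ∈ G
    · rw [indicator_of_mem hy]
      refine (measure_mono ?_).trans (volume_near_le hs j (dyadicIndex s j (p y)))
      intro w hw
      exact (show IsNear _ _ from hw.1.1).symm
    · rw [indicator_of_notMem hy]
      have : {w | (w, y) ∈ E} ∩ F = ∅ := by
        refine eq_empty_of_forall_notMem fun w hw => hy ⟨?_, hw.1.2⟩
        have h1 := isNear_dyadicIndex_of_le hkj (show IsNear _ _ from hw.1.1)
        rw [show dyadicIndex s k w = q from hw.2] at h1
        exact h1
      rw [this, measure_empty]
  simp_rw [ofReal_scaleDensity hν hs]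
  rw [lintegral_const_mul' _ _ ENNReal.ofReal_ne_top, hswap]
  calc _ ≤ ENNReal.ofReal (4 ^ (j + 1) / s ^ 2) *
        ∫⁻ y, G.indicator (fun _ => 9 * ENNReal.ofReal ((s / 2 ^ j) ^ 2)) y ∂ν := by
          gcongr with y
          exact hbound y
    _ = 36 * ν G := by
      rw [lintegral_indicator_const hGm, ← mul_assoc]
      congr 1
      rw [show (9 : ℝ≥0∞) = ENNReal.ofReal 9 by simp, show (36 : ℝ≥0∞) = ENNReal.ofReal 36 by simp,
        ← ENNReal.ofReal_mul (by norm_num), ← ENNReal.ofReal_mul (by positivity)]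
      congr 1
      have : (4 : ℝ) ^ j = 2 ^ j * 2 ^ j := by rw [← mul_pow]; norm_num
      rw [pow_succ, this]
      field_simp
      norm_num

theorem lintegral_generationSum_scaleDensity_le [SFinite ν] (hp : Measurable p)
    (hρ : Measurable ρ) (hν : ∀ A, MeasurableSet A → ν (p ⁻¹' A) ≤ volume A) (hs : 0 < s)
    (hκ : 0 < κ) {m : ℕ} (hm : 2 * C < κ * 2 ^ m) (k d : ℕ) (q : ℤ × ℤ) :
    ∫⁻ w in dyadicIndex s k ⁻¹' {q},
      ENNReal.ofReal (generationSum (dyadicIndex s) (scaleDensity ν s κ C p ρ) k d w) ≤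
      ENNReal.ofReal (324 * m) * volume (dyadicIndex s k ⁻¹' {q}) := by
  unfold generationSum
  have h0 : ∀ w, ENNReal.ofReal (∑ i ∈ Finset.range d,
      scaleDensity ν s κ C p ρ (k + i) (dyadicIndex s (k + i) w)) = ∑ i ∈ Finset.range d,
      ENNReal.ofReal (scaleDensity ν s κ C p ρ (k + i) (dyadicIndex s (k + i) w)) := fun w =>
    ENNReal.ofReal_sum_of_nonneg fun i _ => by unfold scaleDensity; positivity
  simp_rw [h0]
  rw [lintegral_finsetSum]
  swap
  · intro i _
    exact ((Measurable.of_discrete (f := scaleDensity ν s κ C p ρ (k + i))).comp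
      (measurable_dyadicIndex s (k + i))).ennreal_ofReal
  set N := {y | IsNear (dyadicIndex s k (p y)) q} with hN
  have hNm : MeasurableSet N := measurableSet_near hp s k q
  calc _ ≤ ∑ i ∈ Finset.range d, 36 * ν (nearScaleSet s κ C p ρ k (k + i) q) :=
        Finset.sum_le_sum fun i _ => lintegral_scaleDensity_le hp hρ hν hs (by omega) q
    _ = 36 * ∫⁻ y in N, ∑ i ∈ Finset.range d,
          (scaleSet s κ C ρ (k + i)).indicator (1 : Y → ℝ≥0∞) y ∂ν := by
        rw [← Finset.mul_sum, lintegral_finsetSum _ fun i _ =>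
          measurable_one.indicator (measurableSet_scaleSet hρ _ _ _ _)]
        congr 1
        refine Finset.sum_congr rfl fun i _ => ?_
        rw [lintegral_indicator_one (measurableSet_scaleSet hρ _ _ _ _),
          Measure.restrict_apply (measurableSet_scaleSet hρ _ _ _ _), inter_comm]
        rfl
    _ ≤ 36 * ∫⁻ y in N, m ∂ν := by
        gcongr with y
        exact card_scale_le hs hκ hm k d y
    _ ≤ 36 * (m * (9 * ENNReal.ofReal ((s / 2 ^ k) ^ 2))) := by
        rw [setLIntegral_const]
        gcongr
        exact measure_near_le hν hs k q
    _ = _ := by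
        rw [volume_cell hs, ENNReal.ofReal_mul (by norm_num)]
        simp only [ENNReal.ofReal_natCast, ENNReal.ofReal_ofNat]
        rw [show (324 : ℝ≥0∞) = 36 * 9 by norm_num]
        ring

/-- A Marcinkiewicz type integral: it collects the points `y` whose scale `ρ y` is comparable,
between the factors `κ` and `C`, to the distance from `p y` to `w`. -/
def scaleIntegral (ν : Measure Y) (s κ C : ℝ) (p : Y → ℂ) (ρ : Y → ℝ) (w : ℂ) : ℝ≥0∞ :=
  ∫⁻ y in {y | κ * ‖p y - w‖ ≤ ρ y ∧ ρ y ≤ C * ‖p y - w‖ ∧ ‖p y - w‖ ≤ s},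
    ENNReal.ofReal ((‖p y - w‖ ^ 2)⁻¹) ∂ν

theorem abs_floor_sub_le {x y : ℝ} (h : |x - y| ≤ 1) : |⌊x⌋ - ⌊y⌋| ≤ 1 := by
  rw [abs_le] at h ⊢
  have h1 := Int.floor_le x
  have h2 := Int.lt_floor_add_one x
  have h3 := Int.floor_le y
  have h4 := Int.lt_floor_add_one y
  have h5 : ⌊y⌋ < ⌊x⌋ + 2 := by
    have : (⌊y⌋ : ℝ) < ⌊x⌋ + 2 := by linarith
    exact_mod_cast this
  have h6 : ⌊x⌋ < ⌊y⌋ + 2 := by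
    have : (⌊x⌋ : ℝ) < ⌊y⌋ + 2 := by linarith
    exact_mod_cast this
  omega

theorem isNear_of_norm_sub_le (hs : 0 < s) {k : ℕ} {x w : ℂ} (h : ‖x - w‖ ≤ s / 2 ^ k) :
    IsNear (dyadicIndex s k x) (dyadicIndex s k w) := by
  have key : ∀ a b : ℝ, |a - b| ≤ s / 2 ^ k → |2 ^ k * a / s - 2 ^ k * b / s| ≤ 1 := by
    intro a b hab
    rw [← sub_div, ← mul_sub, abs_div, abs_mul, abs_of_pos hs, abs_of_pos (by positivity : (0:ℝ) < 2 ^ k),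
      div_le_one hs]
    rw [le_div_iff₀ (by positivity)] at hab
    linarith
  constructor
  · exact abs_floor_sub_le (key _ _ ((Complex.abs_re_le_norm (x - w)).trans h))
  · exact abs_floor_sub_le (key _ _ ((Complex.abs_im_le_norm (x - w)).trans h))

theorem scaleIntegral_le_tsum (hp : Measurable p) (hρ : Measurable ρ)
    (hν : ∀ A, MeasurableSet A → ν (p ⁻¹' A) ≤ volume A) (hs : 0 < s) (hκ : 0 < κ) (hC : 0 < C)
    (w : ℂ) : scaleIntegral ν s κ C p ρ w ≤
      ∑' k, ENNReal.ofReal (scaleDensity ν s κ C p ρ k (dyadicIndex s k w)) := by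
  have hset : MeasurableSet {y | κ * ‖p y - w‖ ≤ ρ y ∧ ρ y ≤ C * ‖p y - w‖ ∧ ‖p y - w‖ ≤ s} := by
    have hn : Measurable fun y => ‖p y - w‖ := (hp.sub_const w).norm
    exact (measurableSet_le (hn.const_mul _) hρ).inter
      ((measurableSet_le hρ (hn.const_mul _)).inter (measurableSet_le hn measurable_const))
  have hmeas : ∀ k, MeasurableSet (nearScaleSet s κ C p ρ k k (dyadicIndex s k w)) := fun k =>
    (measurableSet_near hp s k _).inter (measurableSet_scaleSet hρ _ _ _ _)
  have hrhs : ∑' k, ENNReal.ofReal (scaleDensity ν s κ C p ρ k (dyadicIndex s k w)) =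
      ∫⁻ y, ∑' k, (nearScaleSet s κ C p ρ k k (dyadicIndex s k w)).indicator
        (fun _ => ENNReal.ofReal (4 ^ (k + 1) / s ^ 2)) y ∂ν := by
    rw [lintegral_tsum fun k => (measurable_const.indicator (hmeas k)).aemeasurable]
    congr 1
    ext k
    rw [ofReal_scaleDensity hν hs, lintegral_indicator_const (hmeas k)]
  rw [hrhs, scaleIntegral, ← lintegral_indicator hset]
  refine lintegral_mono fun y => ?_
  by_cases hy : y ∈ {y | κ * ‖p y - w‖ ≤ ρ y ∧ ρ y ≤ C * ‖p y - w‖ ∧ ‖p y - w‖ ≤ s}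
  swap
  · rw [indicator_of_notMem hy]
    exact zero_le
  rw [indicator_of_mem hy]
  obtain ⟨h1, h2, h3⟩ := hy
  rcases (norm_nonneg (p y - w)).eq_or_lt with h0 | h0
  · rw [← h0]
    simp
  obtain ⟨k, hk1, hk2⟩ := exists_nat_pow_near (one_le_div₀ h0 |>.mpr h3) (one_lt_two)
  rw [le_div_iff₀ h0] at hk1
  rw [div_lt_iff₀ h0] at hk2
  have hk1' : ‖p y - w‖ ≤ s / 2 ^ k := by
    rw [le_div_iff₀ (by positivity)]; linarith
  have hk2' : s / 2 ^ (k + 1) ≤ ‖p y - w‖ := by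
    rw [div_le_iff₀ (by positivity)]; linarith
  refine le_trans ?_ (ENNReal.le_tsum k)
  rw [indicator_of_mem]
  · apply ENNReal.ofReal_le_ofReal
    have h4 : (4 : ℝ) ^ (k + 1) / s ^ 2 = ((s / 2 ^ (k + 1)) ^ 2)⁻¹ := by
      rw [div_pow, inv_div, ← pow_mul, mul_comm (k + 1), pow_mul]
      norm_num
    rw [h4]
    exact inv_anti₀ (by positivity) (by gcongr)
  · refine ⟨isNear_of_norm_sub_le hs hk1', ?_, ?_⟩
    · exact (by gcongr : κ * (s / 2 ^ (k + 1)) ≤ κ * ‖p y - w‖).trans h1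
    · exact h2.trans (by gcongr)

/-- Exponential integrability of the Marcinkiewicz type integral. -/
theorem exists_dominating_exp_scaleIntegral [SFinite ν] (hp : Measurable p) (hρ : Measurable ρ)
    (hν : ∀ A, MeasurableSet A → ν (p ⁻¹' A) ≤ volume A) (hs : 0 < s) (hκ : 0 < κ) (hC : 0 < C)
    {m : ℕ} (hm : 2 * C < κ * 2 ^ m) {t : ℝ} (ht : 0 ≤ t) (htm : t * (324 * m) ≤ 1 / 2) :
    ∃ W : ℂ → ℝ≥0∞, Measurable W ∧
      (∀ q, ∫⁻ w in dyadicIndex s 0 ⁻¹' {q}, W w ≤ 2 * ENNReal.ofReal (s ^ 2)) ∧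
      ∀ w x, ENNReal.ofReal x ≤ scaleIntegral ν s κ C p ρ w →
        ENNReal.ofReal (Real.exp (t * (x - 1))) ≤ W w := by
  set a := scaleDensity ν s κ C p ρ with ha
  have ha0 : ∀ k q, 0 ≤ a k q := fun k q => by rw [ha]; unfold scaleDensity; positivity
  have hπ := measurable_dyadicIndex s
  have hSm : ∀ d, Measurable fun w =>
      ENNReal.ofReal (Real.exp (t * generationSum (dyadicIndex s) a 0 d w)) := fun d =>
    (Real.measurable_exp.comp ((measurable_generationSum hπ a 0 d).const_mul t)).ennreal_ofReal
  refine ⟨fun w => ⨆ d, ENNReal.ofReal (Real.exp (t * generationSum (dyadicIndex s) a 0 d w)),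
    Measurable.iSup hSm, fun q => ?_, fun w x hx => ?_⟩
  · rw [lintegral_iSup hSm]
    · refine iSup_le fun d => ?_
      refine (lintegral_exp_generationSum_le (σ := fun q => (q.1 / 2, q.2 / 2)) hπ
        (dyadicIndex_parent s) ha0 (fun k q => by rw [volume_cell hs]; exact ENNReal.ofReal_ne_top)
        ht (by positivity) htm
        (fun k d q => lintegral_generationSum_scaleDensity_le hp hρ hν hs hκ hm k d q) d 0 q).trans ?_
      rw [volume_cell hs]
      simp
    · intro d d' hd w
      apply ENNReal.ofReal_le_ofReal
      apply Real.exp_le_exp.mpr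
      refine mul_le_mul_of_nonneg_left ?_ ht
      unfold generationSum
      exact Finset.sum_le_sum_of_subset_of_nonneg (Finset.range_subset_range.mpr hd)
        fun _ _ _ => ha0 _ _
  · simp only
    have main : ∃ d, x - 1 ≤ generationSum (dyadicIndex s) a 0 d w := by
      rcases le_or_gt x 1 with h1 | h1
      · exact ⟨0, by simp [generationSum, h1]⟩
      have h2 : ENNReal.ofReal (x - 1) <
          ∑' k, ENNReal.ofReal (scaleDensity ν s κ C p ρ k (dyadicIndex s k w)) := by
        refine lt_of_lt_of_le ?_ (hx.trans (scaleIntegral_le_tsum hp hρ hν hs hκ hC w))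
        rw [ENNReal.ofReal_lt_ofReal_iff (by linarith)]
        linarith
      rw [ENNReal.tsum_eq_iSup_nat, lt_iSup_iff] at h2
      obtain ⟨d, hd⟩ := h2
      refine ⟨d, ?_⟩
      rw [← ENNReal.ofReal_sum_of_nonneg fun i _ => ha0 _ _] at hd
      have := (ENNReal.ofReal_lt_ofReal_iff_of_nonneg (by linarith)).mp hd
      simp only [generationSum, zero_add]
      exact this.le
    obtain ⟨d, hd⟩ := main
    refine le_trans ?_ (le_iSup _ d)
    exact ENNReal.ofReal_le_ofReal (Real.exp_le_exp.mpr (mul_le_mul_of_nonneg_left hd ht))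

end Marcinkiewicz

end MarcinkiewiczIntegral

section AreaMeasure

variable {φ : ℂ → ℂ}

/-- The pull-back under `φ` of the area measure of the image of the unit disk. -/
def areaMeasure (φ : ℂ → ℂ) : Measure ℂ :=
  (volume.restrict (ball 0 1)).withDensity fun ξ => ENNReal.ofReal (‖deriv φ ξ‖ ^ 2)

/-- The conformal radius, up to a factor between `1` and `2`. -/
def conformalScale (φ : ℂ → ℂ) (ξ : ℂ) : ℝ := (1 - ‖ξ‖) * ‖deriv φ ξ‖

theorem measurable_conformalScale (φ : ℂ → ℂ) : Measurable (conformalScale φ) :=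
  (measurable_const.sub measurable_norm).mul (measurable_deriv φ).norm

instance (φ : ℂ → ℂ) : SFinite (areaMeasure φ) := by
  unfold areaMeasure
  infer_instance

theorem det_restrictScalars_smulRight (c : ℂ) :
    (((1 : ℂ →L[ℂ] ℂ).smulRight c).restrictScalars ℝ).det = ‖c‖ ^ 2 := by
  have : (((1 : ℂ →L[ℂ] ℂ).smulRight c).restrictScalars ℝ).det =
      LinearMap.det (((LinearMap.toSpanSingleton ℂ ℂ c)).restrictScalars ℝ) := by
    unfold ContinuousLinearMap.det
    congr 1
  rw [this, LinearMap.det_restrictScalars, Algebra.norm_complex_eq, ← Complex.normSq_eq_norm_sq]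
  simp

theorem lintegral_image_eq_lintegral_deriv (hd : DifferentiableOn ℂ φ (ball 0 1))
    (hi : InjOn φ (ball 0 1)) {A : Set ℂ} (hA : MeasurableSet A) (hsub : A ⊆ ball 0 1)
    (g : ℂ → ℝ≥0∞) :
    ∫⁻ w in φ '' A, g w = ∫⁻ ξ in A, ENNReal.ofReal (‖deriv φ ξ‖ ^ 2) * g (φ ξ) := by
  rw [lintegral_image_eq_lintegral_abs_det_fderiv_mul volume hA
    (f' := fun ξ => ((1 : ℂ →L[ℂ] ℂ).smulRight (deriv φ ξ)).restrictScalars ℝ) _ (hi.mono hsub)]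
  · simp_rw [det_restrictScalars_smulRight, abs_pow, abs_norm]
  · intro ξ hξ
    exact ((hd.differentiableAt (isOpen_ball.mem_nhds (hsub hξ))).hasDerivAt.hasFDerivAt.restrictScalars
      ℝ).hasFDerivWithinAt

theorem measurable_indicator_disk (hd : DifferentiableOn ℂ φ (ball 0 1)) :
    Measurable ((ball (0 : ℂ) 1).indicator φ) := by
  refine measurable_of_restrict_of_restrict_compl (s := ball (0 : ℂ) 1) measurableSet_ball ?_ ?_
  · have h1 : Measurable ((ball (0 : ℂ) 1).domRestrict φ) :=
      (continuousOn_iff_continuous_domRestrict.mp hd.continuousOn).measurable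
    convert! h1 using 1
    ext x
    simp
  · convert! (measurable_const : Measurable fun _ : ((ball (0 : ℂ) 1)ᶜ : Set ℂ) => (0 : ℂ)) using 1
    ext x
    simp only [Set.domRestrict_apply]
    exact indicator_of_notMem x.2 _

theorem areaMeasure_preimage_le (hd : DifferentiableOn ℂ φ (ball 0 1))
    (hi : InjOn φ (ball 0 1)) (A : Set ℂ) (hA : MeasurableSet A) :
    areaMeasure φ ((ball (0 : ℂ) 1).indicator φ ⁻¹' A) ≤ volume A := by
  have hm := measurable_indicator_disk hd hA
  rw [areaMeasure, withDensity_apply _ hm, Measure.restrict_restrict hm]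
  have := lintegral_image_eq_lintegral_deriv hd hi (hm.inter measurableSet_ball)
    inter_subset_right (fun _ => 1)
  simp only [mul_one, lintegral_const, MeasurableSet.univ, Measure.restrict_apply, univ_inter,
    one_mul] at this
  rw [← this]
  refine measure_mono ?_
  rintro _ ⟨ξ, ⟨h1, h2⟩, rfl⟩
  rwa [mem_preimage, indicator_of_mem h2] at h1

theorem areaMeasure_univ_ne_top (hφ : BoundedSchlicht φ) : areaMeasure φ univ ≠ ∞ := by
  have := lintegral_image_eq_lintegral_deriv hφ.holo hφ.inj measurableSet_ball
    subset_rfl (fun _ => 1)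
  simp only [mul_one, lintegral_const, MeasurableSet.univ, Measure.restrict_apply, univ_inter,
    one_mul] at this
  rw [areaMeasure, withDensity_apply _ MeasurableSet.univ, Measure.restrict_univ, ← this]
  exact hφ.bdd.measure_lt_top.ne

theorem dyadicIndex_zero_mem {s : ℝ} {w : ℂ} (hw : ‖w‖ < s) :
    dyadicIndex s 0 w ∈ ({-1, 0} ×ˢ {-1, 0} : Finset (ℤ × ℤ)) := by
  have hs : 0 < s := (norm_nonneg w).trans_lt hw
  have key : ∀ x : ℝ, |x| < s → ⌊2 ^ 0 * x / s⌋ = -1 ∨ ⌊2 ^ 0 * x / s⌋ = 0 := by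
    intro x hx
    rw [abs_lt] at hx
    have h1 : -1 ≤ ⌊2 ^ 0 * x / s⌋ := by
      rw [Int.le_floor, le_div_iff₀ hs]
      push_cast
      linarith
    have h2 : ⌊2 ^ 0 * x / s⌋ < 1 := by
      rw [Int.floor_lt, div_lt_iff₀ hs]
      push_cast
      linarith
    omega
  have h1 := key _ ((Complex.abs_re_le_norm w).trans_lt hw)
  have h2 := key _ ((Complex.abs_im_le_norm w).trans_lt hw)
  rw [Finset.mem_product]
  simp only [dyadicIndex, Finset.mem_insert, Finset.mem_singleton]
  exact ⟨h1, h2⟩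

theorem lintegral_image_le_of_cells (hφ : BoundedSchlicht φ) {s : ℝ}
    (hs : ∀ ξ ∈ ball (0 : ℂ) 1, ‖φ ξ‖ < s) {W : ℂ → ℝ≥0∞} {B : ℝ≥0∞}
    (hW : ∀ q, ∫⁻ w in dyadicIndex s 0 ⁻¹' {q}, W w ≤ B) :
    ∫⁻ ξ in ball (0 : ℂ) 1, ENNReal.ofReal (‖deriv φ ξ‖ ^ 2) * W (φ ξ) ≤ 4 * B := by
  rw [← lintegral_image_eq_lintegral_deriv hφ.holo hφ.inj measurableSet_ball subset_rfl]
  have hsub : φ '' ball 0 1 ⊆ ⋃ q ∈ ({-1, 0} ×ˢ {-1, 0} : Finset (ℤ × ℤ)),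
      dyadicIndex s 0 ⁻¹' {q} := by
    rintro _ ⟨ξ, hξ, rfl⟩
    simp only [mem_iUnion]
    exact ⟨_, dyadicIndex_zero_mem (hs ξ hξ), rfl⟩
  calc _ ≤ ∫⁻ w in ⋃ q ∈ ({-1, 0} ×ˢ {-1, 0} : Finset (ℤ × ℤ)), dyadicIndex s 0 ⁻¹' {q}, W w :=
        lintegral_mono_set hsub
    _ = ∑ q ∈ ({-1, 0} ×ˢ {-1, 0} : Finset (ℤ × ℤ)), ∫⁻ w in dyadicIndex s 0 ⁻¹' {q}, W w := by
        refine lintegral_biUnion_finset ?_ (fun q _ =>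
          measurable_dyadicIndex s 0 (measurableSet_singleton q)) _
        intro q₁ _ q₂ _ hne
        refine Set.disjoint_left.mpr fun x h1 h2 => hne ?_
        rw [← show dyadicIndex s 0 x = q₁ from h1, ← show dyadicIndex s 0 x = q₂ from h2]
    _ ≤ ∑ q ∈ ({-1, 0} ×ˢ {-1, 0} : Finset (ℤ × ℤ)), B := Finset.sum_le_sum fun q _ => hW q
    _ = 4 * B := by
        rw [Finset.sum_const, Finset.card_product, Finset.card_pair (by norm_num)]
        simp

/-- The divided difference of a univalent function, as a function of two variables. -/
theorem BoundedSchlicht.continuousOn_dslope (hφ : BoundedSchlicht φ) :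
    ContinuousOn (fun x : ℂ × ℂ => dslope φ x.1 x.2) (ball 0 1 ×ˢ ball 0 1) := by
  rintro ⟨a, b⟩ ⟨ha, hb⟩
  refine ContinuousAt.continuousWithinAt ?_
  have hna := isOpen_ball.mem_nhds ha
  have hnb := isOpen_ball.mem_nhds hb
  have hca := (hφ.holo.differentiableAt hna).continuousAt
  have hcb := (hφ.holo.differentiableAt hnb).continuousAt
  by_cases hab : b = a
  · subst hab
    have hst := (hφ.holo.analyticAt hnb).hasStrictDerivAt
    have hd' : ContinuousAt (deriv φ) b :=
      ((hφ.holo.deriv isOpen_ball).differentiableAt hnb).continuousAt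
    rw [Metric.continuousAt_iff']
    intro ε hε
    have h1 := hst.isLittleO.def (c := ε / 2) (by positivity)
    have h2 : ∀ᶠ x : ℂ × ℂ in 𝓝 (b, b), ‖deriv φ x.1 - deriv φ b‖ < ε := by
      have h3 : ContinuousAt (fun x : ℂ × ℂ => deriv φ x.1) (b, b) :=
        ContinuousAt.comp_of_eq (f := fun x : ℂ × ℂ => x.1) hd' continuousAt_fst rfl
      have := Metric.continuousAt_iff'.mp h3 ε hε
      simpa [dist_eq_norm] using this
    filter_upwards [h1, h2] with ⟨u, v⟩ h1 h2
    rw [dslope_same, dist_eq_norm]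
    by_cases huv : v = u
    · subst huv
      rwa [dslope_same]
    · simp only at h1 ⊢
      rw [dslope_of_ne _ huv, slope_def_field]
      have hne : v - u ≠ 0 := sub_ne_zero.mpr huv
      have e : (φ v - φ u) / (v - u) - deriv φ b =
          -(φ u - φ v - (u - v) • deriv φ b) / (v - u) := by
        rw [smul_eq_mul]
        field_simp
        ring
      rw [e, norm_div, norm_neg, div_lt_iff₀ (norm_pos_iff.mpr hne)]
      rw [norm_sub_rev u v] at h1
      have : 0 < ‖v - u‖ := norm_pos_iff.mpr hne
      simp only [ContinuousLinearMap.toSpanSingleton_apply] at h1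
      nlinarith
  · have hev : (fun x : ℂ × ℂ => dslope φ x.1 x.2) =ᶠ[𝓝 (a, b)]
        fun x => (φ x.2 - φ x.1) / (x.2 - x.1) := by
      have hne : ∀ᶠ x : ℂ × ℂ in 𝓝 (a, b), x.2 ≠ x.1 :=
        (isOpen_ne_fun continuous_snd continuous_fst).mem_nhds hab
      filter_upwards [hne] with x hx
      rw [dslope_of_ne _ hx, slope_def_field]
    refine ContinuousAt.congr_of_eventuallyEq ?_ hev
    refine ContinuousAt.div (ContinuousAt.sub ?_ ?_) (by fun_prop) (sub_ne_zero.mpr hab)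
    · exact ContinuousAt.comp_of_eq (f := fun x : ℂ × ℂ => x.2) hcb continuousAt_snd rfl
    · exact ContinuousAt.comp_of_eq (f := fun x : ℂ × ℂ => x.1) hca continuousAt_fst rfl

end AreaMeasure

section LogDividedDifference

variable {φ : ℂ → ℂ} {K : ℝ}

/-- A function `ℓ` of two variables which is a logarithm of the divided difference of `φ`,
normalized on the diagonal. -/
structure IsLogDslope (φ : ℂ → ℂ) (ℓ : ℂ → ℂ → ℂ) : Prop where
  cont : ContinuousOn (fun x : ℂ × ℂ => ℓ x.1 x.2) (ball 0 1 ×ˢ ball 0 1)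
  diag : ∀ z ∈ ball (0 : ℂ) 1, ℓ z z = logDerivative φ z
  deriv_left : ∀ {ξ z : ℂ}, ξ ∈ ball (0 : ℂ) 1 → z ∈ ball (0 : ℂ) 1 → ξ ≠ z →
    HasDerivAt (fun ξ => ℓ ξ z) (deriv φ ξ / (φ ξ - φ z) - 1 / (ξ - z)) ξ
  deriv_right : ∀ {ξ z : ℂ}, ξ ∈ ball (0 : ℂ) 1 → z ∈ ball (0 : ℂ) 1 → z ≠ ξ →
    HasDerivAt (fun z => ℓ ξ z) (deriv φ z / (φ z - φ ξ) - 1 / (z - ξ)) z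

/-- Two continuous logarithms of the same function on a preconnected set which agree at a point
are equal. -/
theorem eqOn_of_exp_eq {X : Type*} [TopologicalSpace X] {U : Set X} (hU : IsPreconnected U)
    {f g : X → ℂ} (hf : ContinuousOn f U) (hg : ContinuousOn g U)
    (h : ∀ x ∈ U, Complex.exp (f x) = Complex.exp (g x)) {x₀ : X} (hx₀ : x₀ ∈ U)
    (h0 : f x₀ = g x₀) : EqOn f g U := by
  refine Complex.isCoveringMap_exp.eqOn_of_comp_eqOn hU hf hg (fun x hx => ?_) hx₀ h0
  exact Subtype.ext (h x hx)

theorem BoundedSchlicht.dslope_ne_zero (hφ : BoundedSchlicht φ) :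
    ∀ x ∈ (ball (0 : ℂ) 1 ×ˢ ball (0 : ℂ) 1), dslope φ x.1 x.2 ≠ 0 := by
  intro x hx
  obtain ⟨ha, hb⟩ := mem_prod.mp hx
  by_cases hab : x.2 = x.1
  · rw [hab, dslope_same]
    exact hφ.deriv_ne_zero ha
  · rw [dslope_of_ne _ hab, slope_def_field]
    exact div_ne_zero (fun h => hab (hφ.inj hb ha (sub_eq_zero.mp h))) (sub_ne_zero.mpr hab)
theorem isOpen_bidisk : IsOpen (ball (0 : ℂ) 1 ×ˢ ball (0 : ℂ) 1) := isOpen_ball.prod isOpen_ball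

theorem convex_bidisk : Convex ℝ (ball (0 : ℂ) 1 ×ˢ ball (0 : ℂ) 1) :=
  (convex_ball (0 : ℂ) 1).prod (convex_ball (0 : ℂ) 1)

theorem BoundedSchlicht.exists_log_dslope (hφ : BoundedSchlicht φ) :
    ∃ L : ℂ × ℂ → ℂ, ContinuousOn L (ball 0 1 ×ˢ ball 0 1) ∧
      (∀ x ∈ ball (0 : ℂ) 1 ×ˢ ball (0 : ℂ) 1, Complex.exp (L x) = dslope φ x.1 x.2) ∧
      L (0, 0) = 0 := by
  have h00 : ((0 : ℂ), (0 : ℂ)) ∈ ball (0 : ℂ) 1 ×ˢ ball (0 : ℂ) 1 :=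
    mk_mem_prod (mem_ball_self one_pos) (mem_ball_self one_pos)
  exact exists_continuous_log (g := fun x : ℂ × ℂ => dslope φ x.1 x.2) convex_bidisk isOpen_bidisk
    hφ.continuousOn_dslope hφ.dslope_ne_zero h00 (c := 0)
    (by simp only; rw [dslope_same, hφ.deriv_zero, Complex.exp_zero])
theorem BoundedSchlicht.exists_isLogDslope (hφ : BoundedSchlicht φ) :
    ∃ ℓ, IsLogDslope φ ℓ := by
  have h00 : (0 : ℂ) ∈ ball (0 : ℂ) 1 := mem_ball_self one_pos
  have hsub : ∀ {a b : ℂ}, a ∈ ball (0 : ℂ) 1 → b ∈ ball (0 : ℂ) 1 → b ≠ a → φ b - φ a ≠ 0 :=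
    fun ha hb hne h => hne (hφ.inj hb ha (sub_eq_zero.mp h))
  obtain ⟨L, hLc, hLe, hL0⟩ := hφ.exists_log_dslope
  have hopen := isOpen_bidisk
  refine ⟨fun a b => L (a, b), hLc, ?_, ?_, ?_⟩
  · have hd := logDerivative_spec hφ.holo hφ.deriv_zero fun _ hz => hφ.deriv_ne_zero hz
    have hc : ContinuousOn (fun z : ℂ => L (z, z)) (ball 0 1) :=
      hLc.comp (f := fun z : ℂ => (z, z)) (by fun_prop) fun z hz => ⟨hz, hz⟩
    refine eqOn_of_exp_eq (convex_ball (0 : ℂ) 1).isPreconnected (f := fun z => L (z, z))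
      (g := logDerivative φ) hc hd.2.1.continuousOn ?_ h00 (hL0.trans hd.1.symm)
    intro z hz
    have := hLe (z, z) ⟨hz, hz⟩
    rw [dslope_same] at this
    rw [hd.2.2 z hz, ← this]
  · intro ξ z hξ hz hne
    have h1 : HasDerivAt (fun ξ => (φ ξ - φ z) / (ξ - z))
        ((deriv φ ξ * (ξ - z) - (φ ξ - φ z) * 1) / (ξ - z) ^ 2) ξ :=
      ((hφ.holo.differentiableAt (isOpen_ball.mem_nhds hξ)).hasDerivAt.sub_const _).fun_div
        ((hasDerivAt_id ξ).sub_const z) (sub_ne_zero.mpr hne)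
    have h2 := hasDerivAt_of_exp_eq (ℓ := fun ξ => L (ξ, z)) (z := ξ)
      (ContinuousAt.comp_of_eq (f := fun ξ => (ξ, z)) (hLc.continuousAt (hopen.mem_nhds ⟨hξ, hz⟩))
        (by fun_prop) rfl) (by
        filter_upwards [isOpen_ball.mem_nhds hξ, isOpen_ne.mem_nhds hne] with w hw hwz
        rw [hLe (w, z) ⟨hw, hz⟩]
        simp only
        rw [dslope_of_ne _ (Ne.symm hwz), slope_def_field, ← neg_sub (φ w), ← neg_sub w z,
          neg_div_neg_eq]) h1
    refine h2.congr_deriv ?_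
    have e1 := hsub hz hξ hne
    have e2 := sub_ne_zero.mpr hne
    field_simp
  · intro ξ z hξ hz hne
    have h1 : HasDerivAt (fun z => (φ z - φ ξ) / (z - ξ))
        ((deriv φ z * (z - ξ) - (φ z - φ ξ) * 1) / (z - ξ) ^ 2) z :=
      ((hφ.holo.differentiableAt (isOpen_ball.mem_nhds hz)).hasDerivAt.sub_const _).fun_div
        ((hasDerivAt_id z).sub_const ξ) (sub_ne_zero.mpr hne)
    have h2 := hasDerivAt_of_exp_eq (ℓ := fun z => L (ξ, z)) (z := z)
      (ContinuousAt.comp_of_eq (f := fun z => (ξ, z)) (hLc.continuousAt (hopen.mem_nhds ⟨hξ, hz⟩))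
        (by fun_prop) rfl) (by
        filter_upwards [isOpen_ball.mem_nhds hz, isOpen_ne.mem_nhds hne] with w hw hwz
        rw [hLe (ξ, w) ⟨hξ, hw⟩]
        simp only
        rw [dslope_of_ne _ hwz, slope_def_field]) h1
    refine h2.congr_deriv ?_
    have e1 := hsub hξ hz hne
    have e2 := sub_ne_zero.mpr hne
    field_simp

/-- Comparison of distances to an image point at nearby points. -/
theorem IsDistortionConst.norm_sub_le_left (hK : IsDistortionConst K) (hφ : BoundedSchlicht φ)
    {ξ ξ' z : ℂ} (hξ : ξ ∈ ball (0 : ℂ) 1) (hz : z ∈ ball (0 : ℂ) 1)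
    (h : ‖ξ' - ξ‖ ≤ 1 / 2 * (1 - ‖ξ‖)) (hzξ : 1 / 8 * (1 - ‖ξ‖) ≤ ‖z - ξ'‖) :
    ‖φ ξ - φ z‖ ≤ (1 + 512 * K ^ 2) * ‖φ ξ' - φ z‖ := by
  have hpos : 0 < 1 - ‖ξ‖ := by rw [mem_ball_zero_iff] at hξ; linarith
  have h' : ‖ξ' - ξ‖ ≤ 7 / 8 * (1 - ‖ξ‖) := h.trans (by linarith)
  have h1 := hK.sub_le hφ hξ h'
  have h2 := hK.le_deriv hφ hξ h'
  have h3 := hφ.le_norm_sub (ε := 1 / 8 * (1 - ‖ξ‖)) (by positivity) (one_sub_norm_ge h') hz hzξ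
  have hK1 := hK.one_le
  have h4 : ‖φ ξ - φ z‖ ≤ ‖φ ξ' - φ z‖ + ‖φ ξ' - φ ξ‖ := by
    have : φ ξ - φ z = (φ ξ' - φ z) - (φ ξ' - φ ξ) := by ring
    rw [this]
    exact norm_sub_le _ _
  rw [norm_sub_rev (φ z)] at h3
  have h5 : ‖φ ξ' - φ ξ‖ ≤ K * (K * ‖deriv φ ξ'‖) * (1 / 2 * (1 - ‖ξ‖)) := h1.trans (by gcongr)
  have h6 : K * (K * ‖deriv φ ξ'‖) * (1 / 2 * (1 - ‖ξ‖)) =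
      512 * K ^ 2 * (1 / 8 * (1 - ‖ξ‖) * ‖deriv φ ξ'‖ / 128) := by ring
  have h7 : 512 * K ^ 2 * (1 / 8 * (1 - ‖ξ‖) * ‖deriv φ ξ'‖ / 128) ≤
      512 * K ^ 2 * ‖φ ξ' - φ z‖ := by gcongr
  linarith

theorem IsDistortionConst.norm_sub_le_right (hK : IsDistortionConst K) (hφ : BoundedSchlicht φ)
    {ξ ξ' z : ℂ} (hξ : ξ ∈ ball (0 : ℂ) 1) (hz : z ∈ ball (0 : ℂ) 1)
    (h : ‖ξ' - ξ‖ ≤ 1 / 2 * (1 - ‖ξ‖)) (hzξ : 1 / 8 * (1 - ‖ξ‖) ≤ ‖z - ξ‖) :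
    ‖φ ξ' - φ z‖ ≤ (1 + 512 * K ^ 2) * ‖φ ξ - φ z‖ := by
  have hpos : 0 < 1 - ‖ξ‖ := by rw [mem_ball_zero_iff] at hξ; linarith
  have h' : ‖ξ' - ξ‖ ≤ 7 / 8 * (1 - ‖ξ‖) := h.trans (by linarith)
  have h1 := hK.sub_le hφ hξ h'
  have h3 := hφ.le_norm_sub (ε := 1 / 8 * (1 - ‖ξ‖)) (by positivity) (by linarith) hz hzξ
  have hK1 := hK.one_le
  have h4 : ‖φ ξ' - φ z‖ ≤ ‖φ ξ - φ z‖ + ‖φ ξ' - φ ξ‖ := by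
    have : φ ξ' - φ z = (φ ξ - φ z) + (φ ξ' - φ ξ) := by ring
    rw [this]
    exact norm_add_le _ _
  rw [norm_sub_rev (φ z)] at h3
  have h5 : ‖φ ξ' - φ ξ‖ ≤ K * ‖deriv φ ξ‖ * (1 / 2 * (1 - ‖ξ‖)) := h1.trans (by gcongr)
  have h6 : K * ‖deriv φ ξ‖ * (1 / 2 * (1 - ‖ξ‖)) =
      512 * K * (1 / 8 * (1 - ‖ξ‖) * ‖deriv φ ξ‖ / 128) := by ring
  have h7 : 512 * K * (1 / 8 * (1 - ‖ξ‖) * ‖deriv φ ξ‖ / 128) ≤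
      512 * K ^ 2 * ‖φ ξ - φ z‖ := by
    gcongr
    nlinarith
  linarith

/-- The points at distance `2⁻ʲ` from the boundary on the radius with direction `e`. -/
def radialPoint (e : ℂ) (j : ℕ) : ℂ := ((1 - (1 / 2) ^ j : ℝ) : ℂ) * e

theorem norm_ofReal_mul {e : ℂ} (he : ‖e‖ = 1) {s : ℝ} (hs : 0 ≤ s) : ‖(s : ℂ) * e‖ = s := by
  rw [norm_mul, he, Complex.norm_real, Real.norm_of_nonneg hs, mul_one]

theorem norm_ofReal_mul_sub {e : ℂ} (he : ‖e‖ = 1) {s t : ℝ} (hst : s ≤ t) :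
    ‖(t : ℂ) * e - (s : ℂ) * e‖ = t - s := by
  rw [← sub_mul, ← Complex.ofReal_sub, norm_ofReal_mul he (by linarith)]

theorem half_pow_le_one (j : ℕ) : ((1 : ℝ) / 2) ^ j ≤ 1 :=
  pow_le_one₀ (by norm_num) (by norm_num)

theorem one_sub_norm_radialPoint {e : ℂ} (he : ‖e‖ = 1) (j : ℕ) :
    1 - ‖radialPoint e j‖ = (1 / 2) ^ j := by
  rw [radialPoint, norm_ofReal_mul he (by linarith [half_pow_le_one j])]
  ring

theorem radialPoint_mem {e : ℂ} (he : ‖e‖ = 1) (j : ℕ) : radialPoint e j ∈ ball (0 : ℂ) 1 := by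
  have := one_sub_norm_radialPoint he j
  rw [mem_ball_zero_iff]
  have : (0 : ℝ) < (1 / 2) ^ j := by positivity
  linarith

/-- A point at which the estimates of the `N`-th generation apply. -/
structure IsGeneration (N : ℕ) (r : ℝ) : Prop where
  upper : 1 - r ≤ (1 / 2) ^ (N + 1)
  lower : (1 / 2) ^ (N + 3) ≤ 1 - r

theorem IsGeneration.half_le {N : ℕ} {r : ℝ} (h : IsGeneration N r) : 1 / 2 ≤ r := by
  have h1 := h.upper
  rw [pow_succ] at h1
  linarith [half_pow_le_one N]

theorem IsGeneration.lt_one {N : ℕ} {r : ℝ} (h : IsGeneration N r) : r < 1 := by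
  have h1 := h.lower
  have : (0 : ℝ) < (1 / 2) ^ (N + 3) := by positivity
  linarith

theorem IsGeneration.mem {N : ℕ} {r : ℝ} (h : IsGeneration N r) {e : ℂ} (he : ‖e‖ = 1) :
    (r : ℂ) * e ∈ ball (0 : ℂ) 1 := by
  rw [mem_ball_zero_iff, norm_ofReal_mul he (by linarith [h.half_le])]
  exact h.lt_one

theorem norm_sub_le_of_hasDerivAt {f f' : ℝ → ℂ} {a b C : ℝ} (hab : a ≤ b)
    (hf : ∀ x ∈ Icc a b, HasDerivAt f (f' x) x) (hC : ∀ x ∈ Ico a b, ‖f' x‖ ≤ C) :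
    ‖f b - f a‖ ≤ C * (b - a) :=
  norm_image_sub_le_of_norm_deriv_le_segment' (fun x hx => (hf x hx).hasDerivWithinAt) hC b
    (right_mem_Icc.mpr hab)

end LogDividedDifference

section RadialVariation

variable {φ : ℂ → ℂ} {K : ℝ} {ℓ : ℂ → ℂ → ℂ} {e : ℂ} {N : ℕ} {r : ℝ}

theorem hasDerivAt_ofReal_mul (e : ℂ) (s : ℝ) {f : ℂ → ℂ} {f' : ℂ}
    (hf : HasDerivAt f f' ((s : ℂ) * e)) :
    HasDerivAt (fun s : ℝ => f ((s : ℂ) * e)) (f' * e) s := by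
  have h1 : HasDerivAt (fun s : ℂ => s * e) e (s : ℂ) := by
    simpa using (hasDerivAt_id (s : ℂ)).mul_const e
  exact (HasDerivAt.comp (s : ℂ) hf h1).comp_ofReal

theorem ofReal_mul_ne {e : ℂ} (he : ‖e‖ = 1) {s t : ℝ} (h : s ≠ t) : (s : ℂ) * e ≠ (t : ℂ) * e := by
  have he0 : e ≠ 0 := by
    rintro rfl
    simp at he
  simpa [he0] using h

theorem ofReal_mul_mem {e : ℂ} (he : ‖e‖ = 1) {s : ℝ} (hs : 0 ≤ s) (hs1 : s < 1) :
    (s : ℂ) * e ∈ ball (0 : ℂ) 1 := by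
  rw [mem_ball_zero_iff, norm_ofReal_mul he hs]
  exact hs1

theorem IsLogDslope.hasDerivAt_radial (hℓ : IsLogDslope φ ℓ) (he : ‖e‖ = 1) {s : ℝ} (hs : 0 ≤ s)
    (hsr : s < r) (hr : r < 1) :
    HasDerivAt (fun s : ℝ => ℓ ((s : ℂ) * e) ((r : ℂ) * e) + (Real.log (r - s) : ℝ))
      (deriv φ ((s : ℂ) * e) / (φ ((s : ℂ) * e) - φ ((r : ℂ) * e)) * e) s := by
  have h1 := hasDerivAt_ofReal_mul e s (hℓ.deriv_left (ofReal_mul_mem he hs (by linarith))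
    (ofReal_mul_mem he (by linarith) hr) (ofReal_mul_ne he hsr.ne))
  have h2 : HasDerivAt (fun s : ℝ => Real.log (r - s)) (-1 / (r - s)) s :=
    ((hasDerivAt_id s).const_sub r).log (by simp only [id]; linarith)
  have h3 := h1.add h2.ofReal_comp
  refine h3.congr_deriv ?_
  have he0 : e ≠ 0 := by
    rintro rfl
    simp at he
  have h4 : (r : ℂ) - s ≠ 0 := by
    rw [← Complex.ofReal_sub]
    exact_mod_cast (by linarith : r - s ≠ 0)
  have h5 : (s : ℂ) * e - r * e = -((r - s) * e) := by ring
  rw [h5]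
  push_cast
  field_simp
  ring

/-- The ratio of the size of the image of a Whitney disk to its distance to the image of `z`. -/
def radialRatio (φ : ℂ → ℂ) (e z : ℂ) (j : ℕ) : ℝ :=
  (1 / 2) ^ j * ‖deriv φ (radialPoint e j)‖ / ‖φ (radialPoint e j) - φ z‖

theorem IsGeneration.sub_ge (h : IsGeneration N r) {j : ℕ} (hj : j < N) :
    3 / 4 * (1 / 2) ^ j ≤ r - (1 - (1 / 2) ^ j) := by
  have h1 : ((1 : ℝ) / 2) ^ (N + 1) ≤ (1 / 2) ^ (j + 2) :=
    pow_le_pow_of_le_one (by norm_num) (by norm_num) (by omega)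
  have h2 := h.upper
  rw [pow_add _ j 2] at h1
  norm_num at h1 h2 ⊢
  linarith

theorem IsLogDslope.norm_radial_segment_le (hK : IsDistortionConst K) (hφ : BoundedSchlicht φ)
    (hℓ : IsLogDslope φ ℓ) (he : ‖e‖ = 1) (hN : IsGeneration N r) {j : ℕ} (hj : j < N) :
    ‖(ℓ (radialPoint e (j + 1)) ((r : ℂ) * e) + (Real.log (r - (1 - (1 / 2) ^ (j + 1))) : ℝ)) -
      (ℓ (radialPoint e j) ((r : ℂ) * e) + (Real.log (r - (1 - (1 / 2) ^ j)) : ℝ))‖ ≤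
      K * (1 + 512 * K ^ 2) * radialRatio φ e ((r : ℂ) * e) j := by
  set δ : ℝ := (1 / 2) ^ j with hδ
  have hδ0 : 0 < δ := by positivity
  have hδ1 : δ ≤ 1 := half_pow_le_one j
  have hδs : (1 / 2 : ℝ) ^ (j + 1) = δ / 2 := by rw [hδ, pow_succ]; ring
  have hrδ := hN.sub_ge hj
  rw [← hδ] at hrδ
  have hr1 := hN.lt_one
  have hK1 := hK.one_le
  have hzm := hN.mem he
  have hξm := radialPoint_mem he j
  have hξn := one_sub_norm_radialPoint he j
  rw [← hδ] at hξn
  have hξr : radialPoint e j = ((1 - δ : ℝ) : ℂ) * e := rfl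
  have hpt : ∀ x ∈ Icc (1 - δ) (1 - δ / 2), ‖(x : ℂ) * e - radialPoint e j‖ ≤ 1 / 2 * δ ∧
      0 ≤ x ∧ x < r ∧ 1 / 4 * δ ≤ ‖(r : ℂ) * e - (x : ℂ) * e‖ := by
    intro x hx
    have h3 : x < r := by linarith [hx.2]
    rw [hξr, norm_ofReal_mul_sub he hx.1, norm_ofReal_mul_sub he h3.le]
    exact ⟨by linarith [hx.2], by linarith [hx.1], h3, by linarith [hx.2]⟩
  have hwpos : 0 < ‖φ (radialPoint e j) - φ ((r : ℂ) * e)‖ := by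
    rw [norm_pos_iff, sub_ne_zero]
    intro h
    exact ofReal_mul_ne he (by linarith) (hφ.inj hξm hzm h)
  have key := norm_sub_le_of_hasDerivAt (a := 1 - δ) (b := 1 - δ / 2)
    (C := K * ‖deriv φ (radialPoint e j)‖ * (1 + 512 * K ^ 2) /
      ‖φ (radialPoint e j) - φ ((r : ℂ) * e)‖) (by linarith)
    (fun x hx => hℓ.hasDerivAt_radial he (hpt x hx).2.1 (hpt x hx).2.2.1 hr1) (by
      intro x hx
      obtain ⟨h1, h2, h3, h4⟩ := hpt x (Ico_subset_Icc_self hx)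
      have h5 := hK.deriv_le hφ hξm (ξ' := (x : ℂ) * e) (by rw [hξn]; linarith)
      have h6 := hK.norm_sub_le_left hφ hξm hzm (ξ' := (x : ℂ) * e) (by rw [hξn]; exact h1)
        (by rw [hξn]; linarith)
      have h7 : 0 < ‖φ ((x : ℂ) * e) - φ ((r : ℂ) * e)‖ := by
        rw [norm_pos_iff, sub_ne_zero]
        intro h
        exact ofReal_mul_ne he h3.ne (hφ.inj (ofReal_mul_mem he h2 (by linarith)) hzm h)
      rw [norm_mul, he, mul_one, norm_div, div_le_div_iff₀ h7 hwpos]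
      calc _ ≤ (K * ‖deriv φ (radialPoint e j)‖) *
            ((1 + 512 * K ^ 2) * ‖φ ((x : ℂ) * e) - φ ((r : ℂ) * e)‖) := by gcongr
        _ = _ := by ring)
  rw [hδs]
  have hξ' : radialPoint e (j + 1) = ((1 - δ / 2 : ℝ) : ℂ) * e := by rw [radialPoint, hδs]
  rw [hξ', hξr]
  refine key.trans ?_
  rw [radialRatio, ← hδ]
  have e1 : K * ‖deriv φ (radialPoint e j)‖ * (1 + 512 * K ^ 2) /
      ‖φ (radialPoint e j) - φ ((r : ℂ) * e)‖ * (1 - δ / 2 - (1 - δ)) =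
      (K * (1 + 512 * K ^ 2) *
        (δ * ‖deriv φ (radialPoint e j)‖ / ‖φ (radialPoint e j) - φ ((r : ℂ) * e)‖)) / 2 := by
    field_simp
    ring
  rw [e1]
  have : 0 ≤ K * (1 + 512 * K ^ 2) *
        (δ * ‖deriv φ (radialPoint e j)‖ / ‖φ (radialPoint e j) - φ ((r : ℂ) * e)‖) := by positivity
  linarith

/-- The variation along a radius of the logarithm of the divided difference. -/
theorem IsLogDslope.norm_radial_le (hK : IsDistortionConst K) (hφ : BoundedSchlicht φ)
    (hℓ : IsLogDslope φ ℓ) (he : ‖e‖ = 1) (hN : IsGeneration N r) :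
    ‖(ℓ (radialPoint e N) ((r : ℂ) * e) + (Real.log (r - (1 - (1 / 2) ^ N)) : ℝ)) -
      (ℓ 0 ((r : ℂ) * e) + (Real.log r : ℝ))‖ ≤
      K * (1 + 512 * K ^ 2) * ∑ j ∈ Finset.range N, radialRatio φ e ((r : ℂ) * e) j := by
  set G : ℕ → ℂ := fun j =>
    ℓ (radialPoint e j) ((r : ℂ) * e) + (Real.log (r - (1 - (1 / 2) ^ j)) : ℝ) with hG
  have h0 : ℓ 0 ((r : ℂ) * e) + (Real.log r : ℝ) = G 0 := by simp [hG, radialPoint]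
  rw [h0, show ℓ (radialPoint e N) ((r : ℂ) * e) + (Real.log (r - (1 - (1 / 2) ^ N)) : ℝ) = G N
    from rfl, ← Finset.sum_range_sub, Finset.mul_sum]
  refine (norm_sum_le _ _).trans (Finset.sum_le_sum fun j hj => ?_)
  exact hℓ.norm_radial_segment_le hK hφ he hN (Finset.mem_range.mp hj)

theorem IsGeneration.sub_bounds (h : IsGeneration N r) :
    1 / 2 * (1 / 2) ^ N ≤ r - (1 - (1 / 2) ^ N) ∧ r - (1 - (1 / 2) ^ N) ≤ 7 / 8 * (1 / 2) ^ N := by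
  have h1 := h.upper
  have h2 := h.lower
  rw [pow_add] at h1 h2
  norm_num at h1 h2 ⊢
  constructor <;> linarith

theorem IsLogDslope.norm_tail_le (hK : IsDistortionConst K) (hφ : BoundedSchlicht φ)
    (hℓ : IsLogDslope φ ℓ) (he : ‖e‖ = 1) (hN : IsGeneration N r) :
    ‖ℓ ((r : ℂ) * e) ((r : ℂ) * e) - ℓ (radialPoint e N) ((r : ℂ) * e)‖ ≤ 128 * K ^ 2 := by
  set δ : ℝ := (1 / 2) ^ N with hδ
  have hδ0 : 0 < δ := by positivity
  have hδ1 : δ ≤ 1 := half_pow_le_one N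
  obtain ⟨hr2, hr3⟩ := hN.sub_bounds
  rw [← hδ] at hr2 hr3
  have hr1 := hN.lt_one
  have hK1 := hK.one_le
  have hzm := hN.mem he
  have hξm := radialPoint_mem he N
  have hξn := one_sub_norm_radialPoint he N
  rw [← hδ] at hξn
  have hξr : radialPoint e N = ((1 - δ : ℝ) : ℂ) * e := rfl
  set ξ := radialPoint e N with hξ
  set z := (r : ℂ) * e with hz
  set D := ‖deriv φ ξ‖ with hD
  have hDpos : 0 < D := norm_pos_iff.mpr (hφ.deriv_ne_zero hξm)
  have hball : ∀ {ζ : ℂ}, ‖ζ - ξ‖ ≤ 7 / 8 * δ → ζ ∈ ball (0 : ℂ) 1 := by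
    intro ζ hζ
    have := one_sub_norm_ge (ξ := ξ) (ξ' := ζ) (by rwa [hξn])
    rw [mem_ball_zero_iff]
    rw [hξn] at this
    linarith
  have hzξ : ‖z - ξ‖ ≤ 7 / 8 * δ := by
    rw [hz, hξr, norm_ofReal_mul_sub he (by linarith)]
    linarith
  have hcont : ContinuousOn (fun s : ℝ => ℓ ((s : ℂ) * e) z) (Icc (1 - δ) r) := by
    refine hℓ.cont.comp (f := fun s : ℝ => ((s : ℂ) * e, z)) (by fun_prop) ?_
    intro s hs
    exact ⟨ofReal_mul_mem he (by linarith [hs.1]) (by linarith [hs.2]), hzm⟩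
  have key := norm_image_sub_le_of_norm_deriv_right_le_segment hcont
    (f' := fun s : ℝ => (deriv φ ((s : ℂ) * e) / (φ ((s : ℂ) * e) - φ z) -
      1 / ((s : ℂ) * e - z)) * e) (C := 128 * K ^ 2 / δ) (by
        intro s hs
        exact (hasDerivAt_ofReal_mul e s (hℓ.deriv_left (ofReal_mul_mem he (by linarith [hs.1])
          (by linarith [hs.2])) hzm (ofReal_mul_ne he hs.2.ne))).hasDerivWithinAt) (by
        intro s hs
        set ζ := (s : ℂ) * e with hζ
        have hζξ : ‖ζ - ξ‖ ≤ 7 / 8 * δ := by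
          rw [hζ, hξr, norm_ofReal_mul_sub he hs.1]
          linarith [hs.2]
        have hζm := hball hζξ
        have hzζ : ‖z - ζ‖ = r - s := norm_ofReal_mul_sub he hs.2.le
        have hpos : 0 < ‖z - ζ‖ := by rw [hzζ]; linarith [hs.2]
        have hne : ζ - z ≠ 0 := by
          rw [← norm_pos_iff, norm_sub_rev]; exact hpos
        have h1 := hφ.le_norm_sub (ξ := ζ) hpos (by
          rw [hzζ, hζ, norm_ofReal_mul he (by linarith [hs.1])]; linarith) hzm le_rfl
        have h2 := hK.le_deriv hφ hξm (ξ' := ζ) (by rwa [hξn])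
        rw [norm_sub_rev (φ z)] at h1
        have hne' : 0 < ‖φ ζ - φ z‖ := by
          rw [norm_pos_iff, sub_ne_zero]
          intro h
          exact hne (sub_eq_zero.mpr (hφ.inj hζm hzm h))
        have h3 : ‖φ z - φ ζ - deriv φ ζ * (z - ζ)‖ ≤ K * D / δ * ‖z - ζ‖ * ‖z - ζ‖ := by
          have hseg : ∀ x ∈ segment ℝ ζ z, x ∈ ball (0 : ℂ) 1 ∧ ‖x - ζ‖ ≤ ‖z - ζ‖ ∧
              ∀ y ∈ segment ℝ ζ x, ‖y - ξ‖ ≤ 7 / 8 * δ := by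
            intro x hx
            have hc : ∀ y ∈ segment ℝ ζ z, y ∈ closedBall ξ (7 / 8 * δ) := fun y hy =>
              (convex_closedBall ξ (7 / 8 * δ)).segment_subset (by
                rwa [mem_closedBall, dist_eq_norm]) (by rwa [mem_closedBall, dist_eq_norm]) hy
            have hsub : segment ℝ ζ x ⊆ segment ℝ ζ z :=
              (convex_segment ζ z).segment_subset (left_mem_segment ℝ ζ z) hx
            refine ⟨hball ?_, ?_, fun y hy => ?_⟩
            · rw [← dist_eq_norm]; exact hc x hx
            · have : x ∈ closedBall ζ ‖z - ζ‖ :=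
                (convex_closedBall ζ ‖z - ζ‖).segment_subset (mem_closedBall_self hpos.le) (by
                  rw [mem_closedBall, dist_eq_norm]) hx
              rwa [mem_closedBall, dist_eq_norm] at this
            · rw [← dist_eq_norm]; exact hc y (hsub hy)
          have h4 : ∀ x ∈ segment ℝ ζ z, ‖deriv φ x - deriv φ ζ‖ ≤ K * D / δ * ‖z - ζ‖ := by
            intro x hx
            obtain ⟨_, hx2, hx3⟩ := hseg x hx
            have := Convex.norm_image_sub_le_of_norm_hasDerivWithin_le (C := K * D / δ)
              (f := deriv φ) (f' := deriv (deriv φ)) (s := segment ℝ ζ x)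
              (fun y hy => (((hφ.holo.deriv isOpen_ball).differentiableAt
                (isOpen_ball.mem_nhds (hball (hx3 y hy)))).hasDerivAt).hasDerivWithinAt)
              (fun y hy => by
                have := hK.deriv2_le hφ hξm (ξ' := y) (by rw [hξn]; exact hx3 y hy)
                rwa [hξn] at this)
              (convex_segment ζ x) (left_mem_segment ℝ ζ x) (right_mem_segment ℝ ζ x)
            exact this.trans (by gcongr)
          have h5 := Convex.norm_image_sub_le_of_norm_hasDerivWithin_le (C := K * D / δ * ‖z - ζ‖)
              (f := fun x => φ x - deriv φ ζ * x) (f' := fun x => deriv φ x - deriv φ ζ)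
              (s := segment ℝ ζ z)
              (fun x hx => by
                have := ((hφ.holo.differentiableAt
                  (isOpen_ball.mem_nhds (hseg x hx).1)).hasDerivAt).sub
                    ((hasDerivAt_id x).const_mul (deriv φ ζ))
                rw [mul_one] at this
                exact this.hasDerivWithinAt)
              h4 (convex_segment ζ z) (left_mem_segment ℝ ζ z) (right_mem_segment ℝ ζ z)
          have e : φ z - φ ζ - deriv φ ζ * (z - ζ) =
              φ z - deriv φ ζ * z - (φ ζ - deriv φ ζ * ζ) := by ring
          rw [e]
          exact h5
        have e1 : deriv φ ζ / (φ ζ - φ z) - 1 / (ζ - z) =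
            (φ z - φ ζ - deriv φ ζ * (z - ζ)) / ((φ ζ - φ z) * (ζ - z)) := by
          have := norm_pos_iff.mp hne'
          field_simp
          ring
        rw [norm_mul, he, mul_one, e1, norm_div, norm_mul, norm_sub_rev ζ z,
          div_le_div_iff₀ (by positivity) hδ0]
        have h6 : D * ‖z - ζ‖ ≤ 128 * K * ‖φ ζ - φ z‖ := by
          have : ‖z - ζ‖ * ‖deriv φ ζ‖ ≤ 128 * ‖φ ζ - φ z‖ := by linarith
          calc D * ‖z - ζ‖ ≤ (K * ‖deriv φ ζ‖) * ‖z - ζ‖ := by gcongr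
            _ = K * (‖z - ζ‖ * ‖deriv φ ζ‖) := by ring
            _ ≤ K * (128 * ‖φ ζ - φ z‖) := by gcongr
            _ = _ := by ring
        calc _ ≤ K * D / δ * ‖z - ζ‖ * ‖z - ζ‖ * δ := by gcongr
          _ = K * (D * ‖z - ζ‖) * ‖z - ζ‖ := by field_simp
          _ ≤ K * (128 * K * ‖φ ζ - φ z‖) * ‖z - ζ‖ := by gcongr
          _ = _ := by ring) r ⟨by linarith, le_rfl⟩
  rw [← hξr] at key
  refine key.trans ?_
  calc 128 * K ^ 2 / δ * (r - (1 - δ)) ≤ 128 * K ^ 2 / δ * δ := by gcongr; linarith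
    _ = _ := by field_simp

end RadialVariation

section ScaleSums

variable {φ : ℂ → ℂ} {K : ℝ} {ℓ : ℂ → ℂ → ℂ} {e : ℂ} {N : ℕ} {r : ℝ}

theorem conformalScale_radialPoint (φ : ℂ → ℂ) (he : ‖e‖ = 1) (j : ℕ) :
    conformalScale φ (radialPoint e j) = (1 / 2) ^ j * ‖deriv φ (radialPoint e j)‖ := by
  rw [conformalScale, one_sub_norm_radialPoint he]

theorem IsLogDslope.norm_zero_segment_le (hK : IsDistortionConst K) (hφ : BoundedSchlicht φ)
    (hℓ : IsLogDslope φ ℓ) (he : ‖e‖ = 1) (j : ℕ) {b : ℝ} (hb : 1 - (1 / 2) ^ (j + 1) ≤ b)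
    (hb' : b - (1 - (1 / 2) ^ (j + 1)) ≤ 7 / 8 * (1 / 2) ^ (j + 1)) :
    ‖ℓ 0 ((b : ℂ) * e) - ℓ 0 (radialPoint e (j + 1))‖ ≤
      256 * K * conformalScale φ (radialPoint e (j + 1)) + 2 * (1 / 2) ^ (j + 1) := by
  have h00 : (0 : ℂ) ∈ ball (0 : ℂ) 1 := mem_ball_self one_pos
  rw [conformalScale_radialPoint φ he]
  set δ : ℝ := (1 / 2) ^ (j + 1) with hδ
  have hδ0 : 0 < δ := by positivity
  have hδ1 : δ ≤ 1 / 2 := by rw [hδ, pow_succ]; linarith [half_pow_le_one j]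
  have hK1 := hK.one_le
  have hξm := radialPoint_mem he (j + 1)
  have hξn := one_sub_norm_radialPoint he (j + 1)
  rw [← hδ] at hξn
  have hξr : radialPoint e (j + 1) = ((1 - δ : ℝ) : ℂ) * e := rfl
  set D := ‖deriv φ (radialPoint e (j + 1))‖ with hD
  have key := norm_sub_le_of_hasDerivAt (a := 1 - δ) (b := b) (C := 256 * (K * D) + 2) hb
    (fun x hx => hasDerivAt_ofReal_mul e x (hℓ.deriv_right h00
      (ofReal_mul_mem he (s := x) (by linarith [hx.1]) (by linarith [hx.2])) (by
        simpa using ofReal_mul_ne he (s := x) (t := 0) (by linarith [hx.1])))) (by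
      intro x hx
      have hx0 : 1 / 2 ≤ x := by linarith [hx.1]
      have hxm := ofReal_mul_mem he (s := x) (by linarith) (by linarith [hx.2])
      have h1 := hK.deriv_le hφ hξm (ξ' := (x : ℂ) * e) (by
        rw [hξn, hξr, norm_ofReal_mul_sub he hx.1]; linarith [hx.2])
      have h2 := hφ.le_norm_sub (ξ := 0) (z := (x : ℂ) * e) (ε := 1 / 2) (by norm_num) (by norm_num)
        hxm (by rw [sub_zero, norm_ofReal_mul he (by linarith)]; exact hx0)
      rw [hφ.deriv_zero, norm_one] at h2
      rw [norm_mul, he, mul_one, sub_zero]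
      refine (norm_sub_le _ _).trans ?_
      rw [norm_div, norm_div, norm_one, norm_ofReal_mul he (by linarith)]
      refine add_le_add ?_ ?_
      · rw [div_le_iff₀ (by linarith)]
        have : (256 : ℝ) * (K * D) * (1 / 2 * 1 / 128) ≤
            256 * (K * D) * ‖φ ((x : ℂ) * e) - φ 0‖ := by gcongr
        linarith
      · rw [div_le_iff₀ (by linarith)]
        linarith)
  rw [← hξr] at key
  refine key.trans ?_
  calc (256 * (K * D) + 2) * (b - (1 - δ)) ≤ (256 * (K * D) + 2) * δ := by gcongr; linarith
    _ = _ := by ring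

theorem IsLogDslope.exists_norm_zero_le (hφ : BoundedSchlicht φ)
    (hℓ : IsLogDslope φ ℓ) : ∃ C₀, 0 ≤ C₀ ∧ ∀ {K : ℝ}, IsDistortionConst K → ∀ {e : ℂ}, ‖e‖ = 1 →
      ∀ {N : ℕ} {r : ℝ}, IsGeneration N r → ‖ℓ 0 ((r : ℂ) * e)‖ ≤
        C₀ + 256 * K * ∑ j ∈ Finset.range N, conformalScale φ (radialPoint e (j + 1)) := by
  have h00 : (0 : ℂ) ∈ ball (0 : ℂ) 1 := mem_ball_self one_pos
  have hsub : closedBall (0 : ℂ) (7 / 8) ⊆ ball 0 1 := closedBall_subset_ball (by norm_num)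
  have hcont : ContinuousOn (fun v => ℓ 0 v) (closedBall (0 : ℂ) (7 / 8)) :=
    hℓ.cont.comp (f := fun v : ℂ => ((0 : ℂ), v)) (by fun_prop) fun v hv => ⟨h00, hsub hv⟩
  obtain ⟨C₁, hC₁⟩ := (isCompact_closedBall (0 : ℂ) (7 / 8)).exists_bound_of_continuousOn hcont
  have hC₁0 : 0 ≤ C₁ := (norm_nonneg _).trans (hC₁ 0 (mem_closedBall_self (by norm_num)))
  refine ⟨C₁ + 2, by linarith, fun {K} hK {e} he {N r} hN => ?_⟩
  have hind : ∀ n : ℕ, ‖ℓ 0 (radialPoint e (n + 1))‖ ≤ C₁ + ∑ j ∈ Finset.range n,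
      (256 * K * conformalScale φ (radialPoint e (j + 1)) + 2 * (1 / 2) ^ (j + 1)) := by
    intro n
    induction n with
    | zero =>
      rw [Finset.sum_range_zero, add_zero]
      refine hC₁ _ ?_
      have := one_sub_norm_radialPoint he 1
      rw [zero_add, mem_closedBall_zero_iff]
      norm_num at this
      linarith
    | succ n ih =>
      rw [Finset.sum_range_succ, ← add_assoc]
      have hp : (0 : ℝ) < (1 / 2) ^ (n + 1) := by positivity
      have h1 := hℓ.norm_zero_segment_le hK hφ he n (b := 1 - (1 / 2) ^ (n + 1 + 1)) (by
        rw [pow_succ _ (n + 1)]; linarith) (by rw [pow_succ _ (n + 1)]; linarith)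
      have h2 := norm_le_norm_add_norm_sub' (ℓ 0 (radialPoint e (n + 1 + 1)))
        (ℓ 0 (radialPoint e (n + 1)))
      exact h2.trans (add_le_add ih h1)
  have hgeom : ∀ n : ℕ, ∑ j ∈ Finset.range n, 2 * ((1 : ℝ) / 2) ^ (j + 1) ≤ 2 := by
    intro n
    have : ∑ j ∈ Finset.range n, 2 * ((1 : ℝ) / 2) ^ (j + 1) = 2 * (1 - (1 / 2) ^ n) := by
      induction n with
      | zero => simp
      | succ n ih => rw [Finset.sum_range_succ, ih, pow_succ]; ring
    rw [this]
    have : (0 : ℝ) < (1 / 2) ^ n := by positivity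
    linarith
  have hr1 := hN.lt_one
  obtain ⟨h3, h4⟩ := hN.sub_bounds
  rcases N with _ | n
  · rw [Finset.sum_range_zero, mul_zero, add_zero]
    refine (hC₁ _ ?_).trans (by linarith)
    rw [mem_closedBall_zero_iff, norm_ofReal_mul he (by linarith [hN.half_le])]
    norm_num at h4
    linarith
  · have hp : (0 : ℝ) < (1 / 2) ^ (n + 1) := by positivity
    have h1 := hℓ.norm_zero_segment_le hK hφ he n (b := r) (by linarith) h4
    have h2 := norm_le_norm_add_norm_sub' (ℓ 0 ((r : ℂ) * e)) (ℓ 0 (radialPoint e (n + 1)))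
    have h5 := h2.trans (add_le_add (hind n) h1)
    rw [add_assoc, ← Finset.sum_range_succ] at h5
    rw [Finset.sum_add_distrib, ← Finset.mul_sum] at h5
    linarith [hgeom (n + 1)]

/-- Whitney disks along a radius. -/
def whitneyDisk (e : ℂ) (j : ℕ) : Set ℂ := ball (radialPoint e j) (1 / 8 * (1 / 2) ^ j)

theorem whitneyDisk_bounds (he : ‖e‖ = 1) {j : ℕ} {ξ : ℂ} (hξ : ξ ∈ whitneyDisk e j) :
    7 / 8 * (1 / 2) ^ j ≤ 1 - ‖ξ‖ ∧ 1 - ‖ξ‖ ≤ 9 / 8 * (1 / 2) ^ j ∧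
      ‖ξ - radialPoint e j‖ ≤ 1 / 8 * (1 / 2) ^ j := by
  have h1 := one_sub_norm_radialPoint he j
  rw [whitneyDisk, mem_ball, dist_eq_norm] at hξ
  have h2 := norm_sub_norm_le ξ (radialPoint e j)
  have h3 := norm_sub_norm_le (radialPoint e j) ξ
  rw [norm_sub_rev] at h3
  refine ⟨?_, ?_, hξ.le⟩ <;> linarith

theorem whitneyDisk_subset (he : ‖e‖ = 1) (j : ℕ) : whitneyDisk e j ⊆ ball 0 1 := by
  intro ξ hξ
  have := (whitneyDisk_bounds he hξ).1
  rw [mem_ball_zero_iff]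
  have : (0 : ℝ) < (1 / 2) ^ j := by positivity
  linarith

theorem whitneyDisk_disjoint (he : ‖e‖ = 1) {i j : ℕ} (hij : i ≠ j) :
    Disjoint (whitneyDisk e i) (whitneyDisk e j) := by
  wlog hlt : i < j generalizing i j
  · exact (this hij.symm (by omega)).symm
  refine Set.disjoint_left.mpr fun ξ h1 h2 => ?_
  have h3 := (whitneyDisk_bounds he h1).1
  have h4 := (whitneyDisk_bounds he h2).2.1
  have h5 : ((1 : ℝ) / 2) ^ j ≤ (1 / 2) ^ (i + 1) :=
    pow_le_pow_of_le_one (by norm_num) (by norm_num) (by omega)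
  rw [pow_succ] at h5
  have : (0 : ℝ) < (1 / 2) ^ i := by positivity
  linarith

theorem sum_lintegral_whitneyDisk_le (he : ‖e‖ = 1) (μ : Measure ℂ) (T : Finset ℕ) (k : ℕ)
    (F : ℂ → ℝ≥0∞) :
    ∑ j ∈ T, ∫⁻ ξ in whitneyDisk e (j + k), F ξ ∂μ ≤ ∫⁻ ξ, F ξ ∂μ := by
  rw [← lintegral_biUnion_finset (fun i _ j _ hij => whitneyDisk_disjoint he (by omega))
    (fun j _ => measurableSet_ball)]
  exact setLIntegral_le_lintegral _ _

theorem IsDistortionConst.area_whitneyDisk_ge (hK : IsDistortionConst K) (hφ : BoundedSchlicht φ)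
    (he : ‖e‖ = 1) (j : ℕ) :
    ENNReal.ofReal (conformalScale φ (radialPoint e j) ^ 2 / (64 * K ^ 2)) ≤
      areaMeasure φ (whitneyDisk e j) := by
  have hm : MeasurableSet (whitneyDisk e j) := measurableSet_ball
  have hK1 := hK.one_le
  have hξm := radialPoint_mem he j
  have hξn := one_sub_norm_radialPoint he j
  rw [areaMeasure, withDensity_apply _ hm, Measure.restrict_restrict hm,
    inter_eq_self_of_subset_left (whitneyDisk_subset he j), conformalScale_radialPoint φ he]
  set δ : ℝ := (1 / 2) ^ j with hδ
  have hδ0 : 0 < δ := by positivity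
  calc _ ≤ ENNReal.ofReal ((‖deriv φ (radialPoint e j)‖ / K) ^ 2) * volume (whitneyDisk e j) := by
        rw [whitneyDisk, Complex.volume_ball, ← ENNReal.ofReal_pow (by positivity),
          ← mul_assoc, ← ENNReal.ofReal_mul (by positivity)]
        have h1 : (1 : ℝ≥0∞) ≤ NNReal.pi := by
          have : (1 : NNReal) ≤ NNReal.pi := by
            rw [← NNReal.coe_le_coe]
            simpa using Real.pi_gt_three.le.trans' (by norm_num)
          exact_mod_cast this
        refine le_trans (le_of_eq ?_) (le_mul_of_one_le_right zero_le h1)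
        congr 1
        field_simp
        ring
    _ = ∫⁻ ξ in whitneyDisk e j, ENNReal.ofReal ((‖deriv φ (radialPoint e j)‖ / K) ^ 2) := by
        rw [setLIntegral_const]
    _ ≤ _ := by
        refine setLIntegral_mono' hm fun ξ hξ => ?_
        apply ENNReal.ofReal_le_ofReal
        have h2 := hK.le_deriv hφ hξm (ξ' := ξ) (by
          rw [hξn]
          linarith [(whitneyDisk_bounds he hξ).2.2])
        gcongr
        rw [div_le_iff₀ (by linarith)]
        linarith

theorem IsDistortionConst.sum_conformalScale_sq_le (hK : IsDistortionConst K)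
    (hφ : BoundedSchlicht φ) (he : ‖e‖ = 1) (N : ℕ) :
    ∑ j ∈ Finset.range N, conformalScale φ (radialPoint e (j + 1)) ^ 2 ≤
      64 * K ^ 2 * (areaMeasure φ univ).toReal := by
  have hK1 := hK.one_le
  have h1 := sum_lintegral_whitneyDisk_le he (areaMeasure φ) (Finset.range N) 1 (fun _ => 1)
  simp only [one_mul, lintegral_const, Measure.restrict_apply_univ] at h1
  have h2 : ENNReal.ofReal (∑ j ∈ Finset.range N,
      conformalScale φ (radialPoint e (j + 1)) ^ 2 / (64 * K ^ 2)) ≤ areaMeasure φ univ := by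
    rw [ENNReal.ofReal_sum_of_nonneg fun _ _ => by positivity]
    exact (Finset.sum_le_sum fun j _ => hK.area_whitneyDisk_ge hφ he (j + 1)).trans h1
  rw [ENNReal.ofReal_le_iff_le_toReal (areaMeasure_univ_ne_top hφ), ← Finset.sum_div,
    div_le_iff₀ (by positivity)] at h2
  linarith

theorem IsDistortionConst.sum_radialRatio_sq_le (hK : IsDistortionConst K)
    (hφ : BoundedSchlicht φ) (he : ‖e‖ = 1) (hN : IsGeneration N r) {s κ : ℝ} (hκ : 0 < κ)
    (hs : ∀ ξ ∈ ball (0 : ℂ) 1, ‖φ ξ‖ ≤ s / 2) :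
    ENNReal.ofReal (∑ j ∈ (Finset.range N).filter fun j => κ ≤ radialRatio φ e ((r : ℂ) * e) j,
      radialRatio φ e ((r : ℂ) * e) j ^ 2 / (64 * K ^ 2 * (1 + 512 * K ^ 2) ^ 2)) ≤
      scaleIntegral (areaMeasure φ) s (κ / (2 * K * (1 + 512 * K ^ 2))) 1024
        ((ball (0 : ℂ) 1).indicator φ) (conformalScale φ) (φ ((r : ℂ) * e)) := by
  have hK1 := hK.one_le
  set z := (r : ℂ) * e with hz
  have hzm : z ∈ ball (0 : ℂ) 1 := hN.mem he
  set L := 1 + 512 * K ^ 2 with hL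
  have hL1 : 1 ≤ L := by rw [hL]; nlinarith
  set p := (ball (0 : ℂ) 1).indicator φ with hp
  set S := {y | κ / (2 * K * L) * ‖p y - φ z‖ ≤ conformalScale φ y ∧
    conformalScale φ y ≤ 1024 * ‖p y - φ z‖ ∧ ‖p y - φ z‖ ≤ s} with hS
  have hSm : MeasurableSet S := by
    have hn : Measurable fun y => ‖p y - φ z‖ :=
      ((measurable_indicator_disk hφ.holo).sub_const _).norm
    have hρ := measurable_conformalScale φ
    exact (measurableSet_le (hn.const_mul _) hρ).inter
      ((measurableSet_le hρ (hn.const_mul _)).inter (measurableSet_le hn measurable_const))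
  have hscale : scaleIntegral (areaMeasure φ) s (κ / (2 * K * L)) 1024 p (conformalScale φ) (φ z) =
      ∫⁻ y, S.indicator (fun y => ENNReal.ofReal ((‖p y - φ z‖ ^ 2)⁻¹)) y ∂(areaMeasure φ) := by
    rw [lintegral_indicator hSm]
    rfl
  rw [hscale, ENNReal.ofReal_sum_of_nonneg fun _ _ => by positivity]
  refine le_trans ?_ (sum_lintegral_whitneyDisk_le he (areaMeasure φ)
    ((Finset.range N).filter fun j => κ ≤ radialRatio φ e z j) 0 _)
  refine Finset.sum_le_sum fun j hj => ?_
  obtain ⟨hjN, hjκ⟩ := Finset.mem_filter.mp hj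
  rw [Finset.mem_range] at hjN
  rw [add_zero]
  have hξm := radialPoint_mem he j
  have hξn := one_sub_norm_radialPoint he j
  have hsub := hN.sub_ge hjN
  set δ : ℝ := (1 / 2) ^ j with hδ
  have hδ0 : 0 < δ := by positivity
  set ξ := radialPoint e j with hξ
  have hzξ : 3 / 4 * δ ≤ ‖z - ξ‖ := by
    rw [hz, hξ, radialPoint, norm_ofReal_mul_sub he (by linarith)]
    exact hsub
  have hwpos : 0 < ‖φ ξ - φ z‖ := by
    rw [norm_pos_iff, sub_ne_zero]
    intro h
    have := hφ.inj hξm hzm h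
    rw [this, sub_self, norm_zero] at hzξ
    linarith
  have hratio : radialRatio φ e z j = conformalScale φ ξ / ‖φ ξ - φ z‖ := by
    rw [conformalScale, hξn]
    rfl
  have hκξ : κ * ‖φ ξ - φ z‖ ≤ δ * ‖deriv φ ξ‖ := by
    rwa [hratio, conformalScale, hξn, le_div_iff₀ hwpos] at hjκ
  have hmain : ∀ ζ ∈ whitneyDisk e j, ENNReal.ofReal ((L ^ 2 * ‖φ ξ - φ z‖ ^ 2)⁻¹) ≤
      S.indicator (fun y => ENNReal.ofReal ((‖p y - φ z‖ ^ 2)⁻¹)) ζ := by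
    intro ζ hζ
    obtain ⟨b1, b2, b3⟩ := whitneyDisk_bounds he hζ
    rw [← hδ] at b1 b2 b3
    rw [← hξ] at b3
    have hζm := whitneyDisk_subset he j hζ
    have hpζ : p ζ = φ ζ := indicator_of_mem hζm _
    have hzζ : 5 / 8 * δ ≤ ‖z - ζ‖ := by
      have h1 : z - ξ = (z - ζ) + (ζ - ξ) := by ring
      have h2 := norm_add_le (z - ζ) (ζ - ξ)
      rw [← h1] at h2
      linarith
    have hr1 := hK.norm_sub_le_right hφ hξm hzm (ξ' := ζ) (by rw [hξn]; linarith)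
      (by rw [hξn]; linarith)
    have hr2 := hφ.le_norm_sub (ξ := ζ) (ε := 1 / 8 * (1 - ‖ζ‖)) (by linarith) (by linarith) hzm
      (by linarith)
    have hr3 := hK.le_deriv hφ hξm (ξ' := ζ) (by rw [hξn]; linarith)
    rw [norm_sub_rev (φ z)] at hr2
    have hζpos : 0 < ‖φ ζ - φ z‖ := by
      rw [norm_pos_iff, sub_ne_zero]
      intro h
      have := hφ.inj hζm hzm h
      rw [this, sub_self, norm_zero] at hzζ
      linarith
    have hmem : ζ ∈ S := by
      refine ⟨?_, ?_, ?_⟩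
      · rw [hpζ, conformalScale, div_mul_eq_mul_div, div_le_iff₀ (by positivity)]
        calc κ * ‖φ ζ - φ z‖ ≤ κ * (L * ‖φ ξ - φ z‖) := by gcongr
          _ = L * (κ * ‖φ ξ - φ z‖) := by ring
          _ ≤ L * (δ * (K * ‖deriv φ ζ‖)) := by
            refine mul_le_mul_of_nonneg_left (hκξ.trans ?_) (by linarith)
            gcongr
          _ ≤ L * ((2 * (1 - ‖ζ‖)) * (K * ‖deriv φ ζ‖)) := by gcongr; linarith
          _ = _ := by ring
      · rw [hpζ, conformalScale]
        linarith
      · rw [hpζ]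
        refine (norm_sub_le _ _).trans ?_
        linarith [hs ζ hζm, hs z hzm]
    rw [indicator_of_mem hmem, hpζ]
    apply ENNReal.ofReal_le_ofReal
    refine inv_anti₀ (by positivity) ?_
    rw [← mul_pow]
    gcongr
  calc _ = ENNReal.ofReal ((L ^ 2 * ‖φ ξ - φ z‖ ^ 2)⁻¹) *
        ENNReal.ofReal (conformalScale φ ξ ^ 2 / (64 * K ^ 2)) := by
        rw [← ENNReal.ofReal_mul (by positivity), hratio]
        congr 1
        field_simp
    _ ≤ ENNReal.ofReal ((L ^ 2 * ‖φ ξ - φ z‖ ^ 2)⁻¹) * areaMeasure φ (whitneyDisk e j) := by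
        gcongr
        exact hK.area_whitneyDisk_ge hφ he j
    _ = ∫⁻ ζ in whitneyDisk e j, ENNReal.ofReal ((L ^ 2 * ‖φ ξ - φ z‖ ^ 2)⁻¹) ∂(areaMeasure φ) := by
        rw [setLIntegral_const]
    _ ≤ _ := setLIntegral_mono' measurableSet_ball hmain

end ScaleSums

section PointwiseEstimate

variable {φ : ℂ → ℂ} {K : ℝ} {ℓ : ℂ → ℂ → ℂ} {e : ℂ} {N : ℕ} {r : ℝ}

theorem sum_le_sqrt_card_mul_sum_sq {ι : Type*} (T : Finset ι) (a : ι → ℝ) :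
    ∑ i ∈ T, a i ≤ √(T.card * ∑ i ∈ T, a i ^ 2) :=
  Real.le_sqrt_of_sq_le sq_sum_le_card_mul_sum_sq

theorem sum_le_add_sqrt (N : ℕ) {κ : ℝ} (hκ : 0 ≤ κ) (a : ℕ → ℝ) :
    ∑ j ∈ Finset.range N, a j ≤
      κ * N + √(N * ∑ j ∈ (Finset.range N).filter fun j => κ ≤ a j, a j ^ 2) := by
  rw [← Finset.sum_filter_add_sum_filter_not (Finset.range N) fun j => κ ≤ a j, add_comm]
  have hcard : ∀ p : ℕ → Prop, ∀ _ : DecidablePred p,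
      (((Finset.range N).filter p).card : ℝ) ≤ N := by
    intro p _
    have := Finset.card_filter_le (Finset.range N) p
    rw [Finset.card_range] at this
    exact_mod_cast this
  refine add_le_add ?_ ?_
  · refine (Finset.sum_le_card_nsmul _ _ κ fun j hj =>
      (not_le.mp (Finset.mem_filter.mp hj).2).le).trans ?_
    rw [nsmul_eq_mul, mul_comm]
    exact mul_le_mul_of_nonneg_left (hcard _ _) hκ
  · refine (sum_le_sqrt_card_mul_sum_sq _ _).trans (Real.sqrt_le_sqrt ?_)
    exact mul_le_mul_of_nonneg_right (hcard _ _) (Finset.sum_nonneg fun _ _ => sq_nonneg _)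

theorem IsGeneration.abs_log_le (h : IsGeneration N r) :
    |Real.log r - Real.log (r - (1 - (1 / 2) ^ N)) + Real.log (1 - r)| ≤ 4 := by
  have h1 := h.upper
  have h2 := h.lower
  obtain ⟨h3, h4⟩ := h.sub_bounds
  have h5 := h.half_le
  have h6 := h.lt_one
  have hδ : (0 : ℝ) < (1 / 2) ^ N := by positivity
  rw [pow_add] at h1 h2
  norm_num at h1 h2 h3 h4
  set δ : ℝ := (1 / 2) ^ N
  set d := r - (1 - δ)
  have hd : 0 < d := by linarith
  have hu : 0 < 1 - r := by linarith
  have e1 : Real.log r - Real.log d + Real.log (1 - r) = Real.log (r * (1 - r) / d) := by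
    rw [Real.log_div (by positivity) (by positivity), Real.log_mul (by positivity) (by positivity)]
    ring
  have hx : 1 / 16 ≤ r * (1 - r) / d := by
    rw [le_div_iff₀ hd]
    nlinarith
  have hx1 : r * (1 - r) / d ≤ 1 := by
    rw [div_le_one hd]
    nlinarith
  rw [e1, abs_le]
  constructor
  · have h7 := Real.log_le_log (by norm_num) hx
    have h8 : Real.log (1 / 16) = -(4 * Real.log 2) := by
      rw [one_div, Real.log_inv, show (16 : ℝ) = 2 ^ 4 by norm_num, Real.log_pow]
      norm_num
    linarith [Real.log_two_lt_d9]
  · linarith [Real.log_nonpos (by linarith) hx1]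

/-- Up to an error which is square summable along the radius, `log φ'` is `-log (1 - r)`. -/
theorem IsDistortionConst.exists_norm_logDerivative_le (hK : IsDistortionConst K)
    (hφ : BoundedSchlicht φ) : ∃ C, 0 ≤ C ∧ ∀ {s κ : ℝ}, 0 < κ →
      (∀ ξ ∈ ball (0 : ℂ) 1, ‖φ ξ‖ ≤ s / 2) → ∀ {N : ℕ} {r : ℝ} {e : ℂ}, IsGeneration N r →
      ‖e‖ = 1 → ∃ x, 0 ≤ x ∧ ENNReal.ofReal x ≤ scaleIntegral (areaMeasure φ) s
          (κ / (2 * K * (1 + 512 * K ^ 2))) 1024 ((ball (0 : ℂ) 1).indicator φ)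
          (conformalScale φ) (φ ((r : ℂ) * e)) ∧
        ‖logDerivative φ ((r : ℂ) * e) + (Real.log (1 - r) : ℝ)‖ ≤
          C * (1 + √N) + 8 * K ^ 2 * (1 + 512 * K ^ 2) ^ 2 * (κ * N + √(N * x)) := by
  obtain ⟨ℓ, hℓ⟩ := hφ.exists_isLogDslope
  obtain ⟨C₀, hC₀, hzero⟩ := hℓ.exists_norm_zero_le hφ
  have hK1 := hK.one_le
  set V := (areaMeasure φ univ).toReal with hV
  have hV0 : 0 ≤ V := ENNReal.toReal_nonneg
  set L := 1 + 512 * K ^ 2 with hL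
  have hL1 : 1 ≤ L := by rw [hL]; nlinarith
  refine ⟨128 * K ^ 2 + 4 + C₀ + 2048 * K ^ 2 * √V, by positivity, ?_⟩
  intro s κ hκ hs N r e hN he
  set z := (r : ℂ) * e with hz
  have hzm : z ∈ ball (0 : ℂ) 1 := hN.mem he
  refine ⟨∑ j ∈ (Finset.range N).filter fun j => κ ≤ radialRatio φ e z j,
    radialRatio φ e z j ^ 2 / (64 * K ^ 2 * L ^ 2), Finset.sum_nonneg fun _ _ => by positivity,
    hK.sum_radialRatio_sq_le hφ he hN hκ hs, ?_⟩
  have h1 := hℓ.norm_tail_le hK hφ he hN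
  have h2 := hℓ.norm_radial_le hK hφ he hN
  have h3 := hzero hK he hN
  have h4 := hN.abs_log_le
  have h5 := sum_le_add_sqrt N hκ.le (radialRatio φ e z)
  have h6 : ∑ j ∈ Finset.range N, conformalScale φ (radialPoint e (j + 1)) ≤ 8 * K * √V * √N := by
    refine (sum_le_sqrt_card_mul_sum_sq _ _).trans ?_
    rw [Finset.card_range]
    refine (Real.sqrt_le_sqrt (mul_le_mul_of_nonneg_left
      (hK.sum_conformalScale_sq_le hφ he N) (Nat.cast_nonneg N))).trans ?_
    rw [show (N : ℝ) * (64 * K ^ 2 * (areaMeasure φ univ).toReal) = (8 * K) ^ 2 * (V * N) by ring,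
      Real.sqrt_mul (by positivity), Real.sqrt_sq (by positivity), Real.sqrt_mul hV0, mul_assoc _ √V]
  rw [← Finset.sum_div]
  set X := ∑ j ∈ (Finset.range N).filter fun j => κ ≤ radialRatio φ e z j,
    radialRatio φ e z j ^ 2 with hX
  have hX0 : 0 ≤ X := Finset.sum_nonneg fun _ _ => by positivity
  have h7 : √(N * X) = 8 * K * L * √(N * (X / (64 * K ^ 2 * L ^ 2))) := by
    rw [← Real.sqrt_sq (show 0 ≤ 8 * K * L by positivity), ← Real.sqrt_mul (by positivity)]
    congr 1
    field_simp
    ring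
  rw [h7] at h5
  set y := √(N * (X / (64 * K ^ 2 * L ^ 2))) with hy
  have hy0 : 0 ≤ y := Real.sqrt_nonneg _
  have hH : logDerivative φ z + (Real.log (1 - r) : ℝ) =
      (ℓ z z - ℓ (radialPoint e N) z) +
      ((ℓ (radialPoint e N) z + (Real.log (r - (1 - (1 / 2) ^ N)) : ℝ)) -
        (ℓ 0 z + (Real.log r : ℝ))) + ℓ 0 z +
      ((Real.log r - Real.log (r - (1 - (1 / 2) ^ N)) + Real.log (1 - r) : ℝ) : ℂ) := by
    rw [hℓ.diag z hzm]
    push_cast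
    ring
  rw [hH]
  refine (norm_add_le _ _).trans ?_
  have h8 := norm_add₃_le (a := ℓ z z - ℓ (radialPoint e N) z)
    (b := (ℓ (radialPoint e N) z + (Real.log (r - (1 - (1 / 2) ^ N)) : ℝ)) -
        (ℓ 0 z + (Real.log r : ℝ))) (c := ℓ 0 z)
  rw [Complex.norm_real, Real.norm_eq_abs]
  have h9 : K * L * ∑ j ∈ Finset.range N, radialRatio φ e z j ≤
      8 * K ^ 2 * L ^ 2 * (κ * N + y) := by
    calc _ ≤ K * L * (κ * N + 8 * K * L * y) := by gcongr
      _ = K * L * (κ * N) + 8 * K ^ 2 * L ^ 2 * y := by ring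
      _ ≤ (8 * K * L) * (K * L) * (κ * N) + 8 * K ^ 2 * L ^ 2 * y := by
        have h0 : 1 ≤ K * L := one_le_mul_of_one_le_of_one_le hK1 hL1
        have h1 : K * L ≤ (8 * K * L) * (K * L) := by nlinarith
        have h2 : 0 ≤ κ * N := by positivity
        linarith [mul_le_mul_of_nonneg_right h1 h2]
      _ = _ := by ring
  have h10 : 256 * K * ∑ j ∈ Finset.range N, conformalScale φ (radialPoint e (j + 1)) ≤
      2048 * K ^ 2 * √V * √N := by
    calc _ ≤ 256 * K * (8 * K * √V * √N) := by gcongr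
      _ = _ := by ring
  have hsN : 0 ≤ √(N : ℝ) := Real.sqrt_nonneg _
  have h11 : 0 ≤ (128 * K ^ 2 + 4 + C₀) * √N := by positivity
  have h12 : 0 ≤ 2048 * K ^ 2 * √V := by positivity
  linarith

end PointwiseEstimate

section ExponentialDomination

variable {φ : ℂ → ℂ} {K : ℝ} {N : ℕ} {r : ℝ} {τ : ℂ}

theorem lintegral_circle_le {F : ℂ → ℝ≥0∞} {G : ℝ → ℝ≥0∞} (hG : Measurable G) {r r' : ℝ}
    (hr : 0 < r) (hr' : r' < 1)
    (h : ∀ s ∈ Icc r r', ∀ θ : ℝ, G θ ≤ F ((s : ℂ) * Complex.exp ((θ : ℂ) * Complex.I))) :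
    ENNReal.ofReal (r * (r' - r)) * ∫⁻ θ in Ioo (-Real.pi) Real.pi, G θ ≤
      ∫⁻ ξ in ball (0 : ℂ) 1, F ξ := by
  have hsub : Icc r r' ×ˢ Ioo (-Real.pi) Real.pi ⊆ polarCoord.target := by
    rintro ⟨s, θ⟩ ⟨h1, h2⟩
    exact ⟨lt_of_lt_of_le hr h1.1, h2⟩
  rw [← lintegral_indicator measurableSet_ball, ← Complex.lintegral_comp_polarCoord_symm]
  refine le_trans ?_ (lintegral_mono_set hsub)
  calc _ = ∫⁻ p in Icc r r' ×ˢ Ioo (-Real.pi) Real.pi, ENNReal.ofReal r * G p.2 := by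
        rw [Measure.volume_eq_prod, ← Measure.prod_restrict,
          lintegral_prod_mul (f := fun _ : ℝ => ENNReal.ofReal r) aemeasurable_const
            hG.aemeasurable, setLIntegral_const, Real.volume_Icc, ENNReal.ofReal_mul hr.le]
    _ ≤ _ := by
        refine setLIntegral_mono' (measurableSet_Icc.prod measurableSet_Ioo) ?_
        rintro ⟨s, θ⟩ ⟨h1, h2⟩
        have e : Complex.polarCoord.symm (s, θ) =
            (s : ℂ) * Complex.exp ((θ : ℂ) * Complex.I) := by
          rw [Complex.polarCoord_symm_apply, Complex.exp_mul_I, Complex.ofReal_cos,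
            Complex.ofReal_sin]
        rw [e, smul_eq_mul, indicator_of_mem]
        · have h3 : r ≤ s := h1.1
          gcongr
          exact h s h1 θ
        · rw [mem_ball_zero_iff, norm_ofReal_mul (Complex.norm_exp_ofReal_mul_I θ)
            (hr.le.trans h1.1)]
          exact lt_of_le_of_lt h1.2 hr'

theorem exists_isGeneration (hr : 1 / 2 ≤ r) (hr1 : r < 1) :
    ∃ N : ℕ, (N : ℝ) ≤ 2 * -Real.log (1 - r) ∧
      ∀ s ∈ Icc r (r + (1 - r) / 2), IsGeneration N s := by
  obtain ⟨N, h1, h2⟩ := exists_nat_pow_near_of_lt_one (x := 2 * (1 - r)) (y := (1 / 2 : ℝ))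
    (by linarith) (by linarith) (by norm_num) (by norm_num)
  rw [pow_succ] at h1
  refine ⟨N, ?_, fun s hs => ⟨?_, ?_⟩⟩
  · have h3 := Real.log_le_log (by linarith) (show 1 - r ≤ (1 / 2) ^ N by linarith)
    rw [Real.log_pow, one_div, Real.log_inv] at h3
    nlinarith [Real.log_two_gt_d9, (Nat.cast_nonneg N : (0 : ℝ) ≤ N)]
  · rw [pow_succ]
    linarith [hs.1]
  · rw [pow_add]
    norm_num at h1 ⊢
    linarith [hs.2]

theorem IsDistortionConst.exists_dominating_cexp (hK : IsDistortionConst K)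
    (hφ : BoundedSchlicht φ) {s : ℝ} (hs0 : 0 < s) (hs : ∀ ξ ∈ ball (0 : ℂ) 1, ‖φ ξ‖ ≤ s / 2)
    (hτ0 : τ ≠ 0) (hτ1 : ‖τ‖ ≤ 1) {m : ℕ} (hm1 : 1 ≤ m)
    (hm : 2 * 1024 < ‖τ‖ / (2 * K * (1 + 512 * K ^ 2)) * 2 ^ m) :
    ∃ A : ℝ, ∃ W : ℂ → ℝ≥0∞,
      (∀ q, ∫⁻ w in dyadicIndex s 0 ⁻¹' {q}, W w ≤ 2 * ENNReal.ofReal (s ^ 2)) ∧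
      ∀ {N : ℕ} {r : ℝ} {e : ℂ}, IsGeneration N r → ‖e‖ = 1 →
        ENNReal.ofReal ‖Complex.exp ((2 - τ) * logDerivative φ ((r : ℂ) * e))‖ ≤
          ENNReal.ofReal (Real.exp (A + ‖τ‖ ^ 2 * (1 + 8 * K ^ 2 * (1 + 512 * K ^ 2) ^ 2 +
            162 * m * (8 * K ^ 2 * (1 + 512 * K ^ 2) ^ 2) ^ 2) * N + τ.re * Real.log (1 - r))) *
          (ENNReal.ofReal (‖deriv φ ((r : ℂ) * e)‖ ^ 2) * W (φ ((r : ℂ) * e))) := by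
  obtain ⟨C, hC, hpt⟩ := hK.exists_norm_logDerivative_le hφ
  have hK1 := hK.one_le
  have hτ := norm_pos_iff.mpr hτ0
  have hm0 : (1 : ℝ) ≤ m := by exact_mod_cast hm1
  set t : ℝ := 1 / (648 * m) with ht
  have ht0 : 0 < t := by positivity
  have ht1 : t ≤ 1 := by
    rw [ht, div_le_one (by positivity)]
    linarith
  obtain ⟨W, -, hW, hWt⟩ := exists_dominating_exp_scaleIntegral (ν := areaMeasure φ) (s := s)
    (p := (ball (0 : ℂ) 1).indicator φ) (ρ := conformalScale φ)
    (κ := ‖τ‖ / (2 * K * (1 + 512 * K ^ 2))) (C := 1024)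
    (measurable_indicator_disk hφ.holo) (measurable_conformalScale φ)
    (areaMeasure_preimage_le hφ.holo hφ.inj) hs0 (by positivity) (by norm_num) hm ht0.le (by
      rw [ht, div_mul_eq_mul_div, div_le_iff₀ (by positivity)]
      linarith)
  refine ⟨C + C ^ 2 + 1, W, hW, ?_⟩
  intro N r e hN he
  obtain ⟨x, hx0, hx, hH⟩ := hpt hτ hs hN he
  have hzm := hN.mem he
  set z := (r : ℂ) * e
  set K₂ := 8 * K ^ 2 * (1 + 512 * K ^ 2) ^ 2 with hK₂
  have hK₂0 : 0 ≤ K₂ := by positivity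
  have hexp : ‖deriv φ z‖ ^ 2 = Real.exp (2 * (logDerivative φ z).re) := by
    rw [← hφ.exp_logDerivative hzm, Complex.norm_exp, ← Real.exp_nat_mul]
    norm_num
  have hre : ((2 - τ) * logDerivative φ z).re = 2 * (logDerivative φ z).re +
      τ.re * Real.log (1 - r) - (τ * (logDerivative φ z + (Real.log (1 - r) : ℝ))).re := by
    simp only [Complex.mul_re, Complex.sub_re, Complex.sub_im, Complex.add_re, Complex.add_im,
      Complex.ofReal_re, Complex.ofReal_im, Complex.re_ofNat, Complex.im_ofNat]
    ring
  have h1 : -(τ * (logDerivative φ z + (Real.log (1 - r) : ℝ))).re ≤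
      ‖τ‖ * (C * (1 + √N) + K₂ * (‖τ‖ * N + √(N * x))) := by
    refine (neg_le_abs _).trans ((Complex.abs_re_le_norm _).trans ?_)
    rw [norm_mul]
    gcongr
  have hsN : √(N : ℝ) ^ 2 = N := Real.sq_sqrt (Nat.cast_nonneg N)
  have h2 : ‖τ‖ * (C * (1 + √N)) ≤ C + C ^ 2 + ‖τ‖ ^ 2 * N := by
    have h3 : ‖τ‖ * C ≤ C := mul_le_of_le_one_left hC hτ1
    nlinarith [sq_nonneg (‖τ‖ * √N - C), sq_nonneg (‖τ‖ * √N), sq_nonneg C]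
  have h3 : ‖τ‖ * (K₂ * √(N * x)) ≤ t * x + 162 * m * K₂ ^ 2 * (‖τ‖ ^ 2 * N) := by
    have hsx : √x ^ 2 = x := Real.sq_sqrt hx0
    rw [Real.sqrt_mul (Nat.cast_nonneg N)]
    have e1 : 162 * m * t = 1 / 4 := by
      rw [ht]
      field_simp
      norm_num
    have h4 : 0 ≤ t * (√x - 324 * m * K₂ * (‖τ‖ * √N)) ^ 2 := by positivity
    have e2 : t * (√x - 324 * m * K₂ * (‖τ‖ * √N)) ^ 2 =
        t * √x ^ 2 - 4 * (162 * m * t) * (K₂ * (‖τ‖ * √N) * √x) +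
        4 * (162 * m * t) * (162 * m * K₂ ^ 2 * (‖τ‖ ^ 2 * √N ^ 2)) := by ring
    rw [e2, e1, hsx, hsN] at h4
    linarith
  calc _ ≤ ENNReal.ofReal (Real.exp (C + C ^ 2 + 1 + ‖τ‖ ^ 2 * (1 + K₂ + 162 * m * K₂ ^ 2) * N +
          τ.re * Real.log (1 - r)) * (‖deriv φ z‖ ^ 2 * Real.exp (t * (x - 1)))) := by
        apply ENNReal.ofReal_le_ofReal
        rw [hexp, Complex.norm_exp, ← Real.exp_add, ← Real.exp_add, hre]
        apply Real.exp_le_exp.mpr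
        linarith
    _ ≤ _ := by
        rw [ENNReal.ofReal_mul (Real.exp_pos _).le, ENNReal.ofReal_mul (by positivity)]
        gcongr
        exact hWt _ _ hx

theorem integralMean_le_of_lintegral_le {σ : ℂ} {c : ℝ} (hc : 0 ≤ c)
    (h : ∫⁻ θ in Ioo (-Real.pi) Real.pi, ENNReal.ofReal
      ‖Complex.exp (σ * logDerivative φ ((r : ℂ) * Complex.exp ((θ : ℂ) * Complex.I)))‖ ≤
        ENNReal.ofReal c) : integralMean φ σ r ≤ c := by
  have hπ := Real.pi_gt_three
  rw [integralMean, intervalIntegral.integral_of_le (by linarith),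
    ← MeasureTheory.restrict_Ioo_eq_restrict_Ioc]
  have h1 := ENNReal.toReal_mono ENNReal.ofReal_ne_top h
  rw [ENNReal.toReal_ofReal hc] at h1
  by_cases hm : AEStronglyMeasurable (fun θ : ℝ =>
    ‖Complex.exp (σ * logDerivative φ ((r : ℂ) * Complex.exp ((θ : ℂ) * Complex.I)))‖)
      (volume.restrict (Ioo (-Real.pi) Real.pi))
  · rw [integral_eq_lintegral_of_nonneg_ae (ae_of_all _ fun _ => norm_nonneg _) hm]
    refine (mul_le_mul_of_nonneg_left h1 (by positivity)).trans ?_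
    rw [div_mul_eq_mul_div, one_mul]
    exact div_le_self hc (by linarith)
  · rw [integral_undef fun hi => hm hi.aestronglyMeasurable, mul_zero]
    exact hc

end ExponentialDomination

section UpperBound

variable {φ : ℂ → ℂ} {K : ℝ} {N : ℕ} {r : ℝ} {τ : ℂ}

theorem BoundedSchlicht.continuous_circle (hφ : BoundedSchlicht φ) (hr : 0 ≤ r) (hr1 : r < 1)
    (σ : ℂ) : Continuous fun θ : ℝ =>
      ‖Complex.exp (σ * logDerivative φ ((r : ℂ) * Complex.exp ((θ : ℂ) * Complex.I)))‖ := by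
  refine continuous_norm.comp (Complex.continuous_exp.comp (continuous_const.mul ?_))
  have h : ContinuousOn (logDerivative φ) (ball 0 1) := fun z hz =>
    (hφ.hasDerivAt_logDerivative hz).continuousAt.continuousWithinAt
  refine h.comp_continuous (by fun_prop) fun θ => ?_
  rw [mem_ball_zero_iff, norm_ofReal_mul (Complex.norm_exp_ofReal_mul_I θ) hr]
  exact hr1

theorem IsDistortionConst.norm_exp_le (hK : IsDistortionConst K) (hφ : BoundedSchlicht φ) {σ : ℂ}
    (hσ : ‖σ‖ ≤ 3) {ξ ξ' : ℂ} (hξ : ξ ∈ ball (0 : ℂ) 1) (h : ‖ξ' - ξ‖ ≤ 7 / 8 * (1 - ‖ξ‖)) :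
    ‖Complex.exp (σ * logDerivative φ ξ)‖ ≤
      Real.exp (3 * K) * ‖Complex.exp (σ * logDerivative φ ξ')‖ := by
  have hK1 := hK.one_le
  rw [Complex.norm_exp, Complex.norm_exp, ← Real.exp_add, Real.exp_le_exp, ← sub_le_iff_le_add,
    ← Complex.sub_re, ← mul_sub]
  refine (Complex.re_le_norm _).trans ?_
  rw [norm_mul, norm_sub_rev]
  exact mul_le_mul hσ (hK.log_sub_le hφ hξ h) (norm_nonneg _) (by norm_num)

theorem mul_log_le {x u v : ℝ} (hx : |x| ≤ 1) (hv : 0 < v) (h1 : v / 2 ≤ u) (h2 : u ≤ v) :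
    x * Real.log u ≤ 1 + x * Real.log v := by
  have h3 : Real.log u ≤ Real.log v := Real.log_le_log (by linarith) h2
  have h4 : Real.log v - Real.log 2 ≤ Real.log u := by
    rw [← Real.log_div hv.ne' (by norm_num)]
    exact Real.log_le_log (by linarith) h1
  have h5 : |Real.log u - Real.log v| ≤ 1 := by
    rw [abs_le]
    constructor <;> linarith [Real.log_two_lt_d9]
  have h6 := (le_abs_self (x * (Real.log u - Real.log v)))
  rw [abs_mul] at h6
  have h7 : |x| * |Real.log u - Real.log v| ≤ 1 * 1 :=
    mul_le_mul hx h5 (abs_nonneg _) (by norm_num)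
  linarith

/-- The upper bound for the integral means spectrum of a bounded univalent function near `2`. -/
theorem IsDistortionConst.meansSpectrum_le (hK : IsDistortionConst K)
    (hφ : BoundedSchlicht φ) (hτ0 : τ ≠ 0) (hτ1 : ‖τ‖ ≤ 1) {m : ℕ} (hm1 : 1 ≤ m)
    (hm : 2 * 1024 < ‖τ‖ / (2 * K * (1 + 512 * K ^ 2)) * 2 ^ m) {β : ℝ} (hβ0 : 0 < β)
    (hβ : 1 - τ.re + 2 * (‖τ‖ ^ 2 * (1 + 8 * K ^ 2 * (1 + 512 * K ^ 2) ^ 2 +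
            162 * m * (8 * K ^ 2 * (1 + 512 * K ^ 2) ^ 2) ^ 2)) ≤ β) :
    meansSpectrum φ (2 - τ) ≤ β := by
  obtain ⟨R, hR⟩ := hφ.bdd.exists_norm_le
  have hR' : ∀ ξ ∈ ball (0 : ℂ) 1, ‖φ ξ‖ ≤ R := fun ξ hξ => hR _ (mem_image_of_mem φ hξ)
  have hR0 : 0 ≤ R := (norm_nonneg _).trans (hR' 0 (mem_ball_self one_pos))
  set s : ℝ := 2 * R + 1 with hs
  have hs0 : 0 < s := by linarith
  obtain ⟨A, W, hW, hAW⟩ := hK.exists_dominating_cexp hφ hs0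
    (fun ξ hξ => (hR' ξ hξ).trans (by linarith)) hτ0 hτ1 hm1 hm
  set b := ‖τ‖ ^ 2 * (1 + 8 * K ^ 2 * (1 + 512 * K ^ 2) ^ 2 +
            162 * m * (8 * K ^ 2 * (1 + 512 * K ^ 2) ^ 2) ^ 2) with hb
  have hb0 : 0 ≤ b := by positivity
  have hint := lintegral_image_le_of_cells hφ (s := s)
    (fun ξ hξ => lt_of_le_of_lt (hR' ξ hξ) (by linarith)) hW
  have hσ : ‖2 - τ‖ ≤ 3 := (norm_sub_le _ _).trans (by norm_num; linarith)
  refine sInf_le ⟨β, rfl, hβ0, ?_⟩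
  refine IsBigO.of_bound (Real.exp (3 * K + A + 1) * (8 * s ^ 2) * 4) ?_
  filter_upwards [Ico_mem_nhdsLT (show (1 / 2 : ℝ) < 1 by norm_num)] with r hr
  obtain ⟨hr2, hr1⟩ := hr
  have hr0 : 0 < 1 - r := by linarith
  obtain ⟨N, hN, hgen⟩ := exists_isGeneration hr2 hr1
  set c : ℝ := Real.exp (3 * K + A + 1 + b * N + τ.re * Real.log (1 - r)) with hc
  have h1 := lintegral_circle_le (F := fun ξ => ENNReal.ofReal c *
      (ENNReal.ofReal (‖deriv φ ξ‖ ^ 2) * W (φ ξ)))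
    (hφ.continuous_circle (r := r) (by linarith) hr1 (2 - τ)).measurable.ennreal_ofReal
    (r := r) (r' := r + (1 - r) / 2) (by linarith) (by linarith) (by
      intro u hu θ
      have he := Complex.norm_exp_ofReal_mul_I θ
      set e := Complex.exp ((θ : ℂ) * Complex.I)
      have hrn := norm_ofReal_mul he (s := r) (by linarith)
      have h2 := hK.norm_exp_le hφ hσ (ξ := (r : ℂ) * e) (ξ' := (u : ℂ) * e)
        (ofReal_mul_mem he (by linarith) hr1) (by
          rw [hrn, norm_ofReal_mul_sub he hu.1]
          linarith [hu.2])
      refine (ENNReal.ofReal_le_ofReal h2).trans ?_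
      rw [ENNReal.ofReal_mul (Real.exp_pos _).le]
      refine (mul_le_mul_right (hAW (hgen u hu) he) _).trans ?_
      rw [← mul_assoc, ← ENNReal.ofReal_mul (Real.exp_pos _).le, ← Real.exp_add]
      gcongr
      have h3 := mul_log_le (x := τ.re) (u := 1 - u) (v := 1 - r)
        ((Complex.abs_re_le_norm τ).trans hτ1) hr0 (by linarith [hu.2]) (by linarith [hu.1])
      rw [hc, Real.exp_le_exp]
      linarith)
  rw [lintegral_const_mul' _ _ ENNReal.ofReal_ne_top] at h1
  have h2 := h1.trans (mul_le_mul_right hint _)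
  have h3 : integralMean φ (2 - τ) r ≤ c * (8 * s ^ 2) * 4 / (1 - r) := by
    refine integralMean_le_of_lintegral_le (by positivity) ?_
    have e1 : ENNReal.ofReal c * (4 * (2 * ENNReal.ofReal (s ^ 2))) =
        ENNReal.ofReal (c * (8 * s ^ 2)) := by
      have hc0 : 0 ≤ c := (Real.exp_pos _).le
      rw [ENNReal.ofReal_mul hc0, ENNReal.ofReal_mul (by norm_num), ← mul_assoc 4]
      norm_num
    rw [e1, mul_comm] at h2
    have hq : 0 < r * (r + (1 - r) / 2 - r) := mul_pos (by linarith) (by linarith)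
    rw [← ENNReal.le_div_iff_mul_le (Or.inl (by simpa using hq)) (Or.inl ENNReal.ofReal_ne_top),
      ← ENNReal.ofReal_div_of_pos hq] at h2
    refine h2.trans (ENNReal.ofReal_le_ofReal ?_)
    rw [div_le_div_iff₀ hq hr0]
    have h4 : 0 ≤ c * (8 * s ^ 2) := by positivity
    nlinarith [mul_nonneg h4 hr0.le]
  have hlog : Real.log (1 - r) ≤ 0 := Real.log_nonpos hr0.le (by linarith)
  have h4 : c / (1 - r) ≤ Real.exp (3 * K + A + 1) * (1 / (1 - r) ^ β) := by
    rw [one_div, ← Real.rpow_neg hr0.le, Real.rpow_def_of_pos hr0, ← Real.exp_add, hc]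
    nth_rewrite 2 [← Real.exp_log hr0]
    rw [← Real.exp_sub, Real.exp_le_exp]
    nlinarith [mul_le_mul_of_nonneg_left hN hb0,
      mul_nonneg (sub_nonneg.mpr hβ) (neg_nonneg.mpr hlog)]
  have hM0 : 0 ≤ integralMean φ (2 - τ) r := by
    unfold integralMean
    have := Real.pi_pos
    refine mul_nonneg (by positivity) (intervalIntegral.integral_nonneg (by linarith)
      fun _ _ => norm_nonneg _)
  rw [Real.norm_of_nonneg hM0, Real.norm_of_nonneg (by positivity)]
  calc _ ≤ c * (8 * s ^ 2) * 4 / (1 - r) := h3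
    _ = c / (1 - r) * ((8 * s ^ 2) * 4) := by ring
    _ ≤ Real.exp (3 * K + A + 1) * (1 / (1 - r) ^ β) * ((8 * s ^ 2) * 4) := by gcongr
    _ = _ := by ring

end UpperBound

section Spectrum

/-- The conformal map of the disk onto a domain with a corner at the boundary, whose derivative is
`(1 - z) ^ (-α)`. -/
def cornerMap (α : ℝ) (z : ℂ) : ℂ :=
  (1 - Complex.exp (((1 - α : ℝ) : ℂ) * Complex.log (1 - z))) / ((1 - α : ℝ) : ℂ)

variable {α : ℝ} {z : ℂ}

theorem one_sub_re_pos (hz : z ∈ ball (0 : ℂ) 1) : 0 < (1 - z).re := by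
  rw [mem_ball_zero_iff] at hz
  have := Complex.re_le_norm z
  simp only [Complex.sub_re, Complex.one_re]
  linarith

theorem one_sub_mem_slitPlane (hz : z ∈ ball (0 : ℂ) 1) : 1 - z ∈ Complex.slitPlane :=
  Or.inl (one_sub_re_pos hz)

theorem abs_log_one_sub_im_lt (hz : z ∈ ball (0 : ℂ) 1) :
    |(Complex.log (1 - z)).im| < Real.pi / 2 := by
  rw [Complex.log_im, Complex.abs_arg_lt_pi_div_two_iff]
  exact Or.inl (one_sub_re_pos hz)

theorem hasDerivAt_log_one_sub (hz : z ∈ ball (0 : ℂ) 1) :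
    HasDerivAt (fun z => Complex.log (1 - z)) (-1 / (1 - z)) z :=
  ((hasDerivAt_id z).const_sub 1).clog (one_sub_mem_slitPlane hz)

theorem hasDerivAt_cornerMap (hα : α < 1) (hz : z ∈ ball (0 : ℂ) 1) :
    HasDerivAt (cornerMap α) (Complex.exp (-α * Complex.log (1 - z))) z := by
  have h := ((((hasDerivAt_log_one_sub hz).const_mul ((1 - α : ℝ) : ℂ)).cexp).const_sub 1).div_const
    ((1 - α : ℝ) : ℂ)
  refine h.congr_deriv ?_
  have h0 : ((1 - α : ℝ) : ℂ) ≠ 0 := by exact_mod_cast (by linarith : 1 - α ≠ 0)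
  have h1 : 1 - z ≠ 0 := Complex.slitPlane_ne_zero (one_sub_mem_slitPlane hz)
  have h2 : Complex.exp (((1 - α : ℝ) : ℂ) * Complex.log (1 - z)) =
      (1 - z) * Complex.exp (-α * Complex.log (1 - z)) := by
    nth_rewrite 2 [← Complex.exp_log h1]
    rw [← Complex.exp_add]
    congr 1
    push_cast
    ring
  rw [h2]
  field_simp

theorem boundedSchlicht_cornerMap (hα0 : 0 < α) (hα : α < 1) : BoundedSchlicht (cornerMap α) where
  holo z hz := (hasDerivAt_cornerMap hα hz).differentiableAt.differentiableWithinAt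
  inj z hz w hw h := by
    have h0 : ((1 - α : ℝ) : ℂ) ≠ 0 := by exact_mod_cast (by linarith : 1 - α ≠ 0)
    have him : ∀ {z : ℂ}, z ∈ ball (0 : ℂ) 1 →
        |(((1 - α : ℝ) : ℂ) * Complex.log (1 - z)).im| < Real.pi := by
      intro z hz
      rw [Complex.im_ofReal_mul, abs_mul, abs_of_pos (by linarith)]
      nlinarith [abs_log_one_sub_im_lt hz, abs_nonneg (Complex.log (1 - z)).im, Real.pi_pos]
    have h1 : Complex.exp (((1 - α : ℝ) : ℂ) * Complex.log (1 - z)) =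
        Complex.exp (((1 - α : ℝ) : ℂ) * Complex.log (1 - w)) := by
      unfold cornerMap at h
      rw [div_left_inj' h0] at h
      exact sub_right_injective h
    have h2 := Complex.exp_inj_of_neg_pi_lt_of_le_pi (abs_lt.mp (him hz)).1 (abs_lt.mp (him hz)).2.le
      (abs_lt.mp (him hw)).1 (abs_lt.mp (him hw)).2.le h1
    have h3 := mul_left_cancel₀ h0 h2
    have h4 := congrArg Complex.exp h3
    rw [Complex.exp_log (Complex.slitPlane_ne_zero (one_sub_mem_slitPlane hz)),
      Complex.exp_log (Complex.slitPlane_ne_zero (one_sub_mem_slitPlane hw))] at h4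
    exact sub_right_injective h4
  map_zero := by simp [cornerMap]
  deriv_zero := by
    rw [(hasDerivAt_cornerMap hα (mem_ball_self one_pos)).deriv]
    simp
  bdd := by
    refine isBounded_iff_forall_norm_le.mpr ⟨(1 + 2) / (1 - α), ?_⟩
    rintro _ ⟨z, hz, rfl⟩
    have h1 : 1 - z ≠ 0 := Complex.slitPlane_ne_zero (one_sub_mem_slitPlane hz)
    rw [mem_ball_zero_iff] at hz
    rw [cornerMap, norm_div, Complex.norm_real, Real.norm_of_nonneg (by linarith)]
    refine div_le_div_of_nonneg_right ((norm_sub_le _ _).trans ?_) (by linarith)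
    rw [norm_one]
    refine add_le_add le_rfl ?_
    rw [Complex.norm_exp, Complex.re_ofReal_mul, Complex.log_re]
    have h2 : ‖1 - z‖ ≤ 2 := by
      refine (norm_sub_le _ _).trans ?_
      rw [norm_one]
      linarith
    have h3 : Real.log ‖1 - z‖ ≤ Real.log 2 := Real.log_le_log (norm_pos_iff.mpr h1) h2
    have h4 : (0 : ℝ) < Real.log 2 := Real.log_pos (by norm_num)
    calc Real.exp ((1 - α) * Real.log ‖1 - z‖) ≤ Real.exp (Real.log 2) := by
          apply Real.exp_le_exp.mpr
          nlinarith
      _ = 2 := Real.exp_log (by norm_num)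

theorem logDerivative_cornerMap (hα0 : 0 < α) (hα : α < 1) (hz : z ∈ ball (0 : ℂ) 1) :
    logDerivative (cornerMap α) z = -α * Complex.log (1 - z) := by
  have hφ := boundedSchlicht_cornerMap hα0 hα
  have h00 : (0 : ℂ) ∈ ball (0 : ℂ) 1 := mem_ball_self one_pos
  have hs := logDerivative_spec hφ.holo hφ.deriv_zero fun _ hz => hφ.deriv_ne_zero hz
  refine eqOn_of_exp_eq (convex_ball (0 : ℂ) 1).isPreconnected hs.2.1.continuousOn
    (fun z hz => ((hasDerivAt_log_one_sub hz).const_mul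
      (-α : ℂ)).continuousAt.continuousWithinAt) ?_ h00 ?_ hz
  · intro z hz
    rw [hφ.exp_logDerivative hz, (hasDerivAt_cornerMap hα hz).deriv]
  · simp [hs.1]

theorem norm_exp_cornerMap_ge (hα0 : 0 < α) (hα : α < 1) {τ : ℂ} (hτ : ‖τ‖ ≤ 1) {r θ : ℝ}
    (hr : 0 ≤ r) (hr1 : r < 1) (hθ : |θ| ≤ 1 - r) :
    Real.exp (-5) * (1 - r) ^ (-(α * (2 - τ.re))) ≤
      ‖Complex.exp ((2 - τ) * logDerivative (cornerMap α)
        ((r : ℂ) * Complex.exp ((θ : ℂ) * Complex.I)))‖ := by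
  have hr0 : 0 < 1 - r := by linarith
  have hz := ofReal_mul_mem (Complex.norm_exp_ofReal_mul_I θ) hr hr1
  have h1 : ‖1 - (r : ℂ) * Complex.exp ((θ : ℂ) * Complex.I)‖ ≤ 2 * (1 - r) := by
    have e1 : 1 - (r : ℂ) * Complex.exp ((θ : ℂ) * Complex.I) =
        ((1 - r : ℝ) : ℂ) + (r : ℂ) * -(Complex.exp ((θ : ℂ) * Complex.I) - 1) := by
      push_cast
      ring
    rw [e1]
    refine (norm_add_le _ _).trans ?_
    rw [norm_mul, norm_neg, Complex.norm_real, Complex.norm_real, Real.norm_of_nonneg hr,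
      Real.norm_of_nonneg hr0.le]
    have h2 : ‖Complex.exp ((θ : ℂ) * Complex.I) - 1‖ ≤ |θ| := by
      have := Real.norm_exp_I_mul_ofReal_sub_one_le (x := θ)
      rwa [mul_comm, Real.norm_eq_abs] at this
    nlinarith [norm_nonneg (Complex.exp ((θ : ℂ) * Complex.I) - 1)]
  set z := (r : ℂ) * Complex.exp ((θ : ℂ) * Complex.I)
  have hne : 1 - z ≠ 0 := Complex.slitPlane_ne_zero (one_sub_mem_slitPlane hz)
  have h2 : Real.log ‖1 - z‖ ≤ Real.log 2 + Real.log (1 - r) := by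
    rw [← Real.log_mul (by norm_num) hr0.ne']
    exact Real.log_le_log (norm_pos_iff.mpr hne) h1
  have h3 : |(Complex.log (1 - z)).im| ≤ 2 :=
    (abs_log_one_sub_im_lt hz).le.trans (by linarith [Real.pi_le_four])
  have h4 : |τ.im| ≤ 1 := (Complex.abs_im_le_norm τ).trans hτ
  have h5 : |τ.re| ≤ 1 := (Complex.abs_re_le_norm τ).trans hτ
  rw [logDerivative_cornerMap hα0 hα hz, Complex.norm_exp, Real.rpow_def_of_pos hr0, ← Real.exp_add,
    Real.exp_le_exp]
  have e2 : ((2 - τ) * (-α * Complex.log (1 - z))).re =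
      -(α * (2 - τ.re)) * Real.log ‖1 - z‖ - α * (τ.im * (Complex.log (1 - z)).im) := by
    rw [← Complex.log_re]
    simp only [Complex.mul_re, Complex.sub_re, Complex.sub_im, Complex.mul_im, Complex.neg_re,
      Complex.neg_im, Complex.ofReal_re, Complex.ofReal_im, Complex.re_ofNat, Complex.im_ofNat]
    ring
  rw [e2]
  have h6 : |τ.im * (Complex.log (1 - z)).im| ≤ 1 * 2 := by
    rw [abs_mul]
    exact mul_le_mul h4 h3 (abs_nonneg _) (by norm_num)
  obtain ⟨h7, h8⟩ := abs_le.mp h6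
  obtain ⟨h9, h10⟩ := abs_le.mp h5
  have h11 : 0 ≤ α * (2 - τ.re) := mul_nonneg hα0.le (by linarith)
  have h12 : α * (2 - τ.re) ≤ 3 := by nlinarith
  nlinarith [mul_le_mul_of_nonneg_left h2 h11, Real.log_two_lt_d9, Real.log_two_gt_d9]

theorem integralMean_cornerMap_ge (hα0 : 0 < α) (hα : α < 1) {τ : ℂ} (hτ : ‖τ‖ ≤ 1) {r : ℝ}
    (hr : 0 ≤ r) (hr1 : r < 1) :
    Real.exp (-5) / Real.pi * (1 - r) ^ (1 - α * (2 - τ.re)) ≤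
      integralMean (cornerMap α) (2 - τ) r := by
  have hr0 : 0 < 1 - r := by linarith
  have hπ := Real.pi_gt_three
  have hc := (boundedSchlicht_cornerMap hα0 hα).continuous_circle hr hr1 (2 - τ)
  have h1 : ∫ _ in (-(1 - r))..(1 - r), Real.exp (-5) * (1 - r) ^ (-(α * (2 - τ.re))) ≤
      ∫ θ in (-Real.pi)..Real.pi, ‖Complex.exp ((2 - τ) * logDerivative (cornerMap α)
        ((r : ℂ) * Complex.exp ((θ : ℂ) * Complex.I)))‖ := by
    refine (intervalIntegral.integral_mono_on (by linarith) intervalIntegrable_const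
      (hc.intervalIntegrable _ _) fun θ hθ =>
        norm_exp_cornerMap_ge hα0 hα hτ hr hr1 (abs_le.mpr hθ)).trans ?_
    exact intervalIntegral.integral_mono_interval (by linarith) (by linarith) (by linarith)
      (ae_of_all _ fun _ => norm_nonneg _) (hc.intervalIntegrable _ _)
  rw [intervalIntegral.integral_const, smul_eq_mul] at h1
  rw [integralMean]
  refine le_trans (le_of_eq ?_) (mul_le_mul_of_nonneg_left h1 (by positivity))
  rw [sub_eq_add_neg 1 (α * _), Real.rpow_add hr0, Real.rpow_one]
  field_simp
  ring

theorem le_meansSpectrum_cornerMap (hα0 : 0 < α) (hα : α < 1) {τ : ℂ} (hτ : ‖τ‖ ≤ 1) :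
    ((α * (2 - τ.re) - 1 : ℝ) : EReal) ≤ meansSpectrum (cornerMap α) (2 - τ) := by
  refine le_sInf ?_
  rintro _ ⟨β, rfl, hβ0, hβ⟩
  rw [EReal.coe_le_coe_iff]
  by_contra! hlt
  obtain ⟨C, hC⟩ := hβ.bound
  have h0 : Tendsto (fun r : ℝ => 1 - r) (𝓝[<] 1) (𝓝[>] 0) := by
    refine tendsto_nhdsWithin_iff.mpr ⟨?_, ?_⟩
    · have : Tendsto (fun r : ℝ => 1 - r) (𝓝 1) (𝓝 (1 - 1)) := by
        exact (continuous_const.sub continuous_id).tendsto 1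
      rw [sub_self] at this
      exact this.mono_left nhdsWithin_le_nhds
    · filter_upwards [self_mem_nhdsWithin] with r hr
      exact sub_pos.mpr (mem_Iio.mp hr)
  have h1 := (tendsto_rpow_neg_nhdsGT_zero (y := 1 - α * (2 - τ.re) + β) (by linarith)).comp h0
  have h2 := h1.eventually_gt_atTop (C / (Real.exp (-5) / Real.pi))
  obtain ⟨r, hr, hr1, hr2, hr3⟩ := (hC.and (h2.and
    (Ico_mem_nhdsLT (show (0 : ℝ) < 1 by norm_num)))).exists
  have hr0 : 0 < 1 - r := by linarith
  have hπ := Real.pi_pos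
  have h3 := integralMean_cornerMap_ge hα0 hα hτ hr2 hr3
  have h4 := h3.trans ((le_abs_self _).trans hr)
  rw [Real.norm_of_nonneg (by positivity), mul_one_div, le_div_iff₀ (by positivity), mul_assoc,
    ← Real.rpow_add hr0] at h4
  simp only [Function.comp_apply] at hr1
  rw [div_lt_iff₀ (by positivity)] at hr1
  linarith

/-- The lower bound for the universal spectrum, given by the corner maps. -/
theorem le_universalSpectrum {τ : ℂ} (hτ : ‖τ‖ ≤ 1) :
    ((1 - τ.re : ℝ) : EReal) ≤ universalSpectrum (2 - τ) := by
  have h1 : Tendsto (fun α : ℝ => ((α * (2 - τ.re) - 1 : ℝ) : EReal)) (𝓝[<] 1)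
      (𝓝 ((1 - τ.re : ℝ) : EReal)) := by
    have h2 : Continuous fun α : ℝ => ((α * (2 - τ.re) - 1 : ℝ) : EReal) :=
      continuous_coe_real_ereal.comp (by fun_prop)
    have h3 := (h2.tendsto 1).mono_left (nhdsWithin_le_nhds (s := Iio 1))
    rwa [show (1 : ℝ) * (2 - τ.re) - 1 = 1 - τ.re by ring] at h3
  refine le_of_tendsto h1 ?_
  filter_upwards [Ioo_mem_nhdsLT (show (0 : ℝ) < 1 by norm_num)] with α hα
  exact (le_meansSpectrum_cornerMap hα.1 hα.2 hτ).trans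
    (le_sSup ⟨_, boundedSchlicht_cornerMap hα.1 hα.2, rfl⟩)

/-- The upper bound for the universal spectrum near `2`. -/
theorem exists_universalSpectrum_le : ∃ C : ℝ, 0 ≤ C ∧ ∀ τ : ℂ, τ ≠ 0 → ‖τ‖ ≤ Real.exp (-1) →
    universalSpectrum (2 - τ) ≤
      ((1 - τ.re + C * (‖τ‖ ^ 2 * Real.log (1 / ‖τ‖)) : ℝ) : EReal) := by
  obtain ⟨K, hK⟩ := exists_isDistortionConst
  have hK1 := hK.one_le
  set L := 1 + 512 * K ^ 2 with hL
  have hL1 : 1 ≤ L := by rw [hL]; nlinarith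
  set K₂ := 8 * K ^ 2 * L ^ 2 with hK₂
  have hKL : 1 ≤ K * L := one_le_mul_of_one_le_of_one_le hK1 hL1
  set E := Real.log (4096 * (K * L)) with hE
  have hE0 : 0 ≤ E := Real.log_nonneg (by linarith)
  refine ⟨2 * (1 + K₂ + 162 * (2 * E + 3) * K₂ ^ 2), by positivity, fun τ hτ0 hτ => ?_⟩
  have hτp := norm_pos_iff.mpr hτ0
  have hτ1 : ‖τ‖ < 1 := hτ.trans_lt (by rw [Real.exp_lt_one_iff]; norm_num)
  set l := Real.log (1 / ‖τ‖) with hl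
  have hl1 : 1 ≤ l := by
    rw [hl, one_div, Real.log_inv]
    have := Real.log_le_log hτp hτ
    rw [Real.log_exp] at this
    linarith
  set m := ⌊2 * (E + l)⌋₊ + 1 with hm
  have hm2 : 2 * (E + l) < m := by
    rw [hm]
    exact_mod_cast Nat.lt_floor_add_one _
  have hm3 : (m : ℝ) ≤ (2 * E + 3) * l := by
    have : (⌊2 * (E + l)⌋₊ : ℝ) ≤ 2 * (E + l) := Nat.floor_le (by positivity)
    rw [hm]
    push_cast
    nlinarith
  have hpow : 4096 * (K * L) / ‖τ‖ < 2 ^ m := by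
    have e1 : 4096 * (K * L) / ‖τ‖ = Real.exp (E + l) := by
      rw [Real.exp_add, hE, hl, Real.exp_log (by positivity), Real.exp_log (by positivity)]
      ring
    have e2 : (2 : ℝ) ^ m = Real.exp (m * Real.log 2) := by
      rw [Real.exp_nat_mul, Real.exp_log (by norm_num)]
    rw [e1, e2, Real.exp_lt_exp]
    nlinarith [Real.log_two_gt_d9, (Nat.cast_nonneg m : (0 : ℝ) ≤ m)]
  have hre : τ.re < 1 := (Complex.re_le_norm τ).trans_lt hτ1
  refine sSup_le ?_
  rintro _ ⟨φ, hφ, rfl⟩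
  refine hK.meansSpectrum_le hφ hτ0 hτ1.le (m := m) (by omega) ?_ ?_ ?_
  · rw [div_lt_iff₀ hτp] at hpow
    rw [div_mul_eq_mul_div, lt_div_iff₀ (by positivity)]
    linarith
  · have : 0 ≤ 2 * (1 + K₂ + 162 * (2 * E + 3) * K₂ ^ 2) * (‖τ‖ ^ 2 * l) := by positivity
    linarith
  · rw [← hL, ← hK₂]
    have h1 : 1 + K₂ + 162 * m * K₂ ^ 2 ≤ (1 + K₂ + 162 * (2 * E + 3) * K₂ ^ 2) * l := by
      have h2 : 1 + K₂ ≤ (1 + K₂) * l := le_mul_of_one_le_right (by positivity) hl1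
      have h3 : 162 * m * K₂ ^ 2 ≤ 162 * ((2 * E + 3) * l) * K₂ ^ 2 := by gcongr
      linarith
    have h2 := mul_le_mul_of_nonneg_left h1 (sq_nonneg ‖τ‖)
    linarith

end Spectrum

end IntegralMeans

end

theorem corollary1p2 :
    (∀ᶠ τ : ℂ in 𝓝[≠] 0, IntegralMeans.universalSpectrum (2 - τ) ≠ ⊥ ∧
      IntegralMeans.universalSpectrum (2 - τ) ≠ ⊤) ∧
    (fun τ : ℂ => (IntegralMeans.universalSpectrum (2 - τ)).toReal - (1 - τ.re))
      =O[𝓝[≠] 0] fun τ : ℂ => ‖τ‖ ^ 2 * Real.log (1 / ‖τ‖) := by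
  obtain ⟨C, hC, hup⟩ := IntegralMeans.exists_universalSpectrum_le
  have hsmall : ∀ᶠ τ : ℂ in 𝓝[≠] 0, τ ≠ 0 ∧ ‖τ‖ ≤ Real.exp (-1) := by
    refine eventually_mem_nhdsWithin.and (nhdsWithin_le_nhds ?_)
    filter_upwards [Metric.closedBall_mem_nhds (0 : ℂ) (Real.exp_pos (-1))] with τ hτ
    rwa [mem_closedBall_zero_iff] at hτ
  have hone : Real.exp (-1) ≤ 1 := Real.exp_le_one_iff.mpr (by norm_num)
  constructor
  · filter_upwards [hsmall] with τ hτ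
    exact ⟨ne_bot_of_le_ne_bot (EReal.coe_ne_bot _)
      (IntegralMeans.le_universalSpectrum (hτ.2.trans hone)),
      ne_top_of_le_ne_top (EReal.coe_ne_top _) (hup τ hτ.1 hτ.2)⟩
  · refine IsBigO.of_bound C ?_
    filter_upwards [hsmall] with τ hτ
    have h1 := IntegralMeans.le_universalSpectrum (hτ.2.trans hone)
    have h2 := hup τ hτ.1 hτ.2
    have hb := ne_bot_of_le_ne_bot (EReal.coe_ne_bot _) h1
    have ht := ne_top_of_le_ne_top (EReal.coe_ne_top _) h2
    rw [← EReal.coe_toReal ht hb, EReal.coe_le_coe_iff] at h1 h2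
    have hlog : 0 ≤ Real.log (1 / ‖τ‖) := by
      rw [one_div, Real.log_inv]
      linarith [Real.log_nonpos (norm_nonneg τ) (hτ.2.trans hone)]
    rw [Real.norm_of_nonneg (by linarith), Real.norm_of_nonneg (by positivity)]
    linarith
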